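/- Let $d\ge 1$, $\omega\in\mathbb R^d$, $\mathbb T=\mathbb R/\mathbb Z$, and let $a,b,c\in C^\omega(\mathbb T^d,\mathbb R)$ be real analytic. Put $$L(\theta,x,\xi)=\tfrac12\big(a(\theta)x^2+b(\theta)x\xi+b(\theta)\xi x+c(\theta)\xi^2\big),\qquad A(\theta)=\begin{pmatrix} b(\theta)&c(\theta)\\-a(\theta)&-b(\theta)\end{pmatrix},$$ and let $L^W(\theta)=\tfrac12\big(a(\theta)x^2-\mathrm i\,b(\theta)(x\partial_x+\partial_x x)-c(\theta)\partial_x^2\big)$ be the Weyl quantization of $L(\theta,\cdot,\cdot)$ on $L^2(\mathbb R)$. Let $H_0=-\partial_x^2+x^2$, and for $s\ge 0$ let $\mathcal H^s$ be the domain of $H_0^{s/2}$, with norm $\|\psi\|_s=\|H_0^{s/2}\psi\|_{L^2}$. Assume that there are $B\in \mathrm{sl}(2,\mathbb R)$, $K\ge 0$ and real analytic $Z_0,\dots,Z_K\in C^\omega(2\mathbb T^d,\mathrm{sl}(2,\mathbb R))$, where $2\mathbb T=\mathbb R/2\mathbb Z$, such that $Y=e^{Z_0}e^{Z_1}\cdots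 e^{Z_K}$ satisfies $$\frac{d}{dt}Y(\omega t)=A(\omega t)Y(\omega t)-Y(\omega t)B\qquad\text{for all }t\in\mathbb R .$$ Let $G=\tfrac12\big(-B_{21}x^2-\mathrm i\,B_{11}(x\partial_x+\partial_x x)-B_{12}\partial_x^2\big)$, where $B_{ij}$ is the entry of $B$ in row $i$ and column $j$. Then there is a family of unitary operators $U(\theta)$ on $L^2(\mathbb R)$, $\theta\in 2\mathbb T^d$, such that: * $\theta\mapsto U(\theta)h$ is a real analytic map into $L^2(\mathbb R)$ for every Hermite function $h$; * for every $s\ge 0$ there are constants $c',C'>0$ with $c'\|\psi\|_s\le\|U(\theta)\psi\|_s\le C'\|\psi\|_s$ for all $\theta$ and all $\psi\in\mathcal H^s$; * the equation $\mathrm i\partial_t u=L^W(\omega t)u$ is conjugated to the time-independent equation $\mathrm i\partial_t v=Gv$ by $u(t)=U(\omega t)v(t)$: $u$ is a solution of the first equation if and only if $v$ is a solution of the second. Here a solution is a continuous $L^2(\mathbb R)$-valued function of $t\in\mathbb R$ that satisfies the equation when tested against every Schwartz function of $x$. Moreover, where all differential operators are taken with their maximal (distributional) domains in $L^2(\mathbb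 R)$: 1. if $\det B>0$ or $B=0$, then $G$ is unitarily equivalent to $\sigma\frac{\sqrt{\det B}}{2}H_0$, where $\sigma\in\{1,0,-1\}$ is the sign of $B_{12}$ (so $\sigma=\pm1$ when $\det B>0$, and the operator is $0$ when $B=0$); 2. if $\det B<0$, then $G$ is unitarily equivalent to $-\frac{\mathrm i\sqrt{-\det B}}{2}(x\partial_x+\partial_x x)$; 3. if $B=P\begin{pmatrix}0&0\\ \kappa&0\end{pmatrix}P^{-1}$ with $\kappa\ne0$ and $P\in \mathrm{SL}(2,\mathbb R)$, then $G$ is unitarily equivalent to multiplication by $-\frac{\kappa}{2}x^2$. -/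

import Mathlib

open MeasureTheory SchwartzMap

noncomputable section

/-! ### Analytic functions on tori, linear systems and their conjugation -/

/-- `f ∈ C^ω(p𝕋^d, ℝ)`, `𝕋 = ℝ/ℤ`: a real analytic function on `ℝ^d` that is `p ℤ^d`-periodic. -/
def IsAnalyticOnTorus {d : ℕ} (p : ℕ) (f : (Fin d → ℝ) → ℝ) : Prop :=
  AnalyticOnNhd ℝ f Set.univ ∧
    ∀ (θ : Fin d → ℝ) (k : Fin d → ℤ), f (fun i => θ i + (p : ℝ) * (k i : ℝ)) = f θ

/-- `Z ∈ C^ω(p𝕋^d, sl(2,ℝ))`. -/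
def IsAnalyticSl2OnTorus {d : ℕ} (p : ℕ) (Z : (Fin d → ℝ) → Matrix (Fin 2) (Fin 2) ℝ) : Prop :=
  (∀ i j, IsAnalyticOnTorus p (fun θ => Z θ i j)) ∧ ∀ θ, (Z θ).trace = 0

/-- The matrix of the linear Hamiltonian system of the symbol
`½ (a x² + b xξ + b ξx + c ξ²)`. -/
def hamMatrix (a b c : ℝ) : Matrix (Fin 2) (Fin 2) ℝ := !![b, c; -a, -b]

/-- `e^{Z_0(θ)} e^{Z_1(θ)} ⋯ e^{Z_K(θ)}`. -/
def prodExp {d K : ℕ} (Z : Fin (K + 1) → (Fin d → ℝ) → Matrix (Fin 2) (Fin 2) ℝ)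
    (θ : Fin d → ℝ) : Matrix (Fin 2) (Fin 2) ℝ :=
  (List.ofFn fun j => NormedSpace.exp (Z j θ)).prod

/-- The equation `d/dt Y(ωt) = A₁(ωt) Y(ωt) - Y(ωt) A₂(ωt)` for all `t ∈ ℝ`: the system
`X' = A₁(ωt) X` is conjugated to `X' = A₂(ωt) X` by `Y`. (For the products of exponentials to
which this is applied, `Y ∈ C^ω(2𝕋^d, SL(2,ℝ))` is automatic.) -/
def IsConjugatedBy {d : ℕ} (ω : Fin d → ℝ)
    (A₁ A₂ Y : (Fin d → ℝ) → Matrix (Fin 2) (Fin 2) ℝ) : Prop :=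
  ∀ (t : ℝ) (i j : Fin 2),
    HasDerivAt (fun τ : ℝ => Y (τ • ω) i j)
      ((A₁ (t • ω) * Y (t • ω) - Y (t • ω) * A₂ (t • ω)) i j) t

/-! ### Quadratic differential operators on Schwartz functions -/

/-- `L²(ℝ)`, complex valued. -/
abbrev L2R : Type := Lp ℂ 2 (volume : Measure ℝ)

/-- Multiplication by `x`. -/
def posOp : 𝓢(ℝ, ℂ) →L[ℂ] 𝓢(ℝ, ℂ) := smulLeftCLM ℂ (fun x : ℝ => (x : ℂ))

/-- The momentum operator `-i ∂_x`. -/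
def momOp : 𝓢(ℝ, ℂ) →L[ℂ] 𝓢(ℝ, ℂ) := (-Complex.I) • derivCLM ℂ ℂ

/-- The Weyl quantization of `½ (a x² + b xξ + b ξx + c ξ²)`, that is
`½ (a x² - i b (x ∂_x + ∂_x x) - c ∂_x²)`, on Schwartz functions. -/
def weylOp (a b c : ℝ) : 𝓢(ℝ, ℂ) →L[ℂ] 𝓢(ℝ, ℂ) :=
  (1 / 2 : ℂ) • ((a : ℂ) • (posOp ∘L posOp) + (b : ℂ) • (posOp ∘L momOp + momOp ∘L posOp) +
    (c : ℂ) • (momOp ∘L momOp))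

/-- The harmonic oscillator `H₀ = -∂_x² + x²`. -/
def harmonicOp : 𝓢(ℝ, ℂ) →L[ℂ] 𝓢(ℝ, ℂ) :=
  -(derivCLM ℂ ℂ ∘L derivCLM ℂ ℂ) + posOp ∘L posOp

/-- The generator of dilations `-i (x ∂_x + ∂_x x)`. -/
def dilationOp : 𝓢(ℝ, ℂ) →L[ℂ] 𝓢(ℝ, ℂ) :=
  (-Complex.I) • (posOp ∘L derivCLM ℂ ℂ + derivCLM ℂ ℂ ∘L posOp)

/-- Multiplication by `x²`. -/
def squareOp : 𝓢(ℝ, ℂ) →L[ℂ] 𝓢(ℝ, ℂ) := posOp ∘L posOp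

theorem posOp_apply (f : 𝓢(ℝ, ℂ)) (x : ℝ) : posOp f x = (x : ℂ) * f x := by
  have h : Function.HasTemperateGrowth (fun x : ℝ => (x : ℂ)) :=
    Complex.ofRealCLM.hasTemperateGrowth
  simp [posOp, smulLeftCLM_apply_apply h]

/-! ### Unbounded operators on `L²(ℝ)` -/

theorem eq_of_forall_schwartz_inner {w w' : L2R}
    (h : ∀ φ : 𝓢(ℝ, ℂ), inner ℂ (φ.toLp 2 : L2R) w = inner ℂ (φ.toLp 2 : L2R) w') : w = w' := by
  have hd : DenseRange (toLpCLM ℂ ℂ 2 (volume : Measure ℝ)) :=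
    denseRange_toLpCLM (F := ℂ) (p := 2) (by simp)
  refine ext_inner_left ℂ fun v => ?_
  refine hd.induction_on (p := fun v => inner ℂ v w = inner ℂ v w') v ?_ ?_
  · exact isClosed_eq (by fun_prop) (by fun_prop)
  · intro φ; exact h φ

/-- `w = Q u` in the sense of tempered distributions, for a formally symmetric differential
operator `Q` and `u, w ∈ L²(ℝ)`. -/
def IsDistribImage (Q : 𝓢(ℝ, ℂ) →L[ℂ] 𝓢(ℝ, ℂ)) (u w : L2R) : Prop :=
  ∀ φ : 𝓢(ℝ, ℂ), inner ℂ ((Q φ).toLp 2 : L2R) u = inner ℂ (φ.toLp 2 : L2R) w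

/-- The unbounded operator on `L²(ℝ)` defined by a formally symmetric differential operator `Q`:
its domain consists of the `u ∈ L²` with `Q u ∈ L²` in the sense of distributions. (For the
quadratic operators below, which are essentially self-adjoint on Schwartz functions, this is
the self-adjoint realization.) -/
def l2Op (Q : 𝓢(ℝ, ℂ) →L[ℂ] 𝓢(ℝ, ℂ)) : L2R →ₗ.[ℂ] L2R where
  domain :=
    { carrier := {u | ∃ w, IsDistribImage Q u w}
      add_mem' := by
        rintro u u' ⟨w, hw⟩ ⟨w', hw'⟩
        exact ⟨w + w', fun φ => by rw [inner_add_right, inner_add_right, hw φ, hw' φ]⟩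
      zero_mem' := ⟨0, fun φ => by simp⟩
      smul_mem' := by
        rintro r u ⟨w, hw⟩
        exact ⟨r • w, fun φ => by rw [inner_smul_right, inner_smul_right, hw φ]⟩ }
  toFun :=
    { toFun := fun u => u.2.choose
      map_add' := fun u u' => eq_of_forall_schwartz_inner fun φ => by
        rw [inner_add_right, ← (u + u').2.choose_spec φ, ← u.2.choose_spec φ,
          ← u'.2.choose_spec φ, Submodule.coe_add, inner_add_right]
      map_smul' := fun r u => eq_of_forall_schwartz_inner fun φ => by
        rw [← (r • u).2.choose_spec φ, RingHom.id_apply, inner_smul_right,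
          ← u.2.choose_spec φ, Submodule.coe_smul, inner_smul_right] }

theorem mem_graph_l2Op (Q : 𝓢(ℝ, ℂ) →L[ℂ] 𝓢(ℝ, ℂ)) (u w : L2R) :
    (u, w) ∈ (l2Op Q).graph ↔ IsDistribImage Q u w := by
  rw [LinearPMap.mem_graph_iff]
  constructor
  · rintro ⟨y, hy, hw⟩
    have hs := y.2.choose_spec
    change y.2.choose = w at hw
    rw [hw] at hs
    change (y : L2R) = u at hy
    rwa [hy] at hs
  · intro h
    refine ⟨⟨u, w, h⟩, rfl, eq_of_forall_schwartz_inner fun φ => ?_⟩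
    have hu : u ∈ (l2Op Q).domain := ⟨w, h⟩
    exact (hu.choose_spec φ).symm.trans (h φ)

/-- Unitary equivalence of unbounded operators: some unitary `V` maps the domain of `S` onto the
domain of `T` and satisfies `V S = T V` there. -/
def UnitarilyEquivalent (S T : L2R →ₗ.[ℂ] L2R) : Prop :=
  ∃ V : L2R ≃ₗᵢ[ℂ] L2R, ∀ u w : L2R, (u, w) ∈ S.graph ↔ (V u, V w) ∈ T.graph

/-- `u ∈ C(ℝ; L²(ℝ))` solves `i ∂_t u = Q(t) u` on the whole line: `i (d/dt) ⟨φ, u(t)⟩ =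
⟨Q(t) φ, u(t)⟩` for every Schwartz function `φ` and every `t`, with `Q(t)` formally symmetric. -/
def IsSolution (Q : ℝ → 𝓢(ℝ, ℂ) →L[ℂ] 𝓢(ℝ, ℂ)) (u : ℝ → L2R) : Prop :=
  Continuous u ∧ ∀ (φ : 𝓢(ℝ, ℂ)) (t : ℝ),
    HasDerivAt (fun τ : ℝ => inner ℂ (φ.toLp 2 : L2R) (u τ))
      (-Complex.I * inner ℂ ((Q t φ).toLp 2 : L2R) (u t)) t

/-! ### Hermite functions and the spaces `𝓗^s` -/

/-- The normalized Hermite function `(n! √π)^{-1/2} He_n(√2 x) e^{-x²/2}`, where `He_n` is the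
probabilists' Hermite polynomial; it is an eigenfunction of `H₀` with eigenvalue `2n+1`. -/
def hermiteFun (n : ℕ) (x : ℝ) : ℂ :=
  (((Real.sqrt (n.factorial * Real.sqrt Real.pi))⁻¹ *
    Polynomial.aeval (Real.sqrt 2 * x) (Polynomial.hermite n) * Real.exp (-x ^ 2 / 2) : ℝ) : ℂ)

theorem integrable_polynomial_mul_gaussian (p : Polynomial ℝ) :
    Integrable (fun x : ℝ => p.eval x * Real.exp (-x ^ 2)) := by
  simp only [Polynomial.eval_eq_sum_range, Finset.sum_mul]
  refine integrable_finsetSum _ fun i _ => ?_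
  have h := integrable_rpow_mul_exp_neg_mul_sq (b := 1) one_pos (s := (i : ℝ))
    (by have : (0 : ℝ) ≤ i := i.cast_nonneg
        linarith)
  have h2 := h.const_mul (p.coeff i)
  refine h2.congr (Filter.Eventually.of_forall fun x => ?_)
  simp [Real.rpow_natCast, mul_assoc]

theorem memLp_hermiteFun (n : ℕ) : MemLp (hermiteFun n) 2 (volume : Measure ℝ) := by
  have hc : Continuous (hermiteFun n) := by
    unfold hermiteFun
    refine Complex.continuous_ofReal.comp ?_
    refine Continuous.mul (continuous_const.mul ?_) (by fun_prop)
    exact (Polynomial.continuous_aeval _).comp (by fun_prop)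
  rw [memLp_two_iff_integrable_sq_norm hc.aestronglyMeasurable]
  set q : Polynomial ℝ := Polynomial.C ((Real.sqrt (n.factorial * Real.sqrt Real.pi))⁻¹) *
    ((Polynomial.hermite n).map (Int.castRingHom ℝ)).comp
      (Polynomial.C (Real.sqrt 2) * Polynomial.X) with hq
  refine (integrable_polynomial_mul_gaussian (q ^ 2)).congr
    (Filter.Eventually.of_forall fun x => ?_)
  have he : Real.exp (-x ^ 2) = Real.exp (-x ^ 2 / 2) ^ 2 := by
    rw [← Real.exp_nat_mul]; congr 1; push_cast; ring
  simp only [hermiteFun, Complex.norm_real, Real.norm_eq_abs, sq_abs, he]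
  simp only [hq, Polynomial.eval_pow, Polynomial.eval_mul, Polynomial.eval_C,
    Polynomial.eval_comp, Polynomial.eval_X, Polynomial.eval_map, Polynomial.aeval_def,
    algebraMap_int_eq]
  ring

/-- The `n`-th Hermite function as an element of `L²(ℝ)`. -/
def hermiteL2 (n : ℕ) : L2R := (memLp_hermiteFun n).toLp

/-- The norm `‖ψ‖_s = ‖H₀^{s/2} ψ‖_{L²} = (∑_n (2n+1)^s |⟨h_n, ψ⟩|²)^{1/2}`, with `H₀^{s/2}`
given by the spectral decomposition of `H₀`; the value is `∞` exactly when `ψ ∉ 𝓗^s`. -/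
def sobolevNorm (s : ℝ) (ψ : L2R) : ENNReal :=
  (∑' n : ℕ, ENNReal.ofReal ((2 * (n : ℝ) + 1) ^ s) * ‖inner ℂ (hermiteL2 n) ψ‖ₑ ^ 2) ^
    (1 / 2 : ℝ)

end

/-!
The proof realizes the metaplectic representation by Hagedorn wavepackets instead of by Fourier
integral operators.

A matrix `Y ∈ SL(2,ℝ)` together with a logarithm `q` of `Q = Y₀₀ + i Y₀₁` determines a Gaussian
and, through the ladder operators `raiseOp`, `lowerOp`, an orthonormal basis `wavepacket q β n` of
`L²`, where `P = Y₁₀ + i Y₁₁` and `P / Q = β + i |Q|⁻²`; at the identity it is the Hermite basis.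
The unitary `metaplectic q β` maps the Hermite basis to this one. A quadratic operator is a band
matrix in each of these bases, with coefficients `hopCoeff`, `diagCoeff` that are, up to a factor,
the values of its symbol, as a quadratic and as a Hermitian form, at the vector `(Q, P)`
(`weylOp_wavepacket`). So if `B' Y = Y B` in `sl(2,ℝ)`, the quantizations of `B'` and `B` have the
same matrices in the bases belonging to `Y` and to the identity, and `metaplectic q β` intertwines
them (`hopCoeff_diagCoeff_of_conj`, `metaplectic_weylOp`); since wavepacket expansions of Schwartz
functions converge in the graph norm, this passes to the maximal realizations
(`unitarilyEquivalent_weylOp`). The three normal forms of `G` are thereby reduced to the normal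
forms of `B` under conjugation by `SL(2,ℝ)`.

Along a solution of `Y' = N Y` the wavepackets solve the Schrödinger equation of the quantization
of `N` exactly (`IsHamiltonianAt.hasDerivAt_wavepacket`). The hypothesis `Y' = A Y - Y B` is of
this form with `N = A - Y B Y⁻¹`, and the quantization of `Y B Y⁻¹` acts on the wavepackets as `G`
does on the Hermite functions; hence `U(ωt) = metaplectic (q(ωt)) (β(ωt))` conjugates the two
equations on the level of coefficients. Weak solutions only pair with Schwartz functions, whose
wavepacket coefficients decay faster than any power, and this allows the series to be
differentiated termwise (`isSolution_metaplectic`).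

Three points make `U` a function on `2𝕋^d` with the required bounds. The homotopy `e^{s Z_0} ⋯
e^{s Z_K}` contracts `Y` to the identity through periodic maps into `SL(2,ℝ)`, so lifting it
through the covering `exp : ℂ → ℂ \ {0}` yields a periodic `q` (`exists_log_topRow`). Wavepackets
are analytic in `(q, β)` because Gaussians are (`analyticAt_wavepacket`). Finally, `(q, β)` can be
joined to the origin by a Hamiltonian flow, along which the `𝓗^s` norms satisfy a commutator
estimate and a Gronwall bound, uniform for `(q, β)` in a bounded set
(`exists_sobolevNorm_metaplectic_le`).
-/

noncomputable section

/-! ### The position and momentum operators on Schwartz functions -/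

/-- The inclusion of the Schwartz space into `L²(ℝ)`. -/
def toL2 : 𝓢(ℝ, ℂ) →L[ℂ] L2R := toLpCLM ℂ ℂ 2 (volume : Measure ℝ)

theorem toL2_apply (f : 𝓢(ℝ, ℂ)) : toL2 f = f.toLp 2 := rfl

theorem momOp_apply (f : 𝓢(ℝ, ℂ)) (x : ℝ) : momOp f x = -Complex.I * deriv f x := by
  simp [momOp]

theorem inner_toL2 (f g : 𝓢(ℝ, ℂ)) :
    inner ℂ (toL2 f) (toL2 g) = ∫ x, starRingEnd ℂ (f x) * g x := by
  refine (inner_toL2_toL2_eq f g volume).trans ?_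
  simp [mul_comm]

theorem momOp_posOp (f : 𝓢(ℝ, ℂ)) : momOp (posOp f) = posOp (momOp f) - Complex.I • f := by
  ext x
  have h : deriv (posOp f) x = f x + x * deriv f x := by
    have h1 : HasDerivAt (fun y : ℝ => (y : ℂ) * f y) (1 * f x + x * deriv f x) x :=
      (Complex.ofRealCLM.hasDerivAt (x := x)).mul (f.hasDerivAt x)
    have h2 : (posOp f : ℝ → ℂ) = fun y : ℝ => (y : ℂ) * f y := funext (posOp_apply f)
    rw [h2, h1.deriv, one_mul]
  simp only [momOp_apply, h, sub_apply, posOp_apply, smul_apply, smul_eq_mul]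
  ring

theorem inner_posOp_left (f g : 𝓢(ℝ, ℂ)) :
    inner ℂ (toL2 (posOp f)) (toL2 g) = inner ℂ (toL2 f) (toL2 (posOp g)) := by
  simp only [inner_toL2, posOp_apply, map_mul, Complex.conj_ofReal]
  congr 1; ext x; ring

theorem inner_momOp_left (f g : 𝓢(ℝ, ℂ)) :
    inner ℂ (toL2 (momOp f)) (toL2 g) = inner ℂ (toL2 f) (toL2 (momOp g)) := by
  have h := integral_bilinear_deriv_right_eq_neg_left f g
    ((ContinuousLinearMap.mul ℝ ℂ).comp (Complex.conjCLE : ℂ →L[ℝ] ℂ))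
  simp only [ContinuousLinearMap.comp_apply, ContinuousLinearMap.mul_apply'] at h
  simp only [inner_toL2, momOp_apply, map_mul, map_neg, Complex.conj_I, neg_neg, mul_assoc,
    mul_left_comm _ (-Complex.I), integral_const_mul]
  rw [← neg_eq_iff_eq_neg] at h
  simp only [ContinuousLinearEquiv.coe_coe, Complex.conjCLE_apply] at h
  rw [← h, mul_neg, neg_mul]

theorem weylOp_apply (a b c : ℝ) (f : 𝓢(ℝ, ℂ)) :
    weylOp a b c f = (1 / 2 : ℂ) • ((a : ℂ) • posOp (posOp f) +
      (b : ℂ) • (posOp (momOp f) + momOp (posOp f)) + (c : ℂ) • momOp (momOp f)) := rfl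

theorem inner_weylOp_left (a b c : ℝ) (f g : 𝓢(ℝ, ℂ)) :
    inner ℂ (toL2 (weylOp a b c f)) (toL2 g) = inner ℂ (toL2 f) (toL2 (weylOp a b c g)) := by
  simp only [weylOp_apply, map_add, map_smul, inner_add_left, inner_add_right, inner_smul_left,
    inner_smul_right, inner_posOp_left, inner_momOp_left, Complex.conj_ofReal, map_div₀, map_one,
    map_ofNat]
  ring

/-- `[x, ½ (a x² + b (x D + D x) + c D²)] = i (b x + c D)`. -/
theorem weylOp_posOp (a b c : ℝ) (f : 𝓢(ℝ, ℂ)) :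
    weylOp a b c (posOp f) = posOp (weylOp a b c f) -
      Complex.I • ((b : ℂ) • posOp f + (c : ℂ) • momOp f) := by
  simp only [weylOp_apply, momOp_posOp, map_add, map_sub, map_smul]
  module

/-! ### Gaussians -/

theorem exists_abs_pow_mul_exp_le (m : ℕ) {c : ℝ} (hc : 0 < c) :
    ∃ C, ∀ x : ℝ, |x| ^ m * Real.exp (-c * x ^ 2 / 2) ≤ C := by
  refine ⟨1 + m.factorial * (2 / c) ^ m, fun x => ?_⟩
  have h1 : |x| ^ m ≤ 1 + x ^ (2 * m) := by
    rw [pow_mul, ← sq_abs, ← pow_mul, mul_comm 2 m, pow_mul]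
    nlinarith [sq_nonneg (|x| ^ m - 1)]
  have h2 : (c * x ^ 2 / 2) ^ m / m.factorial ≤ Real.exp (c * x ^ 2 / 2) :=
    Real.pow_div_factorial_le_exp _ (by positivity) m
  have h3 : x ^ (2 * m) ≤ m.factorial * (2 / c) ^ m * Real.exp (c * x ^ 2 / 2) := by
    have : x ^ (2 * m) = m.factorial * (2 / c) ^ m * ((c * x ^ 2 / 2) ^ m / m.factorial) := by
      have hm : (m.factorial : ℝ) ≠ 0 := by positivity
      rw [mul_assoc, mul_div_assoc', ← mul_pow, pow_mul]
      field_simp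
    rw [this]
    gcongr
  have h4 : (1 : ℝ) ≤ Real.exp (c * x ^ 2 / 2) := Real.one_le_exp (by positivity)
  have h5 : Real.exp (c * x ^ 2 / 2) * Real.exp (-c * x ^ 2 / 2) = 1 := by
    rw [← Real.exp_add]; ring_nf; simp
  calc |x| ^ m * Real.exp (-c * x ^ 2 / 2)
      ≤ ((1 + m.factorial * (2 / c) ^ m) * Real.exp (c * x ^ 2 / 2)) *
          Real.exp (-c * x ^ 2 / 2) := by
        gcongr
        linarith
    _ = _ := by rw [mul_assoc, h5, mul_one]

theorem norm_cexp_neg_mul_sq_div_two (Γ : ℂ) (x : ℝ) :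
    ‖Complex.exp (-Γ * x ^ 2 / 2)‖ = Real.exp (-Γ.re * x ^ 2 / 2) := by
  rw [Complex.norm_exp]
  congr 1
  have : -Γ * (x : ℂ) ^ 2 / 2 = ((x ^ 2 / 2 : ℝ) : ℂ) * -Γ := by push_cast; ring
  rw [this, Complex.re_ofReal_mul, Complex.neg_re]
  ring

theorem hasDerivAt_cexp_neg_mul_sq_div_two (Γ : ℂ) (x : ℝ) :
    HasDerivAt (fun x : ℝ => Complex.exp (-Γ * x ^ 2 / 2))
      (-Γ * x * Complex.exp (-Γ * x ^ 2 / 2)) x := by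
  have h : HasDerivAt (fun z : ℂ => Complex.exp (-Γ * z ^ 2 / 2))
      (-Γ * x * Complex.exp (-Γ * x ^ 2 / 2)) (x : ℂ) := by
    have := (((hasDerivAt_pow 2 (x : ℂ)).const_mul (-Γ)).div_const 2).cexp
    convert! this using 1
    push_cast; ring
  exact h.comp_ofReal

/-- Every derivative of a Gaussian is a polynomial times the Gaussian. -/
theorem iteratedDeriv_cexp_neg_mul_sq (Γ : ℂ) (n : ℕ) :
    ∃ p : Polynomial ℂ, iteratedDeriv n (fun x : ℝ => Complex.exp (-Γ * x ^ 2 / 2)) =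
      fun x : ℝ => p.eval (x : ℂ) * Complex.exp (-Γ * x ^ 2 / 2) := by
  induction n with
  | zero => exact ⟨1, by simp⟩
  | succ n ih =>
    obtain ⟨p, hp⟩ := ih
    refine ⟨p.derivative - Polynomial.C Γ * Polynomial.X * p, ?_⟩
    rw [iteratedDeriv_succ, hp]
    ext x
    have h := ((p.hasDerivAt (x : ℂ)).comp_ofReal).mul (hasDerivAt_cexp_neg_mul_sq_div_two Γ x)
    refine h.deriv.trans ?_
    simp
    ring

/-- The Gaussian `e^{-Γ x²/2}` as a Schwartz function, for `Re Γ > 0`; the value is `0`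
otherwise. -/
def gaussianS (Γ : ℂ) : 𝓢(ℝ, ℂ) :=
  if h : 0 < Γ.re then
    { toFun := fun x => Complex.exp (-Γ * x ^ 2 / 2)
      smooth' := by
        have := Complex.ofRealCLM.contDiff (n := (⊤ : ℕ∞))
        change ContDiff ℝ _ (fun x : ℝ => (x : ℂ)) at this
        fun_prop
      decay' := by
        intro k n
        obtain ⟨p, hp⟩ := iteratedDeriv_cexp_neg_mul_sq Γ n
        choose C hC using fun m => exists_abs_pow_mul_exp_le m h
        refine ⟨∑ i ∈ Finset.range (p.natDegree + 1), ‖p.coeff i‖ * C (k + i), fun x => ?_⟩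
        rw [norm_iteratedFDeriv_eq_norm_iteratedDeriv, hp, norm_mul, norm_cexp_neg_mul_sq_div_two,
          Polynomial.eval_eq_sum_range]
        calc _ ≤ ‖x‖ ^ k * ((∑ i ∈ Finset.range (p.natDegree + 1), ‖p.coeff i‖ * |x| ^ i) *
              Real.exp (-Γ.re * x ^ 2 / 2)) := by
              gcongr
              refine (norm_sum_le _ _).trans (Finset.sum_le_sum fun i _ => ?_)
              simp
          _ = ∑ i ∈ Finset.range (p.natDegree + 1), ‖p.coeff i‖ * (|x| ^ (k + i) *
              Real.exp (-Γ.re * x ^ 2 / 2)) := by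
              rw [Finset.sum_mul, Finset.mul_sum]
              refine Finset.sum_congr rfl fun i _ => ?_
              rw [Real.norm_eq_abs, pow_add]; ring
          _ ≤ _ := by
              gcongr with i
              exact hC _ x }
  else 0

theorem gaussianS_apply {Γ : ℂ} (h : 0 < Γ.re) (x : ℝ) :
    gaussianS Γ x = Complex.exp (-Γ * x ^ 2 / 2) := by
  rw [gaussianS, dif_pos h]; rfl

theorem posOp_pow_apply (k : ℕ) (f : 𝓢(ℝ, ℂ)) (x : ℝ) : (posOp ^ k) f x = (x : ℂ) ^ k * f x := by
  induction k with
  | zero => simp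
  | succ k ih =>
    rw [pow_succ', mul_apply_eq_comp, posOp_apply, ih]; ring

theorem momOp_gaussianS {Γ : ℂ} (h : 0 < Γ.re) :
    momOp (gaussianS Γ) = (Complex.I * Γ) • posOp (gaussianS Γ) := by
  ext x
  have h2 : (gaussianS Γ : ℝ → ℂ) = fun x : ℝ => Complex.exp (-Γ * x ^ 2 / 2) :=
    funext (gaussianS_apply h)
  rw [momOp_apply, h2, (hasDerivAt_cexp_neg_mul_sq_div_two Γ x).deriv, smul_apply, posOp_apply,
    gaussianS_apply h, smul_eq_mul]
  ring

theorem norm_toL2_le_of_norm_le {f g : 𝓢(ℝ, ℂ)} {C : ℝ} (h : ∀ x, ‖f x‖ ≤ C * ‖g x‖) :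
    ‖toL2 f‖ ≤ C * ‖toL2 g‖ := by
  refine Lp.norm_le_mul_norm_of_ae_le_mul ?_
  filter_upwards [f.coeFn_toLp 2, g.coeFn_toLp 2] with x hf hg
  rw [toL2_apply, toL2_apply, hf, hg]
  exact h x

/-- The Gaussians depend holomorphically on the exponent, as elements of `L²(ℝ)` and together with
all their moments. -/
theorem hasDerivAt_toL2_gaussianS (k : ℕ) {Γ : ℂ} (h : 0 < Γ.re) :
    HasDerivAt (fun Γ => toL2 ((posOp ^ k) (gaussianS Γ)))
      ((-1 / 2 : ℂ) • toL2 ((posOp ^ (k + 2)) (gaussianS Γ))) Γ := by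
  rw [hasDerivAt_iff_isLittleO_nhds_zero]
  refine Asymptotics.IsBigO.trans_isLittleO (g := fun z : ℂ => ‖z‖ ^ 2) ?_ ?_
  · refine Asymptotics.IsBigO.of_bound
      (1 / 4 * ‖toL2 ((posOp ^ (k + 4)) (gaussianS (Γ.re / 2 : ℝ)))‖) ?_
    have h0 : ∀ᶠ z : ℂ in nhds 0, ‖z‖ < Γ.re / 2 := by
      have := Metric.ball_mem_nhds (0 : ℂ) (half_pos h)
      filter_upwards [this] with z hz
      simpa using hz
    filter_upwards [h0] with z hz
    have hz' : 0 < (Γ + z).re := by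
      have := (abs_le.1 (Complex.abs_re_le_norm z)).1
      rw [Complex.add_re]; linarith
    rw [← map_smul, ← map_smul, ← map_sub, ← map_sub, norm_pow, norm_norm, mul_right_comm,
      mul_comm (1 / 4 : ℝ)]
    refine norm_toL2_le_of_norm_le fun x => ?_
    have hc : 0 < ((Γ.re / 2 : ℝ) : ℂ).re := by simpa using h
    simp only [sub_apply, smul_apply, posOp_pow_apply, gaussianS_apply h, gaussianS_apply hz',
      gaussianS_apply hc, smul_eq_mul]
    have e1 : (x : ℂ) ^ k * Complex.exp (-(Γ + z) * x ^ 2 / 2) -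
        x ^ k * Complex.exp (-Γ * x ^ 2 / 2) -
        z * (-1 / 2 * (x ^ (k + 2) * Complex.exp (-Γ * x ^ 2 / 2))) =
        x ^ k * Complex.exp (-Γ * x ^ 2 / 2) * (Complex.exp (-z * x ^ 2 / 2) -
          ∑ m ∈ Finset.range 2, (-z * x ^ 2 / 2) ^ m / m.factorial) := by
      have : -(Γ + z) * (x : ℂ) ^ 2 / 2 = -Γ * x ^ 2 / 2 + -z * x ^ 2 / 2 := by ring
      rw [this, Complex.exp_add]
      simp [Finset.sum_range_succ]
      ring
    rw [e1, norm_mul, norm_mul, norm_mul, norm_cexp_neg_mul_sq_div_two,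
      norm_cexp_neg_mul_sq_div_two]
    have e2 : ‖-z * (x : ℂ) ^ 2 / 2‖ = ‖z‖ * x ^ 2 / 2 := by simp
    have e3 := Complex.norm_exp_sub_sum_le_norm_mul_exp (-z * (x : ℂ) ^ 2 / 2) 2
    rw [e2] at e3
    -- the growing factor of the Taylor remainder costs half of the Gaussian decay
    have e4 : Real.exp (-Γ.re * x ^ 2 / 2) * Real.exp (‖z‖ * x ^ 2 / 2) ≤
        Real.exp (-((Γ.re / 2 : ℝ) : ℂ).re * x ^ 2 / 2) := by
      rw [← Real.exp_add, Real.exp_le_exp, Complex.ofReal_re]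
      nlinarith [sq_nonneg x]
    calc _ ≤ ‖(x : ℂ) ^ k‖ * Real.exp (-Γ.re * x ^ 2 / 2) *
          ((‖z‖ * x ^ 2 / 2) ^ 2 * Real.exp (‖z‖ * x ^ 2 / 2)) := by gcongr
      _ = (‖(x : ℂ) ^ k‖ * (‖z‖ * x ^ 2 / 2) ^ 2) *
          (Real.exp (-Γ.re * x ^ 2 / 2) * Real.exp (‖z‖ * x ^ 2 / 2)) := by ring
      _ ≤ (‖(x : ℂ) ^ k‖ * (‖z‖ * x ^ 2 / 2) ^ 2) *
          Real.exp (-((Γ.re / 2 : ℝ) : ℂ).re * x ^ 2 / 2) :=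
        mul_le_mul_of_nonneg_left e4 (by positivity)
      _ = _ := by
        simp only [norm_pow, Complex.norm_real, Real.norm_eq_abs, ← sq_abs x]
        ring
  · simpa using (Asymptotics.isLittleO_norm_pow_id (E' := ℂ) one_lt_two)

/-! ### Ladder operators and wavepackets -/

/-- `1/√2`, as a complex number. -/
def invSqrtTwo : ℂ := ((Real.sqrt 2)⁻¹ : ℝ)

theorem invSqrtTwo_mul_self : invSqrtTwo * invSqrtTwo = 1 / 2 := by
  rw [invSqrtTwo, ← Complex.ofReal_mul, ← mul_inv, Real.mul_self_sqrt zero_le_two]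
  norm_num

theorem invSqrtTwo_ne_zero : invSqrtTwo ≠ 0 := by
  simp [invSqrtTwo]

theorem conj_invSqrtTwo : starRingEnd ℂ invSqrtTwo = invSqrtTwo := Complex.conj_ofReal _

/-- The slope `w = β + i e^{-2 Re q}`, a point of the upper half plane. The pair `(q, β) ∈ ℂ × ℝ`
is a global coordinate on the universal cover of `SL(2,ℝ)`: it stands for the matrix `Y` with
`Y₀₀ + i Y₀₁ = e^q` and `Y₁₀ + i Y₁₁ = e^q w`. -/
def momSlope (q : ℂ) (β : ℝ) : ℂ := β + Complex.I * (Real.exp (-2 * q.re) : ℝ)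

/-- The exponent `Γ = -i w` of the Gaussian wavepacket `e^{i w x²/2}`. -/
def gaussExponent (q : ℂ) (β : ℝ) : ℂ := -Complex.I * momSlope q β

theorem gaussExponent_re (q : ℂ) (β : ℝ) : (gaussExponent q β).re = Real.exp (-2 * q.re) := by
  have h : gaussExponent q β = (Real.exp (-2 * q.re) : ℝ) + ((-β : ℝ) : ℂ) * Complex.I := by
    rw [gaussExponent, momSlope, Complex.ofReal_neg]
    linear_combination -((Real.exp (-2 * q.re) : ℝ) : ℂ) * Complex.I_mul_I
  rw [h, Complex.add_re, Complex.ofReal_re, Complex.re_ofReal_mul, Complex.I_re, mul_zero,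
    add_zero]

theorem gaussExponent_re_pos (q : ℂ) (β : ℝ) : 0 < (gaussExponent q β).re := by
  rw [gaussExponent_re]; positivity

theorem conj_exp_mul_exp (q : ℂ) :
    starRingEnd ℂ (Complex.exp q) * Complex.exp q = (Real.exp (2 * q.re) : ℝ) := by
  rw [← Complex.exp_conj, ← Complex.exp_add, Complex.ofReal_exp]
  congr 1
  rw [add_comm, Complex.add_conj]

/-- The entry `P = e^q w`. -/
def momParam (q : ℂ) (β : ℝ) : ℂ := Complex.exp q * momSlope q β

/-- The relation `conj Q * P - Q * conj P = 2 i`, which expresses that the matrix with rows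
`(Re Q, Im Q)` and `(Re P, Im P)` has determinant one. -/
theorem conj_exp_mul_momParam (q : ℂ) (β : ℝ) :
    starRingEnd ℂ (Complex.exp q) * momParam q β -
      Complex.exp q * starRingEnd ℂ (momParam q β) = 2 * Complex.I := by
  have h := conj_exp_mul_exp q
  have h2 : momSlope q β - starRingEnd ℂ (momSlope q β) =
      2 * Complex.I * (Real.exp (-2 * q.re) : ℝ) := by
    simp only [momSlope, map_add, map_mul, Complex.conj_ofReal, Complex.conj_I]
    ring
  have h3 : ((Real.exp (2 * q.re) : ℝ) : ℂ) * (Real.exp (-2 * q.re) : ℝ) = 1 := by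
    rw [← Complex.ofReal_mul, ← Real.exp_add]
    ring_nf; simp
  rw [momParam, map_mul]
  linear_combination (momSlope q β - starRingEnd ℂ (momSlope q β)) * h +
    ((Real.exp (2 * q.re) : ℝ) : ℂ) * h2 + 2 * Complex.I * h3

/-- The raising operator `A† = (i/√2) (conj P x - conj Q D)`, with `D = -i ∂_x`. -/
def raiseOp (q : ℂ) (β : ℝ) : 𝓢(ℝ, ℂ) →L[ℂ] 𝓢(ℝ, ℂ) :=
  (Complex.I * invSqrtTwo) • ((starRingEnd ℂ (momParam q β)) • posOp -
    (starRingEnd ℂ (Complex.exp q)) • momOp)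

/-- The lowering operator `A = -(i/√2) (P x - Q D)`, with `D = -i ∂_x`. -/
def lowerOp (q : ℂ) (β : ℝ) : 𝓢(ℝ, ℂ) →L[ℂ] 𝓢(ℝ, ℂ) :=
  (-Complex.I * invSqrtTwo) • (momParam q β • posOp - Complex.exp q • momOp)

theorem raiseOp_apply (q : ℂ) (β : ℝ) (f : 𝓢(ℝ, ℂ)) :
    raiseOp q β f = (Complex.I * invSqrtTwo) • ((starRingEnd ℂ (momParam q β)) • posOp f -
      (starRingEnd ℂ (Complex.exp q)) • momOp f) := rfl

theorem lowerOp_apply (q : ℂ) (β : ℝ) (f : 𝓢(ℝ, ℂ)) :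
    lowerOp q β f = (-Complex.I * invSqrtTwo) • (momParam q β • posOp f -
      Complex.exp q • momOp f) := rfl

theorem posOp_eq_ladder (q : ℂ) (β : ℝ) (f : 𝓢(ℝ, ℂ)) :
    posOp f = invSqrtTwo • (Complex.exp q • raiseOp q β f +
      starRingEnd ℂ (Complex.exp q) • lowerOp q β f) := by
  rw [raiseOp_apply, lowerOp_apply]
  have h := conj_exp_mul_momParam q β
  match_scalars
  · linear_combination (Complex.I * invSqrtTwo * invSqrtTwo) * h -
      2 * invSqrtTwo_mul_self + 2 * invSqrtTwo * invSqrtTwo * Complex.I_mul_I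
  · ring

theorem momOp_eq_ladder (q : ℂ) (β : ℝ) (f : 𝓢(ℝ, ℂ)) :
    momOp f = invSqrtTwo • (momParam q β • raiseOp q β f +
      starRingEnd ℂ (momParam q β) • lowerOp q β f) := by
  rw [raiseOp_apply, lowerOp_apply]
  have h := conj_exp_mul_momParam q β
  match_scalars
  · linear_combination (Complex.I * invSqrtTwo * invSqrtTwo) * h -
      2 * invSqrtTwo_mul_self + 2 * invSqrtTwo * invSqrtTwo * Complex.I_mul_I
  · ring

/-- The canonical commutation relation `[A, A†] = 1`. -/
theorem lowerOp_raiseOp (q : ℂ) (β : ℝ) (f : 𝓢(ℝ, ℂ)) :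
    lowerOp q β (raiseOp q β f) = raiseOp q β (lowerOp q β f) + f := by
  have h := conj_exp_mul_momParam q β
  simp only [raiseOp_apply, lowerOp_apply, map_smul, map_sub, momOp_posOp]
  match_scalars
  · ring
  · ring
  · linear_combination (Complex.I ^ 3 * invSqrtTwo * invSqrtTwo) * h +
      2 * invSqrtTwo * invSqrtTwo * Complex.I_pow_four + 2 * invSqrtTwo_mul_self
  · ring

theorem inner_raiseOp_left (q : ℂ) (β : ℝ) (f g : 𝓢(ℝ, ℂ)) :
    inner ℂ (toL2 (raiseOp q β f)) (toL2 g) = inner ℂ (toL2 f) (toL2 (lowerOp q β g)) := by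
  simp only [raiseOp_apply, lowerOp_apply, map_sub, map_smul, inner_sub_left, inner_sub_right,
    inner_smul_left, inner_smul_right, inner_posOp_left, inner_momOp_left, map_mul,
    Complex.conj_conj, Complex.conj_I, conj_invSqrtTwo]

/-- Hagedorn's wavepackets: the images of the Hermite functions under the metaplectic operator
with parameters `(q, β)`. The ground state is `π^{-1/4} e^{-q/2} e^{i w x²/2}`. -/
def wavepacket (q : ℂ) (β : ℝ) : ℕ → 𝓢(ℝ, ℂ)
  | 0 => (((Real.sqrt (Real.sqrt Real.pi))⁻¹ : ℝ) * Complex.exp (-q / 2)) •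
      gaussianS (gaussExponent q β)
  | n + 1 => (((Real.sqrt (n + 1))⁻¹ : ℝ) : ℂ) • raiseOp q β (wavepacket q β n)

theorem sqrt_succ_ne_zero (n : ℕ) : ((Real.sqrt (n + 1) : ℝ) : ℂ) ≠ 0 := by
  rw [Complex.ofReal_ne_zero]; positivity

theorem ofReal_sqrt_mul_self {x : ℝ} (hx : 0 ≤ x) :
    ((Real.sqrt x : ℝ) : ℂ) * (Real.sqrt x : ℝ) = x := by
  rw [← Complex.ofReal_mul, Real.mul_self_sqrt hx]

theorem raiseOp_wavepacket (q : ℂ) (β : ℝ) (n : ℕ) :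
    raiseOp q β (wavepacket q β n) = ((Real.sqrt (n + 1) : ℝ) : ℂ) • wavepacket q β (n + 1) := by
  rw [wavepacket, smul_smul, Complex.ofReal_inv, mul_inv_cancel₀ (sqrt_succ_ne_zero n), one_smul]

theorem lowerOp_wavepacket_zero (q : ℂ) (β : ℝ) : lowerOp q β (wavepacket q β 0) = 0 := by
  rw [wavepacket, map_smul, lowerOp_apply, momOp_gaussianS (gaussExponent_re_pos q β)]
  have : Complex.exp q * (Complex.I * gaussExponent q β) = momParam q β := by
    rw [gaussExponent, momParam]; linear_combination -Complex.exp q * momSlope q β * Complex.I_mul_I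
  rw [smul_smul (Complex.exp q), this, sub_self, smul_zero, smul_zero]

theorem lowerOp_wavepacket (q : ℂ) (β : ℝ) (n : ℕ) :
    lowerOp q β (wavepacket q β n) = ((Real.sqrt n : ℝ) : ℂ) • wavepacket q β (n - 1) := by
  induction n with
  | zero => simp [lowerOp_wavepacket_zero]
  | succ n ih =>
    rw [wavepacket, map_smul, lowerOp_raiseOp, ih, map_smul]
    have h : ((Real.sqrt n : ℝ) : ℂ) • raiseOp q β (wavepacket q β (n - 1)) =
        (n : ℂ) • wavepacket q β n := by
      cases n with
      | zero => simp
      | succ m =>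
        rw [Nat.add_sub_cancel, raiseOp_wavepacket, smul_smul]
        push_cast
        rw [ofReal_sqrt_mul_self (by positivity)]
        push_cast; rfl
    have h2 := ofReal_sqrt_mul_self (x := n + 1) (by positivity)
    have h3 := sqrt_succ_ne_zero n
    rw [h, Nat.add_sub_cancel]
    nth_rewrite 2 [← one_smul ℂ (wavepacket q β n)]
    rw [← add_smul, smul_smul]
    congr 1
    push_cast at h2 ⊢
    field_simp
    linear_combination -h2

theorem posOp_wavepacket (q : ℂ) (β : ℝ) (n : ℕ) :
    posOp (wavepacket q β n) = invSqrtTwo •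
      ((Complex.exp q * (Real.sqrt (n + 1) : ℝ)) • wavepacket q β (n + 1) +
        (starRingEnd ℂ (Complex.exp q) * (Real.sqrt n : ℝ)) • wavepacket q β (n - 1)) := by
  rw [posOp_eq_ladder q β, raiseOp_wavepacket, lowerOp_wavepacket, smul_smul, smul_smul]

theorem momOp_wavepacket (q : ℂ) (β : ℝ) (n : ℕ) :
    momOp (wavepacket q β n) = invSqrtTwo •
      ((momParam q β * (Real.sqrt (n + 1) : ℝ)) • wavepacket q β (n + 1) +
        (starRingEnd ℂ (momParam q β) * (Real.sqrt n : ℝ)) • wavepacket q β (n - 1)) := by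
  rw [momOp_eq_ladder q β, raiseOp_wavepacket, lowerOp_wavepacket, smul_smul, smul_smul]

/-- The coefficient of `A†²` in the ladder form of `weylOp a b c`. -/
def hopCoeff (a b c : ℝ) (q : ℂ) (β : ℝ) : ℂ :=
  1 / 4 * (a * Complex.exp q ^ 2 + 2 * b * Complex.exp q * momParam q β + c * momParam q β ^ 2)

/-- The coefficient of `A† A + A A†` in the ladder form of `weylOp a b c`. -/
def diagCoeff (a b c : ℝ) (q : ℂ) (β : ℝ) : ℂ :=
  1 / 4 * (a * (Complex.exp q * starRingEnd ℂ (Complex.exp q)) +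
    b * (Complex.exp q * starRingEnd ℂ (momParam q β) +
      starRingEnd ℂ (Complex.exp q) * momParam q β) +
    c * (momParam q β * starRingEnd ℂ (momParam q β)))

/-- A quadratic operator in terms of the ladder operators: `x` and `D` are the combinations
`(Q A† + conj Q A)/√2` and `(P A† + conj P A)/√2`, and the Weyl ordering makes the mixed term
symmetric. -/
theorem weylOp_eq_ladder (a b c : ℝ) (q : ℂ) (β : ℝ) (f : 𝓢(ℝ, ℂ)) :
    weylOp a b c f = hopCoeff a b c q β • raiseOp q β (raiseOp q β f) +
      diagCoeff a b c q β • (raiseOp q β (lowerOp q β f) + lowerOp q β (raiseOp q β f)) +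
      starRingEnd ℂ (hopCoeff a b c q β) • lowerOp q β (lowerOp q β f) := by
  have hp := posOp_eq_ladder q β
  have hm := momOp_eq_ladder q β
  have h := invSqrtTwo_mul_self
  have hpp : posOp (posOp f) = (1 / 2 : ℂ) • (Complex.exp q ^ 2 • raiseOp q β (raiseOp q β f) +
      (Complex.exp q * starRingEnd ℂ (Complex.exp q)) •
        (raiseOp q β (lowerOp q β f) + lowerOp q β (raiseOp q β f)) +
      starRingEnd ℂ (Complex.exp q) ^ 2 • lowerOp q β (lowerOp q β f)) := by
    rw [hp f]
    simp only [map_smul, map_add]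
    rw [hp (raiseOp q β f), hp (lowerOp q β f), ← h]
    module
  have hmm : momOp (momOp f) = (1 / 2 : ℂ) • (momParam q β ^ 2 • raiseOp q β (raiseOp q β f) +
      (momParam q β * starRingEnd ℂ (momParam q β)) •
        (raiseOp q β (lowerOp q β f) + lowerOp q β (raiseOp q β f)) +
      starRingEnd ℂ (momParam q β) ^ 2 • lowerOp q β (lowerOp q β f)) := by
    rw [hm f]
    simp only [map_smul, map_add]
    rw [hm (raiseOp q β f), hm (lowerOp q β f), ← h]
    module
  have hpm : posOp (momOp f) + momOp (posOp f) =
      (1 / 2 : ℂ) • ((2 * Complex.exp q * momParam q β) • raiseOp q β (raiseOp q β f) +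
      (Complex.exp q * starRingEnd ℂ (momParam q β) +
          starRingEnd ℂ (Complex.exp q) * momParam q β) •
        (raiseOp q β (lowerOp q β f) + lowerOp q β (raiseOp q β f)) +
      (2 * starRingEnd ℂ (Complex.exp q) * starRingEnd ℂ (momParam q β)) •
        lowerOp q β (lowerOp q β f)) := by
    rw [hm f, hp f]
    simp only [map_smul, map_add]
    rw [hp (raiseOp q β f), hp (lowerOp q β f), hm (raiseOp q β f), hm (lowerOp q β f), ← h]
    module
  rw [weylOp_apply, hpp, hmm, hpm]
  simp only [hopCoeff, diagCoeff, map_mul, map_add, map_pow, Complex.conj_ofReal, map_div₀,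
    map_one, map_ofNat]
  module

/-- The matrix element `√((n+1)(n+2))` of `A†²` between the `n`-th and the `n+2`-nd wavepacket. -/
def hopWeight (n : ℕ) : ℝ := Real.sqrt (n + 1) * Real.sqrt (n + 2)

theorem hopWeight_nonneg (n : ℕ) : 0 ≤ hopWeight n := by unfold hopWeight; positivity

theorem hopWeight_le (n : ℕ) : hopWeight n ≤ n + 2 := by
  rw [hopWeight, ← Real.sqrt_mul (by positivity)]
  refine Real.sqrt_le_iff.2 ⟨by positivity, ?_⟩
  nlinarith [n.cast_nonneg (α := ℝ)]

/-- The matrix element of `A²` from the `n`-th to the `n-2`-nd wavepacket; it vanishes for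
`n = 0, 1`. -/
def dropWeight (n : ℕ) : ℝ := Real.sqrt n * Real.sqrt (n - 1 : ℕ)

theorem dropWeight_add_two (n : ℕ) : dropWeight (n + 2) = hopWeight n := by
  rw [dropWeight, hopWeight, mul_comm]
  congr 2 <;> push_cast <;> ring

theorem dropWeight_zero : dropWeight 0 = 0 := by simp [dropWeight]

theorem dropWeight_one : dropWeight 1 = 0 := by simp [dropWeight]

theorem raiseOp_lowerOp_wavepacket (q : ℂ) (β : ℝ) (n : ℕ) :
    raiseOp q β (lowerOp q β (wavepacket q β n)) = (n : ℂ) • wavepacket q β n := by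
  rw [lowerOp_wavepacket, map_smul]
  cases n with
  | zero => simp
  | succ m =>
    rw [Nat.add_sub_cancel, raiseOp_wavepacket, smul_smul]
    push_cast
    rw [ofReal_sqrt_mul_self (by positivity)]
    push_cast; rfl

/-- A quadratic operator acts on the wavepackets as a band matrix. -/
theorem weylOp_wavepacket (a b c : ℝ) (q : ℂ) (β : ℝ) (n : ℕ) :
    weylOp a b c (wavepacket q β n) =
      (hopCoeff a b c q β * hopWeight n) • wavepacket q β (n + 2) +
      (diagCoeff a b c q β * (2 * n + 1)) • wavepacket q β n +
      (starRingEnd ℂ (hopCoeff a b c q β) * dropWeight n) • wavepacket q β (n - 2) := by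
  rw [weylOp_eq_ladder a b c q β, lowerOp_raiseOp, raiseOp_lowerOp_wavepacket,
    raiseOp_wavepacket, map_smul, raiseOp_wavepacket, lowerOp_wavepacket, map_smul,
    lowerOp_wavepacket, hopWeight, dropWeight, show n - 1 - 1 = n - 2 by omega]
  have : Real.sqrt (((n + 1 : ℕ) : ℝ) + 1) = Real.sqrt (n + 2) := by
    congr 1; push_cast; ring
  rw [this]
  push_cast
  module

theorem norm_conj_mul_self_exp_neg_half (q : ℂ) :
    starRingEnd ℂ (Complex.exp (-q / 2)) * Complex.exp (-q / 2) = (Real.exp (-q.re) : ℝ) := by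
  rw [conj_exp_mul_exp]
  congr 2
  have : (-q / 2).re = -q.re / 2 := by simp
  rw [this]; ring

theorem inner_wavepacket_zero_self (q : ℂ) (β : ℝ) :
    inner ℂ (toL2 (wavepacket q β 0)) (toL2 (wavepacket q β 0)) = 1 := by
  rw [wavepacket, map_smul, inner_smul_left, inner_smul_right, inner_toL2]
  have h1 : ∀ x : ℝ, starRingEnd ℂ (gaussianS (gaussExponent q β) x) *
      gaussianS (gaussExponent q β) x = (Real.exp (-Real.exp (-2 * q.re) * x ^ 2) : ℝ) := by
    intro x
    rw [gaussianS_apply (gaussExponent_re_pos q β), conj_exp_mul_exp, ← gaussExponent_re q β]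
    congr 2
    have : -gaussExponent q β * (x : ℂ) ^ 2 / 2 =
        ((x ^ 2 / 2 : ℝ) : ℂ) * -gaussExponent q β := by push_cast; ring
    rw [this, Complex.re_ofReal_mul, Complex.neg_re]
    ring
  simp only [h1]
  rw [integral_complex_ofReal, integral_gaussian, map_mul, Complex.conj_ofReal]
  have h2 := norm_conj_mul_self_exp_neg_half q
  have h3 : (Real.sqrt (Real.sqrt Real.pi))⁻¹ * (Real.sqrt (Real.sqrt Real.pi))⁻¹ *
      (Real.exp (-q.re) * Real.sqrt (Real.pi / Real.exp (-2 * q.re))) = 1 := by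
    have e : Real.exp (-2 * q.re) = Real.exp (-q.re) ^ 2 := by
      rw [← Real.exp_nat_mul]; congr 1; push_cast; ring
    have hp : 0 < Real.sqrt Real.pi := Real.sqrt_pos.2 Real.pi_pos
    rw [Real.sqrt_div Real.pi_pos.le, e, Real.sqrt_sq (Real.exp_pos _).le, ← mul_inv,
      Real.mul_self_sqrt hp.le]
    field_simp
  have h4 := congrArg (Complex.ofReal) h3
  simp only [Complex.ofReal_mul, Complex.ofReal_one] at h4
  rw [← h4, ← h2]
  ring

theorem inner_wavepacket (q : ℂ) (β : ℝ) (m n : ℕ) :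
    inner ℂ (toL2 (wavepacket q β m)) (toL2 (wavepacket q β n)) = if m = n then 1 else 0 := by
  induction m generalizing n with
  | zero =>
    cases n with
    | zero => simpa using inner_wavepacket_zero_self q β
    | succ n =>
      rw [← inner_conj_symm, wavepacket.eq_2, map_smul, inner_smul_left, inner_raiseOp_left,
        lowerOp_wavepacket_zero]
      simp
  | succ m ih =>
    rw [wavepacket, map_smul, inner_smul_left, inner_raiseOp_left, lowerOp_wavepacket, map_smul,
      inner_smul_right, ih, Complex.conj_ofReal]
    cases n with
    | zero => simp
    | succ n =>
      simp only [Nat.add_sub_cancel, Nat.add_right_cancel_iff]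
      split_ifs with h
      · subst h
        push_cast
        rw [mul_one, inv_mul_cancel₀ (sqrt_succ_ne_zero m)]
      · simp

theorem orthonormal_wavepacket (q : ℂ) (β : ℝ) :
    Orthonormal ℂ (fun n => toL2 (wavepacket q β n)) :=
  orthonormal_iff_ite.2 (inner_wavepacket q β)

theorem hermiteFun_succ (n : ℕ) (x : ℝ) :
    hermiteFun (n + 1) x = ((Real.sqrt (n + 1))⁻¹ : ℝ) * invSqrtTwo *
      (x * hermiteFun n x - deriv (hermiteFun n) x) := by
  set p : ℝ → ℝ := fun y => Polynomial.aeval y (Polynomial.hermite n) with hp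
  have hd : HasDerivAt (fun x => (Real.sqrt (n.factorial * Real.sqrt Real.pi))⁻¹ *
      p (Real.sqrt 2 * x) * Real.exp (-x ^ 2 / 2))
      ((Real.sqrt (n.factorial * Real.sqrt Real.pi))⁻¹ * (Polynomial.aeval (Real.sqrt 2 * x)
        (Polynomial.derivative (Polynomial.hermite n)) * Real.sqrt 2) * Real.exp (-x ^ 2 / 2) +
        (Real.sqrt (n.factorial * Real.sqrt Real.pi))⁻¹ * p (Real.sqrt 2 * x) *
          (Real.exp (-x ^ 2 / 2) * -x)) x := by
    have h1 := (Polynomial.hermite n).hasDerivAt_aeval (Real.sqrt 2 * x)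
    have h2 : HasDerivAt (fun x : ℝ => Real.sqrt 2 * x) (Real.sqrt 2) x := by
      simpa using (hasDerivAt_id x).const_mul (Real.sqrt 2)
    have h3 : HasDerivAt (fun x : ℝ => -x ^ 2 / 2) (-x) x := by
      convert! ((hasDerivAt_pow 2 x).neg).div_const 2 using 1
      push_cast; ring
    exact ((h1.comp x h2).const_mul _).mul h3.exp
  have hd2 : deriv (hermiteFun n) x = _ := hd.ofReal_comp.deriv
  rw [hd2]
  simp only [hermiteFun, invSqrtTwo, ← Complex.ofReal_mul, ← Complex.ofReal_sub]
  congr 1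
  rw [Polynomial.hermite_succ, Nat.factorial_succ, map_sub, map_mul, Polynomial.aeval_X]
  push_cast
  rw [mul_assoc ((n : ℝ) + 1), Real.sqrt_mul (by positivity) , mul_inv]
  have h2 : Real.sqrt 2 * Real.sqrt 2 = 2 := Real.mul_self_sqrt zero_le_two
  have h2' : (Real.sqrt 2)⁻¹ = Real.sqrt 2 / 2 := by
    field_simp; linarith
  rw [h2']
  simp only [hp]
  linear_combination ((Real.sqrt (n + 1))⁻¹ *
    (Real.sqrt (n.factorial * Real.sqrt Real.pi))⁻¹ * Real.exp (-x ^ 2 / 2) *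
    Polynomial.aeval (Real.sqrt 2 * x) (Polynomial.derivative (Polynomial.hermite n)) / 2) * h2

theorem wavepacket_zero_zero_apply (n : ℕ) (x : ℝ) : wavepacket 0 0 n x = hermiteFun n x := by
  have hw : momSlope 0 0 = Complex.I := by simp [momSlope]
  induction n generalizing x with
  | zero =>
    rw [wavepacket, smul_apply, gaussianS_apply (gaussExponent_re_pos 0 0), gaussExponent, hw]
    simp [hermiteFun]
  | succ n ih =>
    have hf : (wavepacket 0 0 n : ℝ → ℂ) = hermiteFun n := funext ih
    rw [wavepacket, smul_apply, raiseOp_apply, smul_apply, sub_apply, smul_apply, smul_apply,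
      posOp_apply, momOp_apply, hf, hermiteFun_succ, momParam, hw]
    simp only [smul_eq_mul, Complex.exp_zero, one_mul, Complex.conj_I, map_one]
    linear_combination (-((Real.sqrt (n + 1))⁻¹ : ℝ) * invSqrtTwo *
      (x * hermiteFun n x - deriv (hermiteFun n) x)) * Complex.I_mul_I

theorem toL2_wavepacket_zero_zero (n : ℕ) : toL2 (wavepacket 0 0 n) = hermiteL2 n := by
  rw [toL2_apply, hermiteL2, SchwartzMap.toLp]
  exact MemLp.toLp_congr _ _ (Filter.Eventually.of_forall (wavepacket_zero_zero_apply n))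

/-! ### Completeness of the wavepackets -/

/-- If all moments of an exponentially decaying function vanish, so does its Laplace transform, by
termwise integration of the exponential series. -/
theorem integral_cexp_mul_eq_zero_of_moments {F : ℝ → ℂ}
    (hF : AEStronglyMeasurable F volume)
    (hexp : ∀ c : ℝ, Integrable (fun x => Real.exp (c * |x|) * ‖F x‖))
    (hmom : ∀ k : ℕ, ∫ x : ℝ, (x : ℂ) ^ k * F x = 0) (z : ℂ) :
    ∫ x : ℝ, Complex.exp (z * x) * F x = 0 := by
  have hpow : ∀ k : ℕ, Integrable (fun x : ℝ => (x : ℂ) ^ k * F x) := by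
    intro k
    refine ((hexp 1).const_mul (k.factorial : ℝ)).mono' ?_ ?_
    · exact (by fun_prop : Continuous fun x : ℝ => (x : ℂ) ^ k).aestronglyMeasurable.mul hF
    · refine Filter.Eventually.of_forall fun x => ?_
      have h := Real.pow_div_factorial_le_exp |x| (abs_nonneg x) k
      rw [div_le_iff₀ (by positivity)] at h
      rw [norm_mul, norm_pow, Complex.norm_real, Real.norm_eq_abs, one_mul, ← mul_assoc]
      gcongr
      linarith
  have hlim := tendsto_integral_of_dominated_convergence
    (F := fun (N : ℕ) (x : ℝ) => (∑ k ∈ Finset.range N, (z * x) ^ k / k.factorial) * F x)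
    (f := fun x => Complex.exp (z * x) * F x) (μ := volume)
    (fun x => Real.exp (‖z‖ * |x|) * ‖F x‖) (fun N => by
      refine AEStronglyMeasurable.mul ?_ hF
      exact (by fun_prop : Continuous fun x : ℝ =>
        ∑ k ∈ Finset.range N, (z * x) ^ k / (k.factorial : ℂ)).aestronglyMeasurable)
    (hexp ‖z‖) (fun N => Filter.Eventually.of_forall fun x => by
      rw [norm_mul]
      gcongr
      refine (norm_sum_le _ _).trans ?_
      refine le_trans (le_of_eq ?_)
        (Real.sum_le_exp_of_nonneg (x := ‖z‖ * |x|) (by positivity) N)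
      refine Finset.sum_congr rfl fun k _ => ?_
      simp)
    (Filter.Eventually.of_forall fun x => by
      refine Filter.Tendsto.mul_const _ ?_
      have h := NormedSpace.expSeries_div_hasSum_exp (z * (x : ℂ))
      rw [← Complex.exp_eq_exp_ℂ] at h
      exact h.tendsto_sum_nat)
  refine tendsto_nhds_unique hlim ?_
  have h0 : ∀ N : ℕ, ∫ x : ℝ, (∑ k ∈ Finset.range N, (z * x) ^ k / k.factorial) * F x = 0 := by
    intro N
    have : ∀ x : ℝ, (∑ k ∈ Finset.range N, (z * x) ^ k / k.factorial) * F x =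
        ∑ k ∈ Finset.range N, (z ^ k / k.factorial) * ((x : ℂ) ^ k * F x) := by
      intro x
      rw [Finset.sum_mul]
      refine Finset.sum_congr rfl fun k _ => ?_
      rw [mul_pow]; ring
    simp only [this]
    rw [integral_finsetSum _ fun k _ => (hpow k).const_mul _]
    refine Finset.sum_eq_zero fun k _ => ?_
    rw [integral_const_mul, hmom, mul_zero]
  simp only [h0]
  exact tendsto_const_nhds

/-- Injectivity of the Fourier transform on integrable functions, by duality with test functions. -/
theorem ae_eq_zero_of_integral_cexp_mul_eq_zero {F : ℝ → ℂ} (hF : Integrable F)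
    (h : ∀ z : ℂ, ∫ x : ℝ, Complex.exp (z * x) * F x = 0) : ∀ᵐ x, F x = 0 := by
  have hfour : FourierTransform.fourier F = 0 := by
    ext w
    rw [Real.fourier_real_eq_integral_exp_smul, Pi.zero_apply,
      ← h ((-2 * Real.pi * w : ℝ) * Complex.I)]
    congr 1; ext x
    rw [smul_eq_mul]
    congr 2
    push_cast; ring
  refine ae_eq_zero_of_integral_contDiff_smul_eq_zero hF.locallyIntegrable fun g hg hgs => ?_
  have hgc : HasCompactSupport (fun x => (g x : ℂ)) := hgs.comp_left (g := Complex.ofReal) rfl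
  set ψ : 𝓢(ℝ, ℂ) := hgc.toSchwartzMap (Complex.ofRealCLM.contDiff.comp hg) with hψ
  set φ : 𝓢(ℝ, ℂ) := FourierTransformInv.fourierInv ψ with hφ
  have h1 : FourierTransform.fourier φ = ψ := FourierTransform.fourier_fourierInv_eq ψ
  have h2 : (FourierTransform.fourier (φ : ℝ → ℂ)) = fun x => (g x : ℂ) := by
    rw [← SchwartzMap.fourier_coe, h1]; rfl
  have h3 := VectorFourier.integral_fourierIntegral_smul_eq_flip (L := innerₗ ℝ)
    (e := Real.fourierChar) (μ := volume) (ν := volume) (f := (φ : ℝ → ℂ)) (g := F)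
    Real.continuous_fourierChar continuous_inner φ.integrable hF
  have h4 : (innerₗ ℝ).flip = innerₗ ℝ := by ext; simp
  rw [h4] at h3
  change ∫ x, FourierTransform.fourier (φ : ℝ → ℂ) x • F x =
    ∫ x, φ x • FourierTransform.fourier F x at h3
  rw [h2, hfour] at h3
  simpa using h3

/-- Polynomials times a Gaussian are total in `L²`: the moments of `conj(e^{-Γ x²/2}) f` determine
`f`, since this function decays faster than any exponential in the mean. -/
theorem eq_zero_of_inner_posOp_pow_gaussianS {Γ : ℂ} (hΓ : 0 < Γ.re) {f : L2R}
    (h : ∀ k : ℕ, inner ℂ (toL2 ((posOp ^ k) (gaussianS Γ))) f = 0) : f = 0 := by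
  set F : ℝ → ℂ := fun x => starRingEnd ℂ (gaussianS Γ x) * f x with hFdef
  have hfm : AEStronglyMeasurable f volume := Lp.aestronglyMeasurable f
  have hF : AEStronglyMeasurable F volume :=
    (Complex.continuous_conj.comp (gaussianS Γ).continuous).aestronglyMeasurable.mul hfm
  have hexp : ∀ c : ℝ, Integrable (fun x => Real.exp (c * |x|) * ‖F x‖) := by
    intro c
    have hc : 0 < ((Γ.re / 2 : ℝ) : ℂ).re := by simpa using hΓ
    have h1 : Integrable (fun x => gaussianS (Γ.re / 2 : ℝ) x * f x) :=
      ((gaussianS _).memLp 2).integrable_mul (Lp.memLp f)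
    refine (h1.norm.const_mul (Real.exp (c ^ 2 / Γ.re))).mono' ?_ ?_
    · exact (by fun_prop : Continuous fun x : ℝ =>
        Real.exp (c * |x|)).aestronglyMeasurable.mul hF.norm
    · refine Filter.Eventually.of_forall fun x => ?_
      rw [norm_mul, norm_norm, hFdef, norm_mul, norm_mul, RCLike.norm_conj, gaussianS_apply hΓ,
        gaussianS_apply hc, norm_cexp_neg_mul_sq_div_two, norm_cexp_neg_mul_sq_div_two,
        ← mul_assoc, ← mul_assoc, Real.norm_of_nonneg (Real.exp_pos _).le, ← Real.exp_add,
        ← Real.exp_add, Complex.ofReal_re]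
      refine mul_le_mul_of_nonneg_right (Real.exp_le_exp.2 ?_) (norm_nonneg _)
      have : c ^ 2 / Γ.re + -(Γ.re / 2) * x ^ 2 / 2 - (c * |x| + -Γ.re * x ^ 2 / 2) =
          (c - Γ.re * |x| / 2) ^ 2 / Γ.re := by
        rw [← sq_abs x]; field_simp; ring
      have h2 : 0 ≤ (c - Γ.re * |x| / 2) ^ 2 / Γ.re := by positivity
      linarith
  have hmom : ∀ k : ℕ, ∫ x : ℝ, (x : ℂ) ^ k * F x = 0 := by
    intro k
    rw [← h k, L2.inner_def]
    refine integral_congr_ae ?_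
    filter_upwards [((posOp ^ k) (gaussianS Γ)).coeFn_toLp 2] with x hx
    rw [toL2_apply, hx, posOp_pow_apply, hFdef]
    simp only [RCLike.inner_apply, map_mul, map_pow, Complex.conj_ofReal]
    ring
  have hFi : Integrable F := by
    refine (hexp 0).mono' hF (Filter.Eventually.of_forall fun x => ?_)
    simp
  have h0 := ae_eq_zero_of_integral_cexp_mul_eq_zero hFi
    (integral_cexp_mul_eq_zero_of_moments hF hexp hmom)
  rw [Lp.eq_zero_iff_ae_eq_zero]
  filter_upwards [h0] with x hx
  have hg : starRingEnd ℂ (gaussianS Γ x) ≠ 0 := by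
    rw [gaussianS_apply hΓ, Ne, map_eq_zero]; exact Complex.exp_ne_zero _
  exact (mul_eq_zero.1 hx).resolve_left hg

theorem posOp_pow_wavepacket_zero_mem_span (q : ℂ) (β : ℝ) (k : ℕ) :
    (posOp ^ k) (wavepacket q β 0) ∈ Submodule.span ℂ (Set.range (wavepacket q β)) := by
  induction k with
  | zero => exact Submodule.subset_span ⟨0, rfl⟩
  | succ k ih =>
    rw [pow_succ', mul_apply_eq_comp]
    refine Submodule.span_induction (p := fun f _ => posOp f ∈
      Submodule.span ℂ (Set.range (wavepacket q β))) ?_ ?_ ?_ ?_ ih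
    · rintro _ ⟨n, rfl⟩
      rw [posOp_wavepacket]
      exact Submodule.smul_mem _ _ (Submodule.add_mem _
        (Submodule.smul_mem _ _ (Submodule.subset_span ⟨_, rfl⟩))
        (Submodule.smul_mem _ _ (Submodule.subset_span ⟨_, rfl⟩)))
    · rw [map_zero]; exact Submodule.zero_mem _
    · intro f g _ _ hf hg
      rw [map_add]; exact Submodule.add_mem _ hf hg
    · intro c f _ hf
      rw [map_smul]; exact Submodule.smul_mem _ _ hf

/-- The wavepackets are total, because they span the polynomials times the ground state. -/
theorem eq_zero_of_inner_wavepacket {q : ℂ} {β : ℝ} {f : L2R}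
    (h : ∀ n, inner ℂ (toL2 (wavepacket q β n)) f = 0) : f = 0 := by
  refine eq_zero_of_inner_posOp_pow_gaussianS (gaussExponent_re_pos q β) fun k => ?_
  have h1 : inner ℂ (toL2 ((posOp ^ k) (wavepacket q β 0))) f = 0 := by
    refine Submodule.span_induction (p := fun g _ => inner ℂ (toL2 g) f = 0) ?_ ?_ ?_ ?_
      (posOp_pow_wavepacket_zero_mem_span q β k)
    · rintro _ ⟨n, rfl⟩; exact h n
    · simp
    · intro g g' _ _ hg hg'
      rw [map_add, inner_add_left, hg, hg', add_zero]
    · intro c g _ hg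
      rw [map_smul, inner_smul_left, hg, mul_zero]
  rw [wavepacket, map_smul, map_smul, inner_smul_left, mul_eq_zero] at h1
  refine h1.resolve_left ?_
  rw [map_eq_zero, mul_eq_zero, not_or]
  refine ⟨?_, Complex.exp_ne_zero _⟩
  have := Real.pi_pos
  exact Complex.ofReal_ne_zero.2 (by positivity)

/-- The wavepackets with given parameters, as a Hilbert basis of `L²(ℝ)`. -/
def waveBasis (q : ℂ) (β : ℝ) : HilbertBasis ℕ ℂ L2R :=
  HilbertBasis.mkOfOrthogonalEqBot (orthonormal_wavepacket q β) (by
    refine (Submodule.eq_bot_iff _).2 fun f hf =>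
      eq_zero_of_inner_wavepacket (q := q) (β := β) fun n => ?_
    exact (Submodule.mem_orthogonal _ _).1 hf _ (Submodule.subset_span ⟨n, rfl⟩))

theorem waveBasis_apply (q : ℂ) (β : ℝ) (n : ℕ) : waveBasis q β n = toL2 (wavepacket q β n) := by
  rw [waveBasis, HilbertBasis.coe_mkOfOrthogonalEqBot]

/-- The metaplectic operator with parameters `(q, β)`: the unitary operator that maps the Hermite
functions to the wavepackets. -/
def metaplectic (q : ℂ) (β : ℝ) : L2R ≃ₗᵢ[ℂ] L2R :=
  (waveBasis 0 0).repr.trans (waveBasis q β).repr.symm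

theorem metaplectic_hermiteL2 (q : ℂ) (β : ℝ) (n : ℕ) :
    metaplectic q β (hermiteL2 n) = toL2 (wavepacket q β n) := by
  rw [← toL2_wavepacket_zero_zero, ← waveBasis_apply, ← waveBasis_apply, metaplectic,
    LinearIsometryEquiv.trans_apply, HilbertBasis.repr_self, HilbertBasis.repr_symm_single]

theorem metaplectic_wavepacket (q : ℂ) (β : ℝ) (n : ℕ) :
    metaplectic q β (toL2 (wavepacket 0 0 n)) = toL2 (wavepacket q β n) := by
  rw [toL2_wavepacket_zero_zero, metaplectic_hermiteL2]

theorem inner_wavepacket_metaplectic (q : ℂ) (β : ℝ) (n : ℕ) (ψ : L2R) :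
    inner ℂ (toL2 (wavepacket q β n)) (metaplectic q β ψ) = inner ℂ (hermiteL2 n) ψ := by
  rw [← metaplectic_hermiteL2, LinearIsometryEquiv.inner_map_map]

/-! ### Dependence of the wavepackets on the parameters -/

/-- The three-term recursion, with multiplication by `x` as the only operator: derivatives of the
wavepackets in the parameters then only involve moments of the ground state. -/
theorem wavepacket_succ_eq (q : ℂ) (β : ℝ) (n : ℕ) :
    wavepacket q β (n + 1) = (Complex.exp (-q) * ((Real.sqrt (n + 1))⁻¹ : ℝ)) •
      (invSqrtTwo⁻¹ • posOp (wavepacket q β n) -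
        (Complex.exp (starRingEnd ℂ q) * (Real.sqrt n : ℝ)) • wavepacket q β (n - 1)) := by
  have h1 : Complex.exp (-q) * Complex.exp q = 1 := by rw [← Complex.exp_add]; simp
  have h2 : (((Real.sqrt (n + 1))⁻¹ : ℝ) : ℂ) * (Real.sqrt (n + 1) : ℝ) = 1 := by
    rw [Complex.ofReal_inv, inv_mul_cancel₀ (sqrt_succ_ne_zero n)]
  rw [posOp_wavepacket, smul_smul invSqrtTwo⁻¹, inv_mul_cancel₀ invSqrtTwo_ne_zero, one_smul,
    Complex.exp_conj, add_sub_cancel_right, smul_smul, mul_mul_mul_comm, h1, h2, one_mul, one_smul]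

theorem momSlope_re (q : ℂ) (β : ℝ) : (momSlope q β).re = β := by
  rw [momSlope, Complex.add_re, Complex.ofReal_re, mul_comm, Complex.re_ofReal_mul, Complex.I_re,
    mul_zero, add_zero]

theorem momSlope_im (q : ℂ) (β : ℝ) : (momSlope q β).im = Real.exp (-2 * q.re) := by
  rw [momSlope, Complex.add_im, Complex.ofReal_im, mul_comm, Complex.im_ofReal_mul, Complex.I_im,
    mul_one, zero_add]

/-- The curve `(q(t), β(t))` has at time `t` the velocity that the Hamiltonian
`½ (a x² + 2 b x ξ + c ξ²)` prescribes: `Q' = b Q + c P` and `P' = -a Q - b P`, expressed in terms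
of `q` and `β`. -/
def IsHamiltonianAt (a b c : ℝ) (q : ℝ → ℂ) (β : ℝ → ℝ) (t : ℝ) : Prop :=
  HasDerivAt q (b + c * momSlope (q t) (β t)) t ∧
    HasDerivAt β (-a - 2 * b * β t - c * (β t ^ 2 - Real.exp (-2 * (q t).re) ^ 2)) t

/-- The Riccati equation for the slope. -/
theorem IsHamiltonianAt.hasDerivAt_momSlope {a b c : ℝ} {q : ℝ → ℂ} {β : ℝ → ℝ} {t : ℝ}
    (h : IsHamiltonianAt a b c q β t) :
    HasDerivAt (fun τ => momSlope (q τ) (β τ)) (-(a + 2 * b * momSlope (q t) (β t) +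
      c * momSlope (q t) (β t) ^ 2)) t := by
  have h1 : HasDerivAt (fun τ => (q τ).re) (b + c * β t) t := by
    have := Complex.reCLM.hasFDerivAt.comp_hasDerivAt t h.1
    convert! this using 1
    rw [Complex.reCLM_apply, Complex.add_re, Complex.re_ofReal_mul, momSlope_re,
      Complex.ofReal_re]
  have h2 := ((h1.const_mul (-2)).exp.ofReal_comp.const_mul Complex.I)
  convert! h.2.ofReal_comp.add h2 using 1
  rw [momSlope]
  push_cast
  linear_combination (-c * (Complex.exp (-2 * (q t).re)) ^ 2) * Complex.I_mul_I

/-- On the ground state `D` acts as multiplication by `w x`. -/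
theorem weylOp_wavepacket_zero (a b c : ℝ) (q : ℂ) (β : ℝ) :
    weylOp a b c (wavepacket q β 0) = (1 / 2 : ℂ) •
      ((a + 2 * b * momSlope q β + c * momSlope q β ^ 2) • posOp (posOp (wavepacket q β 0)) -
        (Complex.I * (b + c * momSlope q β)) • wavepacket q β 0) := by
  have h : momOp (wavepacket q β 0) = momSlope q β • posOp (wavepacket q β 0) := by
    rw [wavepacket, map_smul, map_smul, momOp_gaussianS (gaussExponent_re_pos q β),
      gaussExponent, smul_comm (momSlope q β)]
    congr 2
    linear_combination (-momSlope q β) * Complex.I_mul_I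
  rw [weylOp_apply, h, map_smul, map_smul, momOp_posOp, h, map_smul]
  module

/-- The evolution equation of the wavepackets and all their moments, by induction on the level: for
the ground state it is the Riccati equation, and the recursion `wavepacket_succ_eq` propagates it
through the commutator of `x` with the quadratic operator. The powers of `x` are carried along
because multiplication by `x` is not continuous on `L²`. -/
theorem IsHamiltonianAt.hasDerivAt_posOp_pow_wavepacket {a b c : ℝ} {q : ℝ → ℂ} {β : ℝ → ℝ}
    {t : ℝ} (h : IsHamiltonianAt a b c q β t) (n k : ℕ) :
    HasDerivAt (fun τ => toL2 ((posOp ^ k) (wavepacket (q τ) (β τ) n)))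
      (toL2 ((posOp ^ k) (-Complex.I • weylOp a b c (wavepacket (q t) (β t) n)))) t := by
  induction n using Nat.strong_induction_on generalizing k with
  | _ n ih =>
  rcases n with _ | n
  · have h1 := (hasDerivAt_toL2_gaussianS k (gaussExponent_re_pos (q t) (β t))).scomp t
      (h.hasDerivAt_momSlope.const_mul (-Complex.I))
    have h0 : HasDerivAt (fun τ => -q τ) _ t := h.1.neg
    have h2 := ((h0.div_const 2).cexp).const_mul (((Real.sqrt (Real.sqrt Real.pi))⁻¹ : ℝ) : ℂ)
    convert! h2.smul h1 using 1
    · ext τ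
      simp only [wavepacket, map_smul]; rfl
    · rw [weylOp_wavepacket_zero, wavepacket]
      have : (posOp ^ k) (posOp (posOp (gaussianS (gaussExponent (q t) (β t))))) =
          (posOp ^ (k + 2)) (gaussianS (gaussExponent (q t) (β t))) := by
        rw [pow_add, mul_apply_eq_comp, pow_two, mul_apply_eq_comp]
      simp only [map_smul, map_sub, this, Function.comp_apply, ← gaussExponent.eq_1,
        Complex.ofReal_inv]
      match_scalars
      · ring
      · linear_combination (1 / 2 * ((Real.sqrt (Real.sqrt Real.pi) : ℝ) : ℂ)⁻¹ *
          Complex.exp (-q t / 2) * (b + c * momSlope (q t) (β t))) * Complex.I_mul_I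
  · have ih1 := ih n (by omega) (k + 1)
    have ih2 := ih (n - 1) (by omega) k
    have hq := h.1
    have hq' : HasDerivAt (fun τ => -q τ) _ t := hq.neg
    have hs := (hq'.cexp).mul_const (((Real.sqrt (n + 1))⁻¹ : ℝ) : ℂ)
    have hqc : HasDerivAt (fun τ => starRingEnd ℂ (q τ))
        (starRingEnd ℂ (b + c * momSlope (q t) (β t))) t :=
      (Complex.conjCLE : ℂ →L[ℝ] ℂ).hasFDerivAt.comp_hasDerivAt t hq
    have hc := (hqc.cexp).mul_const ((Real.sqrt n : ℝ) : ℂ)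
    convert! hs.smul ((ih1.const_smul invSqrtTwo⁻¹).sub (hc.smul ih2)) using 1
    · ext τ
      simp only [wavepacket_succ_eq, map_smul, map_sub, pow_succ, mul_apply_eq_comp]
      rfl
    · have hV : invSqrtTwo⁻¹ • ((b : ℂ) • posOp (wavepacket (q t) (β t) n) +
          (c : ℂ) • momOp (wavepacket (q t) (β t) n)) =
          ((b + c * momSlope (q t) (β t)) * (Complex.exp (q t) * (Real.sqrt (n + 1) : ℝ))) •
            wavepacket (q t) (β t) (n + 1) +
          (starRingEnd ℂ (b + c * momSlope (q t) (β t)) *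
            (Complex.exp (starRingEnd ℂ (q t)) * (Real.sqrt n : ℝ))) •
            wavepacket (q t) (β t) (n - 1) := by
        rw [posOp_wavepacket, momOp_wavepacket, smul_comm (b : ℂ), smul_comm (c : ℂ), ← smul_add,
          smul_smul invSqrtTwo⁻¹, inv_mul_cancel₀ invSqrtTwo_ne_zero, one_smul, momParam,
          ← Complex.exp_conj]
        simp only [map_add, map_mul, Complex.conj_ofReal, ← Complex.exp_conj]
        module
      have h1 : Complex.exp (-q t) * Complex.exp (q t) = 1 := by rw [← Complex.exp_add]; simp
      have h2 : (((Real.sqrt (n + 1))⁻¹ : ℝ) : ℂ) * (Real.sqrt (n + 1) : ℝ) = 1 := by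
        rw [Complex.ofReal_inv, inv_mul_cancel₀ (sqrt_succ_ne_zero n)]
      have h3 : (b + c * momSlope (q t) (β t)) • wavepacket (q t) (β t) (n + 1) =
          (Complex.exp (-q t) * (((Real.sqrt (n + 1))⁻¹ : ℝ) : ℂ)) •
            ((b + c * momSlope (q t) (β t)) * (Complex.exp (q t) * (Real.sqrt (n + 1) : ℝ))) •
            wavepacket (q t) (β t) (n + 1) := by
        rw [smul_smul]
        congr 1
        linear_combination (-(b + c * momSlope (q t) (β t))) * h1 -
          (b + c * momSlope (q t) (β t)) * Complex.exp (-q t) * Complex.exp (q t) * h2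
      have key : -Complex.I • weylOp a b c (wavepacket (q t) (β t) (n + 1)) =
          (Complex.exp (-q t) * (((Real.sqrt (n + 1))⁻¹ : ℝ) : ℂ)) •
            (invSqrtTwo⁻¹ • posOp (-Complex.I • weylOp a b c (wavepacket (q t) (β t) n)) -
              ((Complex.exp (starRingEnd ℂ (q t)) * (Real.sqrt n : ℝ)) •
                (-Complex.I • weylOp a b c (wavepacket (q t) (β t) (n - 1))) +
              (Complex.exp (starRingEnd ℂ (q t)) * starRingEnd ℂ (b + c * momSlope (q t) (β t)) *
                (Real.sqrt n : ℝ)) • wavepacket (q t) (β t) (n - 1))) -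
          (b + c * momSlope (q t) (β t)) • wavepacket (q t) (β t) (n + 1) := by
        rw [h3, ← sub_eq_iff_eq_add.2 hV, wavepacket_succ_eq]
        simp only [map_smul, map_sub, weylOp_posOp, Complex.ofReal_inv]
        match_scalars
        · ring
        · linear_combination (invSqrtTwo⁻¹ * Complex.exp (-q t) *
            ((Real.sqrt (n + 1) : ℝ) : ℂ)⁻¹ * b) * Complex.I_mul_I
        · linear_combination (invSqrtTwo⁻¹ * Complex.exp (-q t) *
            ((Real.sqrt (n + 1) : ℝ) : ℂ)⁻¹ * c) * Complex.I_mul_I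
        · ring
        · ring
      rw [key, wavepacket_succ_eq]
      generalize (b : ℂ) + c * momSlope (q t) (β t) = v
      simp only [map_smul, map_sub, map_add, pow_succ, mul_apply_eq_comp, Pi.sub_apply,
        Pi.smul_apply, Pi.smul_apply']
      module

/-- Hagedorn's theorem: along a Hamiltonian curve the wavepackets solve the Schrödinger equation
`i ∂_t Ψ_n = L Ψ_n` of the quantized quadratic Hamiltonian. -/
theorem IsHamiltonianAt.hasDerivAt_wavepacket {a b c : ℝ} {q : ℝ → ℂ} {β : ℝ → ℝ}
    {t : ℝ} (h : IsHamiltonianAt a b c q β t) (n : ℕ) :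
    HasDerivAt (fun τ => toL2 (wavepacket (q τ) (β τ) n))
      (-Complex.I • toL2 (weylOp a b c (wavepacket (q t) (β t) n))) t := by
  simpa using h.hasDerivAt_posOp_pow_wavepacket n 0

theorem analyticAt_toL2_gaussianS (k : ℕ) {Γ : ℂ} (h : 0 < Γ.re) :
    AnalyticAt ℂ (fun Γ => toL2 ((posOp ^ k) (gaussianS Γ))) Γ := by
  have ho : IsOpen {z : ℂ | 0 < z.re} := isOpen_lt continuous_const Complex.continuous_re
  refine DifferentiableOn.analyticAt (s := {z : ℂ | 0 < z.re}) ?_ (ho.mem_nhds h)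
  exact fun z hz => (hasDerivAt_toL2_gaussianS k hz).differentiableAt.differentiableWithinAt

theorem analyticAt_cexp_real (z : ℂ) : AnalyticAt ℝ Complex.exp z :=
  (analyticAt_cexp (z := z)).restrictScalars

section Analytic

variable {E : Type*} [NormedAddCommGroup E] [NormedSpace ℝ E] {q : E → ℂ} {β : E → ℝ} {θ : E}

theorem analyticAt_posOp_pow_wavepacket (hq : AnalyticAt ℝ q θ) (hβ : AnalyticAt ℝ β θ)
    (n k : ℕ) : AnalyticAt ℝ (fun θ => toL2 ((posOp ^ k) (wavepacket (q θ) (β θ) n))) θ := by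
  induction n using Nat.strong_induction_on generalizing k with
  | _ n ih =>
  rcases n with _ | n
  · have hre : AnalyticAt ℝ (fun θ => (q θ).re) θ := (Complex.reCLM.analyticAt _).comp hq
    have he : AnalyticAt ℝ (fun θ => Real.exp (-2 * (q θ).re)) θ :=
      (analyticAt_const.mul hre).rexp
    have hw : AnalyticAt ℝ (fun θ => gaussExponent (q θ) (β θ)) θ :=
      analyticAt_const.mul (((Complex.ofRealCLM.analyticAt _).comp hβ).add
        (analyticAt_const.mul ((Complex.ofRealCLM.analyticAt _).comp he)))
    have hg : AnalyticAt ℝ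
        (fun θ => toL2 ((posOp ^ k) (gaussianS (gaussExponent (q θ) (β θ))))) θ :=
      ((analyticAt_toL2_gaussianS k (gaussExponent_re_pos (q θ) (β θ))).restrictScalars
        (𝕜 := ℝ)).comp_of_eq hw rfl
    have hs : AnalyticAt ℝ (fun θ => (((Real.sqrt (Real.sqrt Real.pi))⁻¹ : ℝ) : ℂ) *
        Complex.exp (-q θ / 2)) θ := by
      have h1 : AnalyticAt ℝ (fun θ => -q θ / 2) θ := hq.neg.mul analyticAt_const
      exact analyticAt_const.mul ((analyticAt_cexp_real _).comp h1)
    refine (hs.smul hg).congr (Filter.Eventually.of_forall fun θ => ?_)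
    simp only [wavepacket, map_smul]; rfl
  · have hs : AnalyticAt ℝ (fun θ => Complex.exp (-q θ) * (((Real.sqrt (n + 1))⁻¹ : ℝ) : ℂ)) θ :=
      ((analyticAt_cexp_real _).comp hq.neg).mul analyticAt_const
    have hqc : AnalyticAt ℝ (fun θ => starRingEnd ℂ (q θ)) θ :=
      ((Complex.conjCLE : ℂ →L[ℝ] ℂ).analyticAt _).comp hq
    have hc : AnalyticAt ℝ (fun θ => Complex.exp (starRingEnd ℂ (q θ)) * (Real.sqrt n : ℝ)) θ :=
      ((analyticAt_cexp_real _).comp hqc).mul analyticAt_const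
    have hr : AnalyticAt ℝ (fun _ : E => invSqrtTwo⁻¹) θ := analyticAt_const
    have := hs.smul ((hr.smul (ih n (by omega) (k + 1))).sub (hc.smul (ih (n - 1) (by omega) k)))
    refine this.congr (Filter.Eventually.of_forall fun θ => ?_)
    simp only [wavepacket_succ_eq, map_smul, map_sub, pow_succ, mul_apply_eq_comp]; rfl

theorem analyticAt_wavepacket (hq : AnalyticAt ℝ q θ) (hβ : AnalyticAt ℝ β θ) (n : ℕ) :
    AnalyticAt ℝ (fun θ => toL2 (wavepacket (q θ) (β θ) n)) θ := by
  simpa using analyticAt_posOp_pow_wavepacket hq hβ n 0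

end Analytic

/-! ### Boundedness of the metaplectic operators on the spaces `𝓗^s` -/

theorem hasSum_norm_sq_inner_wavepacket (q : ℂ) (β : ℝ) (ψ : L2R) :
    HasSum (fun n => ‖inner ℂ (toL2 (wavepacket q β n)) ψ‖ ^ 2) (‖ψ‖ ^ 2) := by
  have h := (waveBasis q β).hasSum_inner_mul_inner ψ ψ
  simp only [waveBasis_apply] at h
  have h2 := Complex.reCLM.hasSum h
  convert! h2 using 1
  · ext n
    rw [← inner_conj_symm ψ, Complex.reCLM_apply, Complex.conj_mul',
      ← Complex.ofReal_pow, Complex.ofReal_re]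
  · rw [inner_self_eq_norm_sq_to_K]
    norm_cast

/-- The energy `∑ w_{min(n,N)} |x_n|²` for the weight `w` truncated at `N`, written as a finite
sum with the help of `∑ |x_n|² = m`. -/
def truncEnergy (w : ℕ → ℝ) (N : ℕ) (m : ℝ) (x : ℕ → ℂ) : ℝ :=
  w N * m - ∑ n ∈ Finset.range N, (w N - w n) * ‖x n‖ ^ 2

theorem hasSum_truncEnergy (w : ℕ → ℝ) (N : ℕ) {m : ℝ} {x : ℕ → ℂ}
    (h : HasSum (fun n => ‖x n‖ ^ 2) m) :
    HasSum (fun n => w (min n N) * ‖x n‖ ^ 2) (truncEnergy w N m x) := by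
  have h1 : HasSum (fun n => (w N - w (min n N)) * ‖x n‖ ^ 2)
      (∑ n ∈ Finset.range N, (w N - w n) * ‖x n‖ ^ 2) := by
    have : ∑ n ∈ Finset.range N, (w N - w n) * ‖x n‖ ^ 2 =
        ∑ n ∈ Finset.range N, (w N - w (min n N)) * ‖x n‖ ^ 2 := by
      refine Finset.sum_congr rfl fun n hn => ?_
      rw [min_eq_left (Finset.mem_range.1 hn).le]
    rw [this]
    refine hasSum_sum_of_ne_finset_zero fun n hn => ?_
    rw [min_eq_right (by simpa using hn), sub_self, zero_mul]
  convert! (h.mul_left (w N)).sub h1 using 1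
  ext n; ring

/-- The commutator estimate behind the boundedness on `𝓗^s`: along a Hamiltonian flow the
coefficients `x_n = ⟨Ψ_n, ψ⟩` satisfy a band system whose off-diagonal entries grow linearly in
`n`, while the weight varies slowly; hence the truncated energies grow at most exponentially,
uniformly in the truncation. -/
theorem abs_sum_hop_le {w : ℕ → ℝ} (hw0 : ∀ n, 0 ≤ w n) (hw : Monotone w) {C : ℝ}
    (hC : ∀ n, (w (n + 2) - w n) * (n + 2) ≤ C * w n) (N : ℕ) {m : ℝ} {x : ℕ → ℂ}
    (h : HasSum (fun n => ‖x n‖ ^ 2) m) {α : ℂ} {κ : ℝ} (hα : ‖α‖ ≤ κ) :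
    |∑ n ∈ Finset.range N, (w (min (n + 2) N) - w n) *
      (2 * (Complex.I * starRingEnd ℂ α * hopWeight n * starRingEnd ℂ (x n) * x (n + 2)).re)| ≤
      2 * κ * C * truncEnergy w N m x := by
  have hE := hasSum_truncEnergy w N h
  have hκ : 0 ≤ κ := (norm_nonneg α).trans hα
  have hC0 : ∀ n, 0 ≤ C * w n := fun n =>
    (mul_nonneg (sub_nonneg.2 (hw (by omega))) (by positivity)).trans (hC n)
  have h1 : ∑ n ∈ Finset.range N, w n * ‖x n‖ ^ 2 ≤ truncEnergy w N m x := by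
    refine le_trans (le_of_eq ?_) (sum_le_hasSum (Finset.range N) (fun n _ => by
      have := hw0 (min n N); positivity) hE)
    refine Finset.sum_congr rfl fun n hn => ?_
    rw [min_eq_left (Finset.mem_range.1 hn).le]
  have h2 : ∑ n ∈ Finset.range N, w n * ‖x (n + 2)‖ ^ 2 ≤ truncEnergy w N m x := by
    have h3 := sum_le_hasSum (Finset.range (N + 2)) (fun n _ => by
      have := hw0 (min n N); positivity) hE
    rw [Finset.sum_range_succ', Finset.sum_range_succ'] at h3
    have h4 : ∑ n ∈ Finset.range N, w n * ‖x (n + 2)‖ ^ 2 ≤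
        ∑ n ∈ Finset.range N, w (min (n + 1 + 1) N) * ‖x (n + 1 + 1)‖ ^ 2 := by
      refine Finset.sum_le_sum fun n hn => ?_
      have := Finset.mem_range.1 hn
      exact mul_le_mul_of_nonneg_right (hw (by omega)) (by positivity)
    have := hw0 (min (0 + 1) N)
    have := hw0 (min 0 N)
    have h5 : 0 ≤ w (min (0 + 1) N) * ‖x (0 + 1)‖ ^ 2 := by positivity
    have h6 : 0 ≤ w (min 0 N) * ‖x 0‖ ^ 2 := by positivity
    linarith
  calc _ ≤ ∑ n ∈ Finset.range N, κ * (C * w n * (‖x n‖ ^ 2 + ‖x (n + 2)‖ ^ 2)) := by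
        refine (Finset.abs_sum_le_sum_abs _ _).trans (Finset.sum_le_sum fun n hn => ?_)
        have hn' := Finset.mem_range.1 hn
        have hd0 : 0 ≤ w (min (n + 2) N) - w n := sub_nonneg.2 (hw (by omega))
        have hd : (w (min (n + 2) N) - w n) * (n + 2) ≤ C * w n := by
          refine le_trans ?_ (hC n)
          exact mul_le_mul_of_nonneg_right
            (sub_le_sub_right (hw (min_le_left _ _)) _) (by positivity)
        have hre : |(Complex.I * starRingEnd ℂ α * hopWeight n * starRingEnd ℂ (x n) *
            x (n + 2)).re| ≤ κ * (n + 2) * (‖x n‖ * ‖x (n + 2)‖) := by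
          refine (Complex.abs_re_le_norm _).trans ?_
          simp only [norm_mul, Complex.norm_I, one_mul, RCLike.norm_conj, Complex.norm_real,
            Real.norm_of_nonneg (hopWeight_nonneg n)]
          rw [mul_assoc]
          have := hopWeight_le n
          have := hopWeight_nonneg n
          gcongr
        have hxy : 2 * (‖x n‖ * ‖x (n + 2)‖) ≤ ‖x n‖ ^ 2 + ‖x (n + 2)‖ ^ 2 := by
          nlinarith [sq_nonneg (‖x n‖ - ‖x (n + 2)‖)]
        rw [abs_mul, abs_of_nonneg hd0, abs_mul, abs_two]
        calc _ ≤ (w (min (n + 2) N) - w n) * (2 * (κ * (n + 2) * (‖x n‖ * ‖x (n + 2)‖))) := by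
              gcongr
          _ = κ * (((w (min (n + 2) N) - w n) * (n + 2)) * (2 * (‖x n‖ * ‖x (n + 2)‖))) := by ring
          _ ≤ κ * (C * w n * (2 * (‖x n‖ * ‖x (n + 2)‖))) := by gcongr
          _ ≤ _ := by
              have := hC0 n
              gcongr
    _ = κ * C * (∑ n ∈ Finset.range N, w n * ‖x n‖ ^ 2 +
          ∑ n ∈ Finset.range N, w n * ‖x (n + 2)‖ ^ 2) := by
        rw [← Finset.sum_add_distrib, Finset.mul_sum]
        refine Finset.sum_congr rfl fun n _ => ?_
        ring
    _ ≤ _ := by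
        rcases le_or_gt 0 C with hC' | hC'
        · have : κ * C * (∑ n ∈ Finset.range N, w n * ‖x n‖ ^ 2 +
            ∑ n ∈ Finset.range N, w n * ‖x (n + 2)‖ ^ 2) ≤
            κ * C * (truncEnergy w N m x + truncEnergy w N m x) := by gcongr
          linarith
        · have hz : ∀ n, w n = 0 := fun n => by
            have h1 := hC0 n
            have h2 := hw0 n
            nlinarith
          simp [hz, truncEnergy]

theorem conj_diagCoeff (a b c : ℝ) (q : ℂ) (β : ℝ) :
    starRingEnd ℂ (diagCoeff a b c q β) = diagCoeff a b c q β := by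
  simp only [diagCoeff, map_mul, map_add, Complex.conj_conj, Complex.conj_ofReal, map_div₀,
    map_one, map_ofNat]
  ring

theorem IsHamiltonianAt.hasDerivAt_inner_wavepacket {a b c : ℝ} {q : ℝ → ℂ} {β : ℝ → ℝ}
    {t : ℝ} (h : IsHamiltonianAt a b c q β t) (ψ : L2R) (n : ℕ) :
    HasDerivAt (fun τ => inner ℂ (toL2 (wavepacket (q τ) (β τ) n)) ψ)
      (Complex.I * inner ℂ (toL2 (weylOp a b c (wavepacket (q t) (β t) n))) ψ) t := by
  have h1 := (h.hasDerivAt_wavepacket n).inner ℂ (hasDerivAt_const t ψ)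
  simpa [inner_smul_left] using h1

theorem inner_weylOp_wavepacket_left (a b c : ℝ) (q : ℂ) (β : ℝ) (n : ℕ) (ψ : L2R) :
    inner ℂ (toL2 (weylOp a b c (wavepacket q β n))) ψ =
      starRingEnd ℂ (hopCoeff a b c q β) * hopWeight n * inner ℂ (toL2 (wavepacket q β (n + 2))) ψ +
      diagCoeff a b c q β * (2 * n + 1) * inner ℂ (toL2 (wavepacket q β n)) ψ +
      hopCoeff a b c q β * dropWeight n * inner ℂ (toL2 (wavepacket q β (n - 2))) ψ := by
  rw [weylOp_wavepacket]
  simp only [map_add, map_smul, inner_add_left, inner_smul_left, map_mul, Complex.conj_ofReal,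
    Complex.conj_conj, conj_diagCoeff, map_one, map_ofNat, Complex.conj_natCast]

/-- The diagonal part of the band matrix is real and drops out of the evolution of `|x_n|²`; what
remains is the difference of an outgoing and an incoming current. -/
theorem IsHamiltonianAt.hasDerivAt_norm_sq_inner {a b c : ℝ} {q : ℝ → ℂ} {β : ℝ → ℝ}
    {t : ℝ} (h : IsHamiltonianAt a b c q β t) (ψ : L2R) {x : ℕ → ℂ}
    (hx : ∀ n, x n = inner ℂ (toL2 (wavepacket (q t) (β t) n)) ψ) (n : ℕ) :
    HasDerivAt (fun τ => ‖inner ℂ (toL2 (wavepacket (q τ) (β τ) n)) ψ‖ ^ 2)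
      (2 * (Complex.I * starRingEnd ℂ (hopCoeff a b c (q t) (β t)) * hopWeight n *
          starRingEnd ℂ (x n) * x (n + 2)).re -
        2 * (Complex.I * starRingEnd ℂ (hopCoeff a b c (q t) (β t)) * dropWeight n *
          starRingEnd ℂ (x (n - 2)) * x n).re) t := by
  have h1 := (h.hasDerivAt_inner_wavepacket ψ n).norm_sq
  convert! h1 using 1
  rw [inner_weylOp_wavepacket_left, ← hx, ← hx, ← hx, real_inner_eq_re_inner ℂ,
    RCLike.inner_apply, ← mul_sub]
  congr 1
  set α := hopCoeff a b c (q t) (β t)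
  set δ := diagCoeff a b c (q t) (β t) with hδ
  have hδr : δ = (δ.re : ℂ) := by
    exact (Complex.conj_eq_iff_re.1 (conj_diagCoeff a b c (q t) (β t))).symm
  rw [← Complex.sub_re]
  have e1 : (Complex.I * starRingEnd ℂ α * dropWeight n * starRingEnd ℂ (x (n - 2)) * x n).re =
      (-Complex.I * α * dropWeight n * x (n - 2) * starRingEnd ℂ (x n)).re := by
    rw [← Complex.conj_re]
    simp only [map_mul, Complex.conj_conj, Complex.conj_ofReal, Complex.conj_I]
  have e2 : (Complex.I * (δ * (2 * n + 1) * x n) * starRingEnd ℂ (x n)).re = 0 := by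
    have : Complex.I * (δ * (2 * n + 1) * x n) * starRingEnd ℂ (x n) =
        ((δ.re * (2 * n + 1) * ‖x n‖ ^ 2 : ℝ) : ℂ) * Complex.I := by
      rw [hδr]
      push_cast
      rw [← Complex.mul_conj']
      simp only [Complex.ofReal_re]
      ring
    rw [this, Complex.re_ofReal_mul, Complex.I_re, mul_zero]
  rw [Complex.sub_re, e1]
  change _ = Complex.re _
  have e3 : Complex.I * (starRingEnd ℂ α * hopWeight n * x (n + 2) + δ * (2 * n + 1) * x n +
      α * dropWeight n * x (n - 2)) * starRingEnd ℂ (x n) =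
      Complex.I * starRingEnd ℂ α * hopWeight n * starRingEnd ℂ (x n) * x (n + 2) -
        -Complex.I * α * dropWeight n * x (n - 2) * starRingEnd ℂ (x n) +
      Complex.I * (δ * (2 * n + 1) * x n) * starRingEnd ℂ (x n) := by ring
  rw [e3, Complex.add_re, e2, add_zero, Complex.sub_re]

/-- Growth rate of the truncated energy, after summation by parts of the currents. -/
theorem IsHamiltonianAt.exists_hasDerivAt_truncEnergy {a b c : ℝ} {q : ℝ → ℂ} {β : ℝ → ℝ}
    {t : ℝ} (h : IsHamiltonianAt a b c q β t) {w : ℕ → ℝ} (hw0 : ∀ n, 0 ≤ w n) (hw : Monotone w)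
    {C : ℝ} (hC : ∀ n, (w (n + 2) - w n) * (n + 2) ≤ C * w n) (N : ℕ) {κ : ℝ}
    (hα : ‖hopCoeff a b c (q t) (β t)‖ ≤ κ) (ψ : L2R) :
    ∃ D, HasDerivAt (fun τ => truncEnergy w N (‖ψ‖ ^ 2)
        (fun n => inner ℂ (toL2 (wavepacket (q τ) (β τ) n)) ψ)) D t ∧
      |D| ≤ 2 * κ * C * truncEnergy w N (‖ψ‖ ^ 2)
        (fun n => inner ℂ (toL2 (wavepacket (q t) (β t) n)) ψ) := by
  set x : ℕ → ℂ := fun n => inner ℂ (toL2 (wavepacket (q t) (β t) n)) ψ with hx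
  set J : ℕ → ℝ := fun n => 2 * (Complex.I * starRingEnd ℂ (hopCoeff a b c (q t) (β t)) *
    hopWeight n * starRingEnd ℂ (x n) * x (n + 2)).re with hJ
  set L : ℕ → ℝ := fun n => 2 * (Complex.I * starRingEnd ℂ (hopCoeff a b c (q t) (β t)) *
    dropWeight n * starRingEnd ℂ (x (n - 2)) * x n).re with hL
  have hLJ : ∀ n, L (n + 2) = J n := fun n => by
    simp only [hL, hJ, dropWeight_add_two, Nat.add_sub_cancel]
  have hsum : ∑ n ∈ Finset.range N, (w N - w n) * L n =
      ∑ n ∈ Finset.range N, (w N - w (min (n + 2) N)) * J n := by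
    have e1 : ∑ n ∈ Finset.range N, (w N - w n) * L n =
        ∑ n ∈ Finset.range (N + 2), (w N - w (min n N)) * L n := by
      rw [Finset.sum_range_succ, Finset.sum_range_succ, min_eq_right le_rfl,
        min_eq_right (by omega), sub_self, zero_mul, zero_mul, add_zero, add_zero]
      refine Finset.sum_congr rfl fun n hn => ?_
      rw [min_eq_left (Finset.mem_range.1 hn).le]
    rw [e1, Finset.sum_range_succ', Finset.sum_range_succ']
    have l0 : L 0 = 0 := by simp [hL, dropWeight_zero]
    have l1 : L (0 + 1) = 0 := by simp [hL, dropWeight_one]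
    rw [l0, l1, mul_zero, mul_zero, add_zero, add_zero]
    exact Finset.sum_congr rfl fun n _ => by rw [show n + 1 + 1 = n + 2 from rfl, hLJ]
  refine ⟨_, (HasDerivAt.fun_sum fun n (_ : n ∈ Finset.range N) =>
    (h.hasDerivAt_norm_sq_inner ψ (x := x) (fun _ => rfl) n).const_mul (w N - w n)).const_sub
      (w N * ‖ψ‖ ^ 2), ?_⟩
  refine le_trans (le_of_eq ?_) (abs_sum_hop_le hw0 hw hC N
    (hasSum_norm_sq_inner_wavepacket (q t) (β t) ψ) hα)
  rw [abs_neg]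
  congr 1
  change ∑ n ∈ Finset.range N, (w N - w n) * (J n - L n) =
    ∑ n ∈ Finset.range N, (w (min (n + 2) N) - w n) * J n
  simp only [mul_sub]
  rw [Finset.sum_sub_distrib, hsum, ← Finset.sum_sub_distrib]
  exact Finset.sum_congr rfl fun n _ => by ring

/-- Gronwall's inequality, forwards and backwards in time. -/
theorem le_exp_mul_of_abs_deriv_le {E : ℝ → ℝ} {K : ℝ}
    (hE : ∀ t ∈ Set.Icc (0 : ℝ) 1, ∃ D, HasDerivAt E D t ∧ |D| ≤ K * E t) :
    E 1 ≤ Real.exp K * E 0 ∧ E 0 ≤ Real.exp K * E 1 := by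
  choose! D hD hDE using hE
  have hexp : ∀ (σ t : ℝ), HasDerivAt (fun t => Real.exp (σ * t)) (Real.exp (σ * t) * σ) t := by
    intro σ t
    simpa using ((hasDerivAt_id t).const_mul σ).exp
  have hder : ∀ σ : ℝ, ∀ t ∈ Set.Icc (0 : ℝ) 1, HasDerivAt (fun t => Real.exp (σ * t) * E t)
      (Real.exp (σ * t) * (σ * E t + D t)) t := by
    intro σ t ht
    convert! (hexp σ t).mul (hD t ht) using 1
    ring
  have hmono : MonotoneOn (fun t => Real.exp (K * t) * E t) (Set.Icc 0 1) := by
    refine monotoneOn_of_deriv_nonneg (convex_Icc 0 1)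
      (fun t ht => (hder K t ht).continuousAt.continuousWithinAt)
      (fun t ht => (hder K t (interior_subset ht)).differentiableAt.differentiableWithinAt)
      fun t ht => ?_
    have ht' := interior_subset ht
    rw [(hder K t ht').deriv]
    have := (abs_le.1 (hDE t ht')).1
    exact mul_nonneg (Real.exp_pos _).le (by linarith)
  have hanti : AntitoneOn (fun t => Real.exp (-K * t) * E t) (Set.Icc 0 1) := by
    refine antitoneOn_of_deriv_nonpos (convex_Icc 0 1)
      (fun t ht => (hder (-K) t ht).continuousAt.continuousWithinAt)
      (fun t ht => (hder (-K) t (interior_subset ht)).differentiableAt.differentiableWithinAt)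
      fun t ht => ?_
    have ht' := interior_subset ht
    rw [(hder (-K) t ht').deriv]
    have := (abs_le.1 (hDE t ht')).2
    exact mul_nonpos_of_nonneg_of_nonpos (Real.exp_pos _).le (by linarith)
  have h0 : (0 : ℝ) ∈ Set.Icc (0 : ℝ) 1 := by simp
  have h1 : (1 : ℝ) ∈ Set.Icc (0 : ℝ) 1 := by simp
  have m := hmono h0 h1 zero_le_one
  have a := hanti h0 h1 zero_le_one
  simp only [mul_zero, mul_one, Real.exp_zero, one_mul] at m a
  refine ⟨?_, m⟩
  have := mul_le_mul_of_nonneg_left a (Real.exp_pos K).le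
  rwa [← mul_assoc, ← Real.exp_add, add_neg_cancel, Real.exp_zero, one_mul] at this

/-- The parameters `(s q, s β)`, `0 ≤ s ≤ 1`, join `(q, β)` to the identity along a Hamiltonian
curve whose off-diagonal coefficient is controlled by `q` and `β`. -/
theorem exists_isHamiltonianAt_smul (q : ℂ) (β : ℝ) {R : ℝ} (hq : ‖q‖ ≤ R) (hβ : |β| ≤ R) {s : ℝ}
    (hs : s ∈ Set.Icc (0 : ℝ) 1) :
    ∃ a b c : ℝ, IsHamiltonianAt a b c (fun s => (s : ℂ) * q) (fun s => s * β) s ∧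
      ‖hopCoeff a b c ((s : ℂ) * q) (s * β)‖ ≤ R * Real.exp (2 * R) + 2 * R := by
  have hre : ((s : ℂ) * q).re = s * q.re := Complex.re_ofReal_mul _ _
  set E := Real.exp (-2 * ((s : ℂ) * q).re) with hE
  have hEpos : 0 < E := Real.exp_pos _
  set w := momSlope ((s : ℂ) * q) (s * β) with hw
  have hwE : w = ((s * β : ℝ) : ℂ) + Complex.I * (E : ℝ) := rfl
  -- `c`, `b`, `a` are determined in this order by the imaginary part of `b + c w = q`, by its real
  -- part, and by the equation for `β`
  set c := q.im / E with hc
  set b := q.re - c * (s * β) with hb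
  set a := -β - 2 * b * (s * β) - c * ((s * β) ^ 2 - E ^ 2) with ha
  have hcE : c * E = q.im := by rw [hc]; field_simp
  have hq' : (b : ℂ) + c * w = q := by
    rw [hwE, hb]
    have := congrArg Complex.ofReal hcE
    push_cast at this ⊢
    conv_rhs => rw [← Complex.re_add_im q]
    linear_combination Complex.I * this
  have hd1 : HasDerivAt (fun s : ℝ => (s : ℂ) * q) q s := by
    simpa using (Complex.ofRealCLM.hasDerivAt (x := s)).mul_const q
  have hd2 : HasDerivAt (fun s : ℝ => s * β) β s := by
    simpa using (hasDerivAt_id s).mul_const β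
  refine ⟨a, b, c, ⟨?_, ?_⟩, ?_⟩
  · rw [← hw, hq']; exact hd1
  · convert! hd2 using 1
    rw [← hE, ha]; ring
  · have hform : (a : ℂ) + 2 * b * w + c * w ^ 2 = -β + 2 * q.re * E * Complex.I := by
      have h1 : (b : ℂ) + c * (s * β) = q.re := by
        rw [hb]; push_cast; ring
      rw [hwE, ha]
      push_cast
      linear_combination (2 * Complex.I * E) * h1 + (c : ℂ) * E ^ 2 * Complex.I_mul_I
    have hhop : hopCoeff a b c ((s : ℂ) * q) (s * β) =
        1 / 4 * Complex.exp ((s : ℂ) * q) ^ 2 * (-β + 2 * q.re * E * Complex.I) := by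
      rw [← hform, hopCoeff, momParam, ← hw]; ring
    have hQ : ‖Complex.exp ((s : ℂ) * q) ^ 2‖ = Real.exp (2 * (s * q.re)) := by
      rw [norm_pow, Complex.norm_exp, hre, ← Real.exp_nat_mul]; norm_num
    have hQE : Real.exp (2 * (s * q.re)) * E = 1 := by
      rw [hE, hre, ← Real.exp_add]; ring_nf; simp
    have hreR : |q.re| ≤ R := (Complex.abs_re_le_norm q).trans hq
    have hle : Real.exp (2 * (s * q.re)) ≤ Real.exp (2 * R) := by
      have h1 : s * q.re ≤ 1 * R := by
        have hR : 0 ≤ R := (abs_nonneg _).trans hreR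
        nlinarith [hs.1, hs.2, le_abs_self q.re,
          mul_le_mul_of_nonneg_left ((le_abs_self _).trans hreR) hs.1]
      gcongr; linarith
    rw [hhop, norm_mul, norm_mul, hQ]
    have hn : ‖(-β + 2 * q.re * E * Complex.I : ℂ)‖ ≤ |β| + 2 * |q.re| * E := by
      refine (norm_add_le _ _).trans (le_of_eq ?_)
      simp [abs_of_pos hEpos]
    have h14 : ‖(1 / 4 : ℂ)‖ = 1 / 4 := by norm_num
    rw [h14]
    calc _ ≤ 1 / 4 * Real.exp (2 * (s * q.re)) * (|β| + 2 * |q.re| * E) := by gcongr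
      _ = 1 / 4 * (|β| * Real.exp (2 * (s * q.re)) +
          2 * |q.re| * (Real.exp (2 * (s * q.re)) * E)) := by ring
      _ ≤ 1 * (R * Real.exp (2 * R) + 2 * R * (Real.exp (2 * (s * q.re)) * E)) := by
        have : 0 ≤ R := (norm_nonneg q).trans hq
        gcongr
        norm_num
      _ = _ := by rw [hQE]; ring

/-- The weight `(2n+1)^s` varies slowly: its increments over two steps are `O((2n+1)^s / n)`. -/
theorem rpow_weight_step {s : ℝ} (hs : 0 ≤ s) (n : ℕ) :
    ((2 * ((n + 2 : ℕ) : ℝ) + 1) ^ s - (2 * (n : ℝ) + 1) ^ s) * (n + 2) ≤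
      8 * s * Real.exp (4 * s) * (2 * (n : ℝ) + 1) ^ s := by
  have hn : (0 : ℝ) ≤ n := n.cast_nonneg
  have hpos : (0 : ℝ) < 2 * n + 1 := by positivity
  set y : ℝ := 4 / (2 * n + 1) with hy
  have hy4 : y ≤ 4 := by
    rw [hy, div_le_iff₀ hpos]; linarith
  have hy0 : 0 ≤ y := by positivity
  have h1 : (2 * ((n + 2 : ℕ) : ℝ) + 1) ^ s ≤ (2 * (n : ℝ) + 1) ^ s * Real.exp (y * s) := by
    rw [Real.exp_mul, ← Real.mul_rpow hpos.le (Real.exp_pos _).le]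
    refine Real.rpow_le_rpow (by positivity) ?_ hs
    have := Real.add_one_le_exp y
    calc (2 * ((n + 2 : ℕ) : ℝ) + 1) = (2 * n + 1) * (y + 1) := by
          rw [hy]; push_cast; field_simp; ring
      _ ≤ _ := by gcongr
  have h2 : Real.exp (y * s) - 1 ≤ y * s * Real.exp (4 * s) := by
    have e1 := Real.add_one_le_exp (-(y * s))
    have e2 : Real.exp (y * s) ≤ Real.exp (4 * s) := by gcongr
    have e3 : Real.exp (y * s) * Real.exp (-(y * s)) = 1 := by rw [← Real.exp_add]; simp
    have e4 := mul_le_mul_of_nonneg_left e1 (Real.exp_pos (y * s)).le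
    have e5 : y * s * Real.exp (y * s) ≤ y * s * Real.exp (4 * s) := by gcongr
    nlinarith
  have h3 : y * (n + 2) ≤ 8 := by
    rw [hy, div_mul_eq_mul_div, div_le_iff₀ hpos]; linarith
  have hW : 0 ≤ (2 * (n : ℝ) + 1) ^ s := by positivity
  calc _ ≤ ((2 * (n : ℝ) + 1) ^ s * (Real.exp (y * s) - 1)) * (n + 2) := by
        gcongr; linarith
    _ ≤ ((2 * (n : ℝ) + 1) ^ s * (y * s * Real.exp (4 * s))) * (n + 2) := by gcongr
    _ = (y * (n + 2)) * (s * Real.exp (4 * s) * (2 * (n : ℝ) + 1) ^ s) := by ring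
    _ ≤ 8 * (s * Real.exp (4 * s) * (2 * (n : ℝ) + 1) ^ s) := by gcongr
    _ = _ := by ring

/-- Removal of the truncation. -/
theorem tsum_weight_le_of_truncEnergy_le {w : ℕ → ℝ} (hw0 : ∀ n, 0 ≤ w n) (hw : Monotone w)
    {m : ℝ} {x y : ℕ → ℂ} (hx : HasSum (fun n => ‖x n‖ ^ 2) m)
    (hy : HasSum (fun n => ‖y n‖ ^ 2) m) {M : ℝ} (hM : 0 ≤ M)
    (h : ∀ N, truncEnergy w N m x ≤ M * truncEnergy w N m y) :
    ∑' n, ENNReal.ofReal (w n) * ‖x n‖ₑ ^ 2 ≤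
      ENNReal.ofReal M * ∑' n, ENNReal.ofReal (w n) * ‖y n‖ₑ ^ 2 := by
  have hterm : ∀ (z : ℕ → ℂ) (r : ℝ) (n : ℕ), 0 ≤ r → ENNReal.ofReal (r * ‖z n‖ ^ 2) =
      ENNReal.ofReal r * ‖z n‖ₑ ^ 2 := by
    intro z r n hr
    rw [ENNReal.ofReal_mul hr, ENNReal.ofReal_pow (norm_nonneg _), ofReal_norm]
  rw [ENNReal.tsum_eq_iSup_nat]
  refine iSup_le fun N => ?_
  have h1 : ∑ n ∈ Finset.range N, ENNReal.ofReal (w n) * ‖x n‖ₑ ^ 2 ≤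
      ENNReal.ofReal (truncEnergy w N m x) := by
    rw [← (hasSum_truncEnergy w N hx).tsum_eq, ENNReal.ofReal_tsum_of_nonneg
      (fun n => by have := hw0 (min n N); positivity) (hasSum_truncEnergy w N hx).summable]
    refine le_trans (le_of_eq ?_) (ENNReal.sum_le_tsum (Finset.range N))
    refine Finset.sum_congr rfl fun n hn => ?_
    rw [hterm x _ n (hw0 _), min_eq_left (Finset.mem_range.1 hn).le]
  refine h1.trans ((ENNReal.ofReal_le_ofReal (h N)).trans ?_)
  rw [ENNReal.ofReal_mul hM]
  gcongr
  rw [← (hasSum_truncEnergy w N hy).tsum_eq, ENNReal.ofReal_tsum_of_nonneg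
    (fun n => by have := hw0 (min n N); positivity) (hasSum_truncEnergy w N hy).summable]
  refine ENNReal.tsum_le_tsum fun n => ?_
  rw [hterm y _ n (hw0 _)]
  gcongr
  exact hw (min_le_left _ _)

/-- The metaplectic operators with bounded parameters are uniformly bounded on `𝓗^s`, with
uniformly bounded inverses. -/
theorem exists_sobolevNorm_metaplectic_le {s : ℝ} (hs : 0 ≤ s) (R : ℝ) :
    ∃ C : ℝ, 0 < C ∧ ∀ (q : ℂ) (β : ℝ), ‖q‖ ≤ R → |β| ≤ R → ∀ ψ : L2R,
      sobolevNorm s (metaplectic q β ψ) ≤ ENNReal.ofReal C * sobolevNorm s ψ ∧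
      sobolevNorm s ψ ≤ ENNReal.ofReal C * sobolevNorm s (metaplectic q β ψ) := by
  set w : ℕ → ℝ := fun n => (2 * (n : ℝ) + 1) ^ s with hwdef
  have hw0 : ∀ n, 0 ≤ w n := fun n => by simp only [hwdef]; positivity
  have hw : Monotone w := fun m n hmn => by
    simp only [hwdef]
    gcongr
  set M := Real.exp (2 * (R * Real.exp (2 * R) + 2 * R) * (8 * s * Real.exp (4 * s))) with hM
  refine ⟨M ^ (1 / 2 : ℝ), by positivity, fun q β hq hβ ψ => ?_⟩
  set χ := metaplectic q β ψ with hχ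
  set x : ℕ → ℂ := fun n => inner ℂ (hermiteL2 n) ψ with hx
  set y : ℕ → ℂ := fun n => inner ℂ (hermiteL2 n) χ with hy
  -- `χ` is expanded in the bases at both ends of the curve `(t q, t β)`; its coefficients at the
  -- far end are the Hermite coefficients of `ψ`
  have hx' : x = fun n => inner ℂ (toL2 (wavepacket (((1 : ℝ) : ℂ) * q) (1 * β) n)) χ := by
    ext n
    simp only [hx, Complex.ofReal_one, one_mul, hχ, inner_wavepacket_metaplectic]
  have hy' : y = fun n => inner ℂ (toL2 (wavepacket (((0 : ℝ) : ℂ) * q) (0 * β) n)) χ := by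
    ext n
    simp only [hy, Complex.ofReal_zero, zero_mul, toL2_wavepacket_zero_zero]
  have hxs : HasSum (fun n => ‖x n‖ ^ 2) (‖χ‖ ^ 2) := by
    rw [hx']; exact hasSum_norm_sq_inner_wavepacket _ _ χ
  have hys : HasSum (fun n => ‖y n‖ ^ 2) (‖χ‖ ^ 2) := by
    rw [hy']; exact hasSum_norm_sq_inner_wavepacket _ _ χ
  have hE : ∀ N, truncEnergy w N (‖χ‖ ^ 2) x ≤ M * truncEnergy w N (‖χ‖ ^ 2) y ∧
      truncEnergy w N (‖χ‖ ^ 2) y ≤ M * truncEnergy w N (‖χ‖ ^ 2) x := by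
    intro N
    rw [hx', hy']
    refine le_exp_mul_of_abs_deriv_le (E := fun t => truncEnergy w N (‖χ‖ ^ 2)
      (fun n => inner ℂ (toL2 (wavepacket ((t : ℂ) * q) (t * β) n)) χ)) fun t ht => ?_
    obtain ⟨a, b, c, hH, hα⟩ := exists_isHamiltonianAt_smul q β hq hβ ht
    exact hH.exists_hasDerivAt_truncEnergy hw0 hw (rpow_weight_step hs) N hα χ
  have hM0 : 0 ≤ M := (Real.exp_pos _).le
  have hroot : ENNReal.ofReal (M ^ (1 / 2 : ℝ)) = ENNReal.ofReal M ^ (1 / 2 : ℝ) :=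
    (ENNReal.ofReal_rpow_of_nonneg hM0 (by norm_num)).symm
  simp only [sobolevNorm]
  rw [hroot, ← ENNReal.mul_rpow_of_nonneg _ _ (by norm_num),
    ← ENNReal.mul_rpow_of_nonneg _ _ (by norm_num)]
  exact ⟨ENNReal.rpow_le_rpow (tsum_weight_le_of_truncEnergy_le hw0 hw hys hxs hM0
      fun N => (hE N).2) (by norm_num),
    ENNReal.rpow_le_rpow (tsum_weight_le_of_truncEnergy_le hw0 hw hxs hys hM0
      fun N => (hE N).1) (by norm_num)⟩

/-! ### Decay of the wavepacket coefficients of Schwartz functions -/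

/-- The symmetrized number operator `½ (A† A + A A†)`, of which the wavepackets are the
eigenfunctions. -/
def numOp (q : ℂ) (β : ℝ) : 𝓢(ℝ, ℂ) →L[ℂ] 𝓢(ℝ, ℂ) :=
  weylOp (Complex.normSq (momParam q β))
    (-(momParam q β * starRingEnd ℂ (Complex.exp q)).re) (Complex.normSq (Complex.exp q))

theorem numOp_wavepacket (q : ℂ) (β : ℝ) (n : ℕ) :
    numOp q β (wavepacket q β n) = ((n + 1 / 2 : ℝ) : ℂ) • wavepacket q β n := by
  have h := conj_exp_mul_momParam q β
  have hre : (((momParam q β * starRingEnd ℂ (Complex.exp q)).re : ℝ) : ℂ) =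
      (momParam q β * starRingEnd ℂ (Complex.exp q) +
        starRingEnd ℂ (momParam q β) * Complex.exp q) / 2 := by
    rw [Complex.re_eq_add_conj, map_mul, Complex.conj_conj]
  have hP := Complex.mul_conj (momParam q β)
  have hQ := Complex.mul_conj (Complex.exp q)
  have e1 : hopCoeff (Complex.normSq (momParam q β))
      (-(momParam q β * starRingEnd ℂ (Complex.exp q)).re) (Complex.normSq (Complex.exp q)) q β =
      0 := by
    rw [hopCoeff, Complex.ofReal_neg, hre, ← hP, ← hQ]; ring
  have e2 : diagCoeff (Complex.normSq (momParam q β))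
      (-(momParam q β * starRingEnd ℂ (Complex.exp q)).re) (Complex.normSq (Complex.exp q)) q β =
      1 / 2 := by
    rw [diagCoeff, Complex.ofReal_neg, hre, ← hP, ← hQ]
    linear_combination (-1 / 8 * (starRingEnd ℂ (Complex.exp q) * momParam q β -
      Complex.exp q * starRingEnd ℂ (momParam q β) + 2 * Complex.I)) * h -
      1 / 2 * Complex.I_mul_I
  rw [numOp, weylOp_wavepacket, e1, e2]
  simp only [map_zero, zero_mul, zero_smul, zero_add, add_zero]
  congr 1
  push_cast; ring

theorem mul_inner_wavepacket (q : ℂ) (β : ℝ) (φ : 𝓢(ℝ, ℂ)) (n : ℕ) :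
    ((n + 1 / 2 : ℝ) : ℂ) * inner ℂ (toL2 φ) (toL2 (wavepacket q β n)) =
      inner ℂ (toL2 (numOp q β φ)) (toL2 (wavepacket q β n)) := by
  rw [numOp, inner_weylOp_left, ← numOp, numOp_wavepacket, map_smul, inner_smul_right]

/-- Decay of the wavepacket coefficients of a Schwartz function. The third power suffices: one power
pays for the growth of the matrix elements and two leave a summable series. -/
theorem norm_inner_wavepacket_le (q : ℂ) (β : ℝ) (φ : 𝓢(ℝ, ℂ)) (n : ℕ) :
    ‖inner ℂ (toL2 φ) (toL2 (wavepacket q β n))‖ ≤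
      ‖toL2 (numOp q β (numOp q β (numOp q β φ)))‖ * (((n : ℝ) + 1 / 2) ^ 3)⁻¹ := by
  have hpos : (0 : ℝ) < (n : ℝ) + 1 / 2 := by positivity
  have h : (((n + 1 / 2 : ℝ) : ℂ)) ^ 3 * inner ℂ (toL2 φ) (toL2 (wavepacket q β n)) =
      inner ℂ (toL2 (numOp q β (numOp q β (numOp q β φ)))) (toL2 (wavepacket q β n)) := by
    rw [← mul_inner_wavepacket, ← mul_inner_wavepacket, ← mul_inner_wavepacket]; ring
  have h2 := norm_inner_le_norm (𝕜 := ℂ) (toL2 (numOp q β (numOp q β (numOp q β φ))))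
    (toL2 (wavepacket q β n))
  rw [← h, (orthonormal_wavepacket q β).1 n, mul_one, norm_mul, norm_pow, Complex.norm_real,
    Real.norm_of_nonneg hpos.le] at h2
  rw [← div_eq_mul_inv, le_div_iff₀ (by positivity), mul_comm]
  exact h2

theorem dropWeight_nonneg (n : ℕ) : 0 ≤ dropWeight n := by unfold dropWeight; positivity

theorem dropWeight_le (n : ℕ) : dropWeight n ≤ n := by
  rcases n with _ | _ | n
  · simp [dropWeight_zero]
  · simp [dropWeight_one]
  · rw [dropWeight_add_two]
    refine (hopWeight_le n).trans (le_of_eq ?_)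
    push_cast; ring

theorem norm_toL2_weylOp_wavepacket_le (a b c : ℝ) (q : ℂ) (β : ℝ) (n : ℕ) :
    ‖toL2 (weylOp a b c (wavepacket q β n))‖ ≤
      4 * (‖hopCoeff a b c q β‖ + ‖diagCoeff a b c q β‖) * ((n : ℝ) + 1 / 2) := by
  have hn : ∀ k, ‖toL2 (wavepacket q β k)‖ = 1 := (orthonormal_wavepacket q β).1
  rw [weylOp_wavepacket]
  simp only [map_add, map_smul]
  refine (norm_add₃_le).trans ?_
  simp only [norm_smul, norm_mul, hn, mul_one, RCLike.norm_conj, Complex.norm_real,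
    Real.norm_of_nonneg (hopWeight_nonneg n), Real.norm_of_nonneg (dropWeight_nonneg n)]
  have h1 : ‖(2 * (n : ℂ) + 1)‖ = 2 * (n : ℝ) + 1 := by
    have : (2 * (n : ℂ) + 1) = ((2 * n + 1 : ℝ) : ℂ) := by push_cast; ring
    rw [this, Complex.norm_real, Real.norm_of_nonneg (by positivity)]
  rw [h1]
  have h2 := mul_le_mul_of_nonneg_left (hopWeight_le n) (norm_nonneg (hopCoeff a b c q β))
  have h3 := mul_le_mul_of_nonneg_left (dropWeight_le n) (norm_nonneg (hopCoeff a b c q β))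
  have h4 : 0 ≤ ‖diagCoeff a b c q β‖ * (n : ℝ) := by positivity
  have h5 : 0 ≤ ‖hopCoeff a b c q β‖ * (n : ℝ) := by positivity
  nlinarith [norm_nonneg (diagCoeff a b c q β)]

theorem summable_inv_add_half_sq : Summable fun n : ℕ => (((n : ℝ) + 1 / 2) ^ 2)⁻¹ := by
  have h1 : Summable fun n : ℕ => (((n + 1 : ℕ) : ℝ) ^ 2)⁻¹ :=
    (summable_nat_add_iff 1).2 (Real.summable_nat_pow_inv.2 one_lt_two)
  refine Summable.of_nonneg_of_le (fun n => by positivity) (fun n => ?_) (h1.mul_left 4)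
  rw [← div_eq_mul_inv, le_div_iff₀ (by positivity), inv_mul_le_iff₀ (by positivity)]
  push_cast
  nlinarith [n.cast_nonneg (α := ℝ)]

theorem inv_cube_le_inv_sq (n : ℕ) :
    (((n : ℝ) + 1 / 2) ^ 3)⁻¹ ≤ 2 * (((n : ℝ) + 1 / 2) ^ 2)⁻¹ := by
  rw [pow_succ, mul_inv, mul_comm]
  have : ((n : ℝ) + 1 / 2)⁻¹ ≤ 2 := by
    rw [inv_le_comm₀ (by positivity) two_pos]
    linarith [n.cast_nonneg (α := ℝ)]
  gcongr

theorem hasSum_wavepacket (q : ℂ) (β : ℝ) (ψ : L2R) :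
    HasSum (fun n => inner ℂ (toL2 (wavepacket q β n)) ψ • toL2 (wavepacket q β n)) ψ := by
  have h := (waveBasis q β).hasSum_repr ψ
  simpa only [HilbertBasis.repr_apply_apply, waveBasis_apply] using h

/-- The wavepacket expansion of a Schwartz function converges in the graph norm of every quadratic
operator. -/
theorem hasSum_weylOp_wavepacket (a b c : ℝ) (q : ℂ) (β : ℝ) (φ : 𝓢(ℝ, ℂ)) :
    HasSum (fun n => inner ℂ (toL2 (wavepacket q β n)) (toL2 φ) •
      toL2 (weylOp a b c (wavepacket q β n))) (toL2 (weylOp a b c φ)) := by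
  set κ := ‖hopCoeff a b c q β‖ + ‖diagCoeff a b c q β‖ with hκ
  set D := ‖toL2 (numOp q β (numOp q β (numOp q β φ)))‖ with hD
  have hs : Summable (fun n => inner ℂ (toL2 (wavepacket q β n)) (toL2 φ) •
      toL2 (weylOp a b c (wavepacket q β n))) := by
    refine Summable.of_norm_bounded (summable_inv_add_half_sq.mul_left (4 * κ * D)) fun n => ?_
    rw [norm_smul, ← inner_conj_symm, RCLike.norm_conj]
    have h1 := norm_inner_wavepacket_le q β φ n
    have h2 := norm_toL2_weylOp_wavepacket_le a b c q β n
    have hpos : (0 : ℝ) < (n : ℝ) + 1 / 2 := by positivity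
    calc _ ≤ (D * (((n : ℝ) + 1 / 2) ^ 3)⁻¹) * (4 * κ * ((n : ℝ) + 1 / 2)) := by
          gcongr
      _ = _ := by field_simp
  obtain ⟨S, hS⟩ := hs
  suffices S = toL2 (weylOp a b c φ) by rwa [this] at hS
  rw [← sub_eq_zero]
  refine eq_zero_of_inner_wavepacket (q := q) (β := β) fun m => ?_
  rw [inner_sub_right, sub_eq_zero]
  have h1 := (innerSL ℂ (toL2 (wavepacket q β m))).hasSum hS
  have h2 := (innerSL ℂ (toL2 (weylOp a b c (wavepacket q β m)))).hasSum
    (hasSum_wavepacket q β (toL2 φ))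
  simp only [innerSL_apply_apply, inner_smul_right, inner_weylOp_left] at h1 h2
  exact h1.unique h2

/-! ### Unitary equivalence of quadratic operators -/

/-- The maximal realization of a quadratic operator is determined by its action on wavepackets. -/
theorem isDistribImage_weylOp_iff (a b c : ℝ) (q : ℂ) (β : ℝ) (u w : L2R) :
    IsDistribImage (weylOp a b c) u w ↔
      ∀ n, inner ℂ (toL2 (weylOp a b c (wavepacket q β n))) u =
        inner ℂ (toL2 (wavepacket q β n)) w := by
  refine ⟨fun h n => h _, fun h φ => ?_⟩
  have h1 := (innerSL ℂ u).hasSum (hasSum_weylOp_wavepacket a b c q β φ)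
  have h2 := (innerSL ℂ w).hasSum (hasSum_wavepacket q β (toL2 φ))
  simp only [innerSL_apply_apply, inner_smul_right] at h1 h2
  have h3 : ∀ n, inner ℂ u (toL2 (weylOp a b c (wavepacket q β n))) =
      inner ℂ w (toL2 (wavepacket q β n)) := fun n => by
    rw [← inner_conj_symm, h n, inner_conj_symm]
  simp only [h3] at h1
  have h4 := h1.unique h2
  change inner ℂ (toL2 (weylOp a b c φ)) u = inner ℂ (toL2 φ) w
  rw [← inner_conj_symm, h4, inner_conj_symm]

/-- Egorov's theorem for quadratic operators, in matrix form: the metaplectic operator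
intertwines two quadratic operators with the same ladder coefficients. -/
theorem metaplectic_weylOp {a b c a' b' c' : ℝ} {q : ℂ} {β : ℝ}
    (h1 : hopCoeff a' b' c' q β = hopCoeff a b c 0 0)
    (h2 : diagCoeff a' b' c' q β = diagCoeff a b c 0 0) (n : ℕ) :
    metaplectic q β (toL2 (weylOp a b c (wavepacket 0 0 n))) =
      toL2 (weylOp a' b' c' (wavepacket q β n)) := by
  simp only [weylOp_wavepacket, map_add, map_smul, metaplectic_wavepacket, h1, h2]

theorem unitarilyEquivalent_weylOp {a b c a' b' c' : ℝ} {q : ℂ} {β : ℝ}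
    (h1 : hopCoeff a' b' c' q β = hopCoeff a b c 0 0)
    (h2 : diagCoeff a' b' c' q β = diagCoeff a b c 0 0) :
    UnitarilyEquivalent (l2Op (weylOp a b c)) (l2Op (weylOp a' b' c')) := by
  refine ⟨metaplectic q β, fun u w => ?_⟩
  rw [mem_graph_l2Op, mem_graph_l2Op, isDistribImage_weylOp_iff a b c 0 0,
    isDistribImage_weylOp_iff a' b' c' q β]
  refine forall_congr' fun n => ?_
  rw [← metaplectic_weylOp h1 h2, ← metaplectic_wavepacket q β n,
    LinearIsometryEquiv.inner_map_map, LinearIsometryEquiv.inner_map_map]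

/-! ### Strong continuity -/

section Continuity

variable {q : ℝ → ℂ} {β : ℝ → ℝ}

/-- Norm continuity of the wavepackets in the parameters gives strong continuity of the
unitaries. -/
theorem continuous_metaplectic_apply
    (h : ∀ n, Continuous fun t => toL2 (wavepacket (q t) (β t) n)) (ψ : L2R) :
    Continuous fun t => metaplectic (q t) (β t) ψ := by
  refine continuous_of_uniform_approx_of_continuous fun V hV => ?_
  obtain ⟨ε, hε, hεV⟩ := Metric.mem_uniformity_dist.1 hV
  obtain ⟨s, hs⟩ := ((Metric.tendsto_nhds.1 (hasSum_wavepacket 0 0 ψ)) ε hε).exists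
  refine ⟨fun t => metaplectic (q t) (β t) (∑ n ∈ s,
    inner ℂ (toL2 (wavepacket 0 0 n)) ψ • toL2 (wavepacket 0 0 n)), ?_, fun t => hεV ?_⟩
  · simp only [map_sum, map_smul, metaplectic_wavepacket]
    fun_prop
  · rw [LinearIsometryEquiv.dist_map, dist_comm]; exact hs

theorem continuous_metaplectic_apply_iff
    (h : ∀ n, Continuous fun t => toL2 (wavepacket (q t) (β t) n)) (v : ℝ → L2R) :
    (Continuous fun t => metaplectic (q t) (β t) (v t)) ↔ Continuous v := by
  have key : ∀ t₀ t, dist (v t) (v t₀) =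
      dist (metaplectic (q t) (β t) (v t)) (metaplectic (q t) (β t) (v t₀)) :=
    fun t₀ t => (LinearIsometryEquiv.dist_map _ _ _).symm
  constructor
  · intro hu
    refine continuous_iff_continuousAt.2 fun t₀ => ?_
    refine tendsto_iff_dist_tendsto_zero.2 ?_
    simp only [key t₀]
    have h1 := (hu.tendsto t₀).dist ((continuous_metaplectic_apply h (v t₀)).tendsto t₀)
    simpa using h1
  · intro hv
    refine continuous_iff_continuousAt.2 fun t₀ => ?_
    refine tendsto_iff_dist_tendsto_zero.2 ?_
    have h1 := tendsto_iff_dist_tendsto_zero.1 (hv.tendsto t₀)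
    have h2 := tendsto_iff_dist_tendsto_zero.1
      ((continuous_metaplectic_apply h (v t₀)).tendsto t₀)
    refine squeeze_zero (fun _ => dist_nonneg) (fun t => dist_triangle _
      (metaplectic (q t) (β t) (v t₀)) _) ?_
    simp only [← key t₀]
    simpa using h1.add h2

end Continuity

/-! ### Conjugation of the equations -/

theorem inner_real_smul_left (r : ℝ) (x y : L2R) :
    inner ℂ (r • x) y = r • inner ℂ x y := by
  rw [RCLike.real_smul_eq_coe_smul (K := ℂ) r x, inner_smul_left, RCLike.conj_ofReal,
    Complex.real_smul]
  rfl

/-- A product rule for a differentiable test vector and a curve that is only weakly differentiable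
in the direction of the test vector at time `t`. -/
theorem hasDerivAt_inner_of_weak {η u : ℝ → L2R} {η' : L2R} {z : ℂ} {t : ℝ}
    (hη : HasDerivAt η η' t) (hu : ContinuousAt u t)
    (hz : HasDerivAt (fun τ => inner ℂ (η t) (u τ)) z t) :
    HasDerivAt (fun τ => inner ℂ (η τ) (u τ)) (inner ℂ η' (u t) + z) t := by
  have h1 : HasDerivAt (fun τ => inner ℂ (η τ - η t) (u τ)) (inner ℂ η' (u t)) t := by
    rw [hasDerivAt_iff_tendsto_slope] at hη ⊢
    have h2 := hη.inner (𝕜 := ℂ) (hu.tendsto.mono_left nhdsWithin_le_nhds)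
    refine h2.congr fun τ => ?_
    rw [slope_def_module, slope_def_module, sub_self (η t), inner_zero_left, sub_zero,
      inner_real_smul_left]
  refine (h1.add hz).congr_of_eventuallyEq (Filter.Eventually.of_forall fun τ => ?_)
  simp only [Pi.add_apply]
  rw [← inner_add_left, sub_add_cancel]

theorem continuous_weylOp_apply {X : Type*} [TopologicalSpace X] {a b c : X → ℝ}
    {f : X → 𝓢(ℝ, ℂ)} (ha : Continuous a) (hb : Continuous b) (hc : Continuous c)
    (hf : Continuous f) : Continuous fun x => weylOp (a x) (b x) (c x) (f x) := by
  simp only [weylOp_apply]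
  fun_prop

theorem continuous_numOp_apply {X : Type*} [TopologicalSpace X] {q : X → ℂ} {β : X → ℝ}
    {f : X → 𝓢(ℝ, ℂ)} (hq : Continuous q) (hβ : Continuous β) (hf : Continuous f) :
    Continuous fun x => numOp (q x) (β x) (f x) := by
  have hP : Continuous fun x => momParam (q x) (β x) := by
    unfold momParam momSlope; fun_prop
  have hQ : Continuous fun x => Complex.exp (q x) := by fun_prop
  refine continuous_weylOp_apply (Complex.continuous_normSq.comp hP) ?_
    (Complex.continuous_normSq.comp hQ) hf
  exact (Complex.continuous_re.comp (hP.mul (Complex.continuous_conj.comp hQ))).neg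

theorem dropWeight_mul_inv_cube_le (n : ℕ) :
    dropWeight n * (((n : ℝ) + 1 / 2) ^ 3)⁻¹ ≤ (((n : ℝ) + 1 / 2) ^ 2)⁻¹ := by
  have h := dropWeight_le n
  have h2 : (((n : ℝ) + 1 / 2) ^ 2)⁻¹ * ((n : ℝ) + 1 / 2) ^ 3 = (n : ℝ) + 1 / 2 := by field_simp
  rw [← div_eq_mul_inv, div_le_iff₀ (by positivity), h2]
  linarith

theorem dropWeight_mul_inv_cube_sub_two_le (n : ℕ) :
    dropWeight n * ((((n - 2 : ℕ) : ℝ) + 1 / 2) ^ 3)⁻¹ ≤ 100 * (((n : ℝ) + 1 / 2) ^ 2)⁻¹ := by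
  rcases n with _ | _ | m
  · rw [dropWeight_zero, zero_mul]; positivity
  · rw [dropWeight_one, zero_mul]; positivity
  · have h := dropWeight_le (m + 1 + 1)
    have hm : (0 : ℝ) ≤ m := m.cast_nonneg
    rw [Nat.add_sub_cancel (m := 2), ← div_eq_mul_inv, ← div_eq_mul_inv,
      div_le_div_iff₀ (by positivity) (by positivity)]
    push_cast at h ⊢
    have h1 : dropWeight (m + 1 + 1) ≤ 4 * ((m : ℝ) + 1 / 2) := by linarith
    have h2 : ((m : ℝ) + 1 + 1 + 1 / 2) ^ 2 ≤ (5 * ((m : ℝ) + 1 / 2)) ^ 2 := by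
      gcongr; linarith
    calc _ ≤ (4 * ((m : ℝ) + 1 / 2)) * (5 * ((m : ℝ) + 1 / 2)) ^ 2 := by gcongr
      _ = _ := by ring

theorem hopWeight_mul_inv_cube_le (n : ℕ) :
    hopWeight n * ((((n + 2 : ℕ) : ℝ) + 1 / 2) ^ 3)⁻¹ ≤ (((n : ℝ) + 1 / 2) ^ 2)⁻¹ := by
  rw [← dropWeight_add_two]
  refine (dropWeight_mul_inv_cube_le (n + 2)).trans ?_
  push_cast
  gcongr
  linarith

theorem metaplectic_weylOp_wavepacket_zero (a b c : ℝ) (q : ℂ) (β : ℝ) (n : ℕ) :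
    metaplectic q β (toL2 (weylOp a b c (wavepacket 0 0 n))) =
      (hopCoeff a b c 0 0 * hopWeight n) • toL2 (wavepacket q β (n + 2)) +
      (diagCoeff a b c 0 0 * (2 * n + 1)) • toL2 (wavepacket q β n) +
      (starRingEnd ℂ (hopCoeff a b c 0 0) * dropWeight n) • toL2 (wavepacket q β (n - 2)) := by
  simp only [weylOp_wavepacket, map_add, map_smul, metaplectic_wavepacket]

theorem norm_two_mul_natCast_add_one (n : ℕ) : ‖(2 * (n : ℂ) + 1)‖ = 2 * ((n : ℝ) + 1 / 2) := by
  have : (2 * (n : ℂ) + 1) = ((2 * ((n : ℝ) + 1 / 2) : ℝ) : ℂ) := by push_cast; ring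
  rw [this, Complex.norm_real, Real.norm_of_nonneg (by positivity)]

theorem norm_inner_metaplectic_weylOp_le {a b c : ℝ} {q : ℂ} {β M : ℝ} {φ : 𝓢(ℝ, ℂ)}
    (hM : ‖toL2 (numOp q β (numOp q β (numOp q β φ)))‖ ≤ M) (n : ℕ) :
    ‖inner ℂ (toL2 φ) (metaplectic q β (toL2 (weylOp a b c (wavepacket 0 0 n))))‖ ≤
      103 * (‖hopCoeff a b c 0 0‖ + ‖diagCoeff a b c 0 0‖) * M * (((n : ℝ) + 1 / 2) ^ 2)⁻¹ := by
  have hM0 : 0 ≤ M := (norm_nonneg _).trans hM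
  have hd : ∀ k : ℕ, ‖inner ℂ (toL2 φ) (toL2 (wavepacket q β k))‖ ≤
      M * (((k : ℝ) + 1 / 2) ^ 3)⁻¹ := fun k =>
    (norm_inner_wavepacket_le q β φ k).trans (by gcongr)
  rw [metaplectic_weylOp_wavepacket_zero, inner_add_right, inner_add_right, inner_smul_right,
    inner_smul_right, inner_smul_right]
  set α := hopCoeff a b c 0 0
  set δ := diagCoeff a b c 0 0
  set r := (((n : ℝ) + 1 / 2) ^ 2)⁻¹ with hr
  have hr0 : 0 ≤ r := by positivity
  refine norm_add₃_le.trans ?_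
  simp only [norm_mul, RCLike.norm_conj, Complex.norm_real,
    Real.norm_of_nonneg (hopWeight_nonneg n), Real.norm_of_nonneg (dropWeight_nonneg n),
    norm_two_mul_natCast_add_one]
  have h1 : ‖α‖ * hopWeight n * ‖inner ℂ (toL2 φ) (toL2 (wavepacket q β (n + 2)))‖ ≤
      ‖α‖ * M * r := by
    calc _ ≤ ‖α‖ * hopWeight n * (M * ((((n + 2 : ℕ) : ℝ) + 1 / 2) ^ 3)⁻¹) := by
          have := hopWeight_nonneg n
          gcongr
          exact hd _
      _ = ‖α‖ * M * (hopWeight n * ((((n + 2 : ℕ) : ℝ) + 1 / 2) ^ 3)⁻¹) := by ring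
      _ ≤ _ :=
          mul_le_mul_of_nonneg_left (hopWeight_mul_inv_cube_le n) (by positivity)
  have h2 : ‖δ‖ * (2 * ((n : ℝ) + 1 / 2)) * ‖inner ℂ (toL2 φ) (toL2 (wavepacket q β n))‖ ≤
      2 * (‖δ‖ * M * r) := by
    calc _ ≤ ‖δ‖ * (2 * ((n : ℝ) + 1 / 2)) * (M * (((n : ℝ) + 1 / 2) ^ 3)⁻¹) := by
          gcongr
          exact hd _
      _ = _ := by rw [hr]; field_simp
  have h3 : ‖α‖ * dropWeight n * ‖inner ℂ (toL2 φ) (toL2 (wavepacket q β (n - 2)))‖ ≤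
      100 * (‖α‖ * M * r) := by
    calc _ ≤ ‖α‖ * dropWeight n * (M * ((((n - 2 : ℕ) : ℝ) + 1 / 2) ^ 3)⁻¹) := by
          have := dropWeight_nonneg n
          gcongr
          exact hd _
      _ = ‖α‖ * M * (dropWeight n * ((((n - 2 : ℕ) : ℝ) + 1 / 2) ^ 3)⁻¹) := by ring
      _ ≤ ‖α‖ * M * (100 * r) :=
          mul_le_mul_of_nonneg_left (dropWeight_mul_inv_cube_sub_two_le n) (by positivity)
      _ = _ := by ring
  have h4 : 0 ≤ ‖α‖ * M * r := by positivity
  have h5 : 0 ≤ ‖δ‖ * M * r := by positivity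
  nlinarith

theorem inner_mul_inner_metaplectic_hasSum (q : ℂ) (β : ℝ) (φ v : L2R) :
    HasSum (fun n => inner ℂ φ (toL2 (wavepacket q β n)) * inner ℂ (toL2 (wavepacket 0 0 n)) v)
      (inner ℂ φ (metaplectic q β v)) := by
  have h := (waveBasis q β).hasSum_inner_mul_inner φ (metaplectic q β v)
  simpa only [waveBasis_apply, inner_wavepacket_metaplectic, ← toL2_wavepacket_zero_zero] using h

/-- Symmetry of a quadratic operator, transported by the metaplectic operator, between a Schwartz
function and an arbitrary element of `L²`: the boundary terms of the summation by parts vanish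
because the wavepacket coefficients of a Schwartz function decay rapidly. -/
theorem hasSum_metaplectic_weylOp_comm (a b c : ℝ) (q : ℂ) (β : ℝ) (φ : 𝓢(ℝ, ℂ)) (v : L2R) :
    HasSum (fun n =>
      inner ℂ (toL2 φ) (metaplectic q β (toL2 (weylOp a b c (wavepacket 0 0 n)))) *
        inner ℂ (toL2 (wavepacket 0 0 n)) v -
      inner ℂ (toL2 φ) (toL2 (wavepacket q β n)) *
        inner ℂ (toL2 (weylOp a b c (wavepacket 0 0 n))) v) 0 := by
  set α := hopCoeff a b c 0 0 with hα
  set M := ‖toL2 (numOp q β (numOp q β (numOp q β φ)))‖ with hM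
  set x : ℕ → ℂ := fun n => inner ℂ (toL2 φ) (toL2 (wavepacket q β n)) with hx
  set y : ℕ → ℂ := fun n => inner ℂ (toL2 (wavepacket 0 0 n)) v with hy
  have hd : ∀ k : ℕ, ‖x k‖ ≤ M * (((k : ℝ) + 1 / 2) ^ 3)⁻¹ := norm_inner_wavepacket_le q β φ
  have hv : ∀ k, ‖y k‖ ≤ ‖v‖ := fun k => by
    have h := norm_inner_le_norm (𝕜 := ℂ) (toL2 (wavepacket 0 0 k)) v
    rwa [(orthonormal_wavepacket 0 0).1 k, one_mul] at h
  set Z : ℕ → ℂ := fun n => dropWeight n * (α * x n * y (n - 2) -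
    starRingEnd ℂ α * x (n - 2) * y n) with hZ
  have hsum : Summable Z := by
    refine Summable.of_norm_bounded
      (summable_inv_add_half_sq.mul_left (101 * (‖α‖ * M * ‖v‖))) fun n => ?_
    have h1 := dropWeight_mul_inv_cube_le n
    have h2 := dropWeight_mul_inv_cube_sub_two_le n
    have h3 := dropWeight_nonneg n
    rw [hZ]
    simp only [norm_mul, Complex.norm_real, Real.norm_of_nonneg h3]
    calc _ ≤ dropWeight n * (‖α‖ * (M * (((n : ℝ) + 1 / 2) ^ 3)⁻¹) * ‖v‖ +
          ‖α‖ * (M * ((((n - 2 : ℕ) : ℝ) + 1 / 2) ^ 3)⁻¹) * ‖v‖) := by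
          refine mul_le_mul_of_nonneg_left ((norm_sub_le _ _).trans ?_) h3
          simp only [norm_mul, RCLike.norm_conj]
          have := hd n
          have := hd (n - 2)
          have := hv n
          have := hv (n - 2)
          gcongr
      _ = ‖α‖ * M * ‖v‖ * (dropWeight n * (((n : ℝ) + 1 / 2) ^ 3)⁻¹ +
          dropWeight n * ((((n - 2 : ℕ) : ℝ) + 1 / 2) ^ 3)⁻¹) := by ring
      _ ≤ ‖α‖ * M * ‖v‖ * ((((n : ℝ) + 1 / 2) ^ 2)⁻¹ + 100 * (((n : ℝ) + 1 / 2) ^ 2)⁻¹) := by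
          gcongr
      _ = _ := by ring
  have hZ2 := ((hasSum_nat_add_iff' 2).2 hsum.hasSum).sub hsum.hasSum
  have hZ0 : ∑ i ∈ Finset.range 2, Z i = 0 := by
    simp [Finset.sum_range_succ, hZ, dropWeight_zero, dropWeight_one]
  rw [hZ0, sub_zero, sub_self] at hZ2
  convert! hZ2 using 1
  ext n
  rw [metaplectic_weylOp_wavepacket_zero, inner_weylOp_wavepacket_left, inner_add_right,
    inner_add_right, inner_smul_right, inner_smul_right, inner_smul_right, hZ]
  simp only [Nat.add_sub_cancel, dropWeight_add_two]
  ring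

/-- If the wavepackets evolve by `i ∂_t Ψ_n = L(t) Ψ_n - U(t) G h_n`, then `U(t)` turns a
weak solution `v` of `i ∂_t v = G v` into a solution of `i ∂_t u = L(t) u`. For `v` it suffices
to test against Hermite functions. -/
theorem isSolution_metaplectic {a b c β : ℝ → ℝ} {q : ℝ → ℂ} {a₀ b₀ c₀ : ℝ} {v : ℝ → L2R}
    (ha : Continuous a) (hb : Continuous b) (hc : Continuous c) (hq : Continuous q)
    (hβ : Continuous β) (hv : Continuous v)
    (hΨ : ∀ n t, HasDerivAt (fun τ => toL2 (wavepacket (q τ) (β τ) n))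
      (-Complex.I • toL2 (weylOp (a t) (b t) (c t) (wavepacket (q t) (β t) n)) +
        Complex.I • metaplectic (q t) (β t) (toL2 (weylOp a₀ b₀ c₀ (wavepacket 0 0 n)))) t)
    (hvw : ∀ n t, HasDerivAt (fun τ => inner ℂ (toL2 (wavepacket 0 0 n)) (v τ))
      (-Complex.I * inner ℂ (toL2 (weylOp a₀ b₀ c₀ (wavepacket 0 0 n))) (v t)) t) :
    IsSolution (fun t => weylOp (a t) (b t) (c t))
      (fun t => metaplectic (q t) (β t) (v t)) := by
  have hcont : ∀ n, Continuous fun t => toL2 (wavepacket (q t) (β t) n) := fun n =>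
    continuous_iff_continuousAt.2 fun t => (hΨ n t).continuousAt
  refine ⟨(continuous_metaplectic_apply_iff hcont v).2 hv, fun φ t₀ => ?_⟩
  set κ := ‖hopCoeff a₀ b₀ c₀ 0 0‖ + ‖diagCoeff a₀ b₀ c₀ 0 0‖ with hκ
  -- uniform bounds near `t₀` of the quantities that control the coefficients
  obtain ⟨M, hM⟩ : ∃ M, ∀ t ∈ Metric.closedBall t₀ 1,
      ‖toL2 (numOp (q t) (β t) (numOp (q t) (β t) (numOp (q t) (β t) φ)))‖ ≤ M ∧
      ‖toL2 (numOp (q t) (β t) (numOp (q t) (β t) (numOp (q t) (β t)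
        (weylOp (a t) (b t) (c t) φ))))‖ ≤ M ∧ ‖v t‖ ≤ M := by
    have h1 : Continuous fun t =>
        toL2 (numOp (q t) (β t) (numOp (q t) (β t) (numOp (q t) (β t) φ))) :=
      (toL2).continuous.comp (continuous_numOp_apply hq hβ (continuous_numOp_apply hq hβ
        (continuous_numOp_apply hq hβ continuous_const)))
    have h2 : Continuous fun t => toL2 (numOp (q t) (β t) (numOp (q t) (β t) (numOp (q t) (β t)
        (weylOp (a t) (b t) (c t) φ)))) :=
      (toL2).continuous.comp (continuous_numOp_apply hq hβ (continuous_numOp_apply hq hβ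
        (continuous_numOp_apply hq hβ (continuous_weylOp_apply ha hb hc continuous_const))))
    have hK := isCompact_closedBall t₀ (1 : ℝ)
    obtain ⟨M₁, hM₁⟩ := hK.exists_bound_of_continuousOn h1.continuousOn
    obtain ⟨M₂, hM₂⟩ := hK.exists_bound_of_continuousOn h2.continuousOn
    obtain ⟨M₃, hM₃⟩ := hK.exists_bound_of_continuousOn hv.continuousOn
    exact ⟨max M₁ (max M₂ M₃), fun t ht => ⟨(hM₁ t ht).trans (le_max_left _ _),
      (hM₂ t ht).trans ((le_max_left _ _).trans (le_max_right _ _)),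
      (hM₃ t ht).trans ((le_max_right _ _).trans (le_max_right _ _))⟩⟩
  have hM0 : 0 ≤ M := (norm_nonneg _).trans (hM t₀ (Metric.mem_closedBall_self zero_le_one)).1
  set e : ℕ → ℝ → ℂ := fun n t =>
    inner ℂ (toL2 (weylOp (a t) (b t) (c t) φ)) (toL2 (wavepacket (q t) (β t) n)) with he
  set d : ℕ → ℝ → ℂ := fun n t => inner ℂ (toL2 φ) (toL2 (wavepacket (q t) (β t) n)) with hd
  set g : ℕ → ℝ → ℂ := fun n t => inner ℂ (toL2 φ)
    (metaplectic (q t) (β t) (toL2 (weylOp a₀ b₀ c₀ (wavepacket 0 0 n)))) with hg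
  set y : ℕ → ℝ → ℂ := fun n t => inner ℂ (toL2 (wavepacket 0 0 n)) (v t) with hy
  set y' : ℕ → ℝ → ℂ := fun n t => inner ℂ (toL2 (weylOp a₀ b₀ c₀ (wavepacket 0 0 n))) (v t)
    with hy'
  have hder : ∀ n t, HasDerivAt (fun τ => d n τ * y n τ)
      (-Complex.I * (e n t * y n t) + Complex.I * (g n t * y n t - d n t * y' n t)) t := by
    intro n t
    have h1 := (hasDerivAt_const t (toL2 φ)).inner (𝕜 := ℂ) (hΨ n t)
    convert! h1.mul (hvw n t) using 1
    simp only [inner_zero_left, add_zero, inner_add_right, inner_smul_right, ← inner_weylOp_left,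
      he, hd, hg, hy, hy']
    ring
  have hval : ∀ t, (fun n => d n t * y n t) = fun n => inner ℂ (toL2 φ)
      (toL2 (wavepacket (q t) (β t) n)) * inner ℂ (toL2 (wavepacket 0 0 n)) (v t) := fun t => rfl
  have hsum : ∀ t, HasSum (fun n => d n t * y n t)
      (inner ℂ (toL2 φ) (metaplectic (q t) (β t) (v t))) := fun t =>
    inner_mul_inner_metaplectic_hasSum _ _ _ _
  have hsum' : ∀ t, HasSum (fun n =>
      -Complex.I * (e n t * y n t) + Complex.I * (g n t * y n t - d n t * y' n t))
      (-Complex.I * inner ℂ (toL2 (weylOp (a t) (b t) (c t) φ))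
        (metaplectic (q t) (β t) (v t))) := fun t => by
    have h1 := (inner_mul_inner_metaplectic_hasSum (q t) (β t)
      (toL2 (weylOp (a t) (b t) (c t) φ)) (v t)).mul_left (-Complex.I)
    have h2 := (hasSum_metaplectic_weylOp_comm a₀ b₀ c₀ (q t) (β t) φ (v t)).mul_left Complex.I
    rw [mul_zero] at h2
    simpa only [add_zero] using h1.add h2
  have hy_le : ∀ n, ∀ t ∈ Metric.closedBall t₀ 1, ‖y n t‖ ≤ M := fun n t ht => by
    have h := norm_inner_le_norm (𝕜 := ℂ) (toL2 (wavepacket 0 0 n)) (v t)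
    rw [(orthonormal_wavepacket 0 0).1 n, one_mul] at h
    exact h.trans (hM t ht).2.2
  have hy'_le : ∀ n : ℕ, ∀ t ∈ Metric.closedBall t₀ 1, ‖y' n t‖ ≤
      4 * κ * ((n : ℝ) + 1 / 2) * M := fun n t ht => by
    refine (norm_inner_le_norm (𝕜 := ℂ) _ (v t)).trans ?_
    have := norm_toL2_weylOp_wavepacket_le a₀ b₀ c₀ 0 0 n
    have := (hM t ht).2.2
    gcongr
  have hbound : ∀ n : ℕ, ∀ t ∈ Metric.ball t₀ 1,
      ‖-Complex.I * (e n t * y n t) + Complex.I * (g n t * y n t - d n t * y' n t)‖ ≤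
      ((2 + 107 * κ) * M * M) * (((n : ℝ) + 1 / 2) ^ 2)⁻¹ := by
    intro n t ht
    have ht' := Metric.ball_subset_closedBall ht
    obtain ⟨h1, h2, -⟩ := hM t ht'
    have he_le : ‖e n t‖ ≤ M * (2 * (((n : ℝ) + 1 / 2) ^ 2)⁻¹) :=
      (norm_inner_wavepacket_le _ _ _ n).trans (by
        have := inv_cube_le_inv_sq n
        gcongr)
    have hd_le : ‖d n t‖ ≤ M * (((n : ℝ) + 1 / 2) ^ 3)⁻¹ :=
      (norm_inner_wavepacket_le _ _ _ n).trans (by gcongr)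
    have hg_le := norm_inner_metaplectic_weylOp_le (a := a₀) (b := b₀) (c := c₀) h1 n
    have hyn := hy_le n t ht'
    have hyn' := hy'_le n t ht'
    calc _ ≤ ‖e n t‖ * ‖y n t‖ + (‖g n t‖ * ‖y n t‖ + ‖d n t‖ * ‖y' n t‖) := by
          refine (norm_add_le _ _).trans ?_
          simp only [norm_mul, norm_neg, Complex.norm_I, one_mul]
          gcongr
          simpa only [norm_mul] using norm_sub_le (g n t * y n t) (d n t * y' n t)
      _ ≤ (M * (2 * (((n : ℝ) + 1 / 2) ^ 2)⁻¹)) * M +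
          ((103 * κ * M * (((n : ℝ) + 1 / 2) ^ 2)⁻¹) * M +
            (M * (((n : ℝ) + 1 / 2) ^ 3)⁻¹) * (4 * κ * ((n : ℝ) + 1 / 2) * M)) := by
          gcongr
      _ = _ := by field_simp; ring
  have h := hasDerivAt_tsum_of_isPreconnected
    (summable_inv_add_half_sq.mul_left ((2 + 107 * κ) * M * M)) Metric.isOpen_ball
    (convex_ball t₀ 1).isPreconnected (fun n t _ => hder n t) hbound
    (Metric.mem_ball_self one_pos) (hsum t₀).summable (Metric.mem_ball_self one_pos)
  rw [(hsum' t₀).tsum_eq] at h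
  simp only [(hsum _).tsum_eq] at h
  exact h

theorem metaplectic_zero_zero (v : L2R) : metaplectic 0 0 v = v := by
  rw [← sub_eq_zero]
  refine eq_zero_of_inner_wavepacket (q := 0) (β := 0) fun n => ?_
  rw [inner_sub_right, inner_wavepacket_metaplectic, toL2_wavepacket_zero_zero, sub_self]

/-- The conjugation of the two equations by the metaplectic operators. -/
theorem isSolution_metaplectic_iff {a b c β : ℝ → ℝ} {q : ℝ → ℂ} {a₀ b₀ c₀ : ℝ}
    (ha : Continuous a) (hb : Continuous b) (hc : Continuous c) (hq : Continuous q)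
    (hβ : Continuous β)
    (hΨ : ∀ n t, HasDerivAt (fun τ => toL2 (wavepacket (q τ) (β τ) n))
      (-Complex.I • toL2 (weylOp (a t) (b t) (c t) (wavepacket (q t) (β t) n)) +
        Complex.I • metaplectic (q t) (β t) (toL2 (weylOp a₀ b₀ c₀ (wavepacket 0 0 n)))) t)
    (v : ℝ → L2R) :
    IsSolution (fun t => weylOp (a t) (b t) (c t))
      (fun t => metaplectic (q t) (β t) (v t)) ↔ IsSolution (fun _ => weylOp a₀ b₀ c₀) v := by
  have hcont : ∀ n, Continuous fun t => toL2 (wavepacket (q t) (β t) n) := fun n =>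
    continuous_iff_continuousAt.2 fun t => (hΨ n t).continuousAt
  constructor
  · intro h
    have hv : Continuous v := (continuous_metaplectic_apply_iff hcont v).1 h.1
    have hvw : ∀ n t, HasDerivAt (fun τ => inner ℂ (toL2 (wavepacket 0 0 n)) (v τ))
        (-Complex.I * inner ℂ (toL2 (weylOp a₀ b₀ c₀ (wavepacket 0 0 n))) (v t)) t := by
      intro n t
      have h1 := hasDerivAt_inner_of_weak (hΨ n t) (h.1.continuousAt (x := t))
        (h.2 (wavepacket (q t) (β t) n) t)
      simp only [inner_wavepacket_metaplectic, ← toL2_wavepacket_zero_zero] at h1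
      convert! h1 using 1
      rw [inner_add_left, inner_smul_left, inner_smul_left, LinearIsometryEquiv.inner_map_map]
      simp only [map_neg, Complex.conj_I, toL2_apply]
      ring
    -- from Hermite to Schwartz test functions: the conjugation by the identity
    have h2 := isSolution_metaplectic (a := fun _ => a₀) (b := fun _ => b₀) (c := fun _ => c₀)
      (q := fun _ => 0) (β := fun _ => 0) (a₀ := a₀) (b₀ := b₀) (c₀ := c₀) continuous_const
      continuous_const continuous_const continuous_const continuous_const hv (fun n t => by
        rw [metaplectic_zero_zero, ← add_smul, neg_add_cancel, zero_smul]
        exact hasDerivAt_const _ _) hvw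
    simpa only [metaplectic_zero_zero] using h2
  · intro h
    exact isSolution_metaplectic ha hb hc hq hβ h.1 hΨ fun n t => h.2 _ t

/-! ### Symplectic covariance -/

/-- The coordinate `β` of a matrix in `SL(2,ℝ)`: the real part of
`(Y₁₀ + i Y₁₁) / (Y₀₀ + i Y₀₁)`. -/
def slopeRe (Y : Matrix (Fin 2) (Fin 2) ℝ) : ℝ :=
  (Y 0 0 * Y 1 0 + Y 0 1 * Y 1 1) / (Y 0 0 ^ 2 + Y 0 1 ^ 2)

theorem sq_add_sq_pos_of_det_eq_one {Y : Matrix (Fin 2) (Fin 2) ℝ} (hY : Y.det = 1) :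
    0 < Y 0 0 ^ 2 + Y 0 1 ^ 2 := by
  rw [Matrix.det_fin_two] at hY
  refine lt_of_le_of_ne (by positivity) fun h => ?_
  have h0 : Y 0 0 = 0 := by nlinarith [sq_nonneg (Y 0 0), sq_nonneg (Y 0 1)]
  have h1 : Y 0 1 = 0 := by nlinarith [sq_nonneg (Y 0 0), sq_nonneg (Y 0 1)]
  rw [h0, h1] at hY
  simp at hY

theorem topRow_ne_zero {Y : Matrix (Fin 2) (Fin 2) ℝ} (hY : Y.det = 1) :
    (Y 0 0 : ℂ) + Complex.I * (Y 0 1 : ℂ) ≠ 0 := by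
  intro h
  have h0 := congrArg Complex.re h
  have h1 := congrArg Complex.im h
  simp at h0 h1
  have := sq_add_sq_pos_of_det_eq_one hY
  simp [h0, h1] at this

theorem exp_neg_two_re {Y : Matrix (Fin 2) (Fin 2) ℝ} {q : ℂ}
    (hq : Complex.exp q = Y 0 0 + Complex.I * Y 0 1) :
    Real.exp (-2 * q.re) = (Y 0 0 ^ 2 + Y 0 1 ^ 2)⁻¹ := by
  have h := conj_exp_mul_exp q
  rw [hq] at h
  simp only [map_add, map_mul, Complex.conj_ofReal, Complex.conj_I] at h
  have h2 : ((Y 0 0 ^ 2 + Y 0 1 ^ 2 : ℝ) : ℂ) = (Real.exp (2 * q.re) : ℝ) := by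
    rw [← h]; push_cast; linear_combination (Y 0 1 : ℂ) ^ 2 * Complex.I_mul_I
  rw [Complex.ofReal_inj.1 h2, ← Real.exp_neg]
  congr 1; ring

theorem momParam_slopeRe {Y : Matrix (Fin 2) (Fin 2) ℝ} (hY : Y.det = 1) {q : ℂ}
    (hq : Complex.exp q = Y 0 0 + Complex.I * Y 0 1) :
    momParam q (slopeRe Y) = Y 1 0 + Complex.I * Y 1 1 := by
  have hr : ((Y 0 0 : ℂ) ^ 2 + (Y 0 1 : ℂ) ^ 2) ≠ 0 := by
    exact_mod_cast (sq_add_sq_pos_of_det_eq_one hY).ne'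
  have hd : (Y 0 0 : ℂ) * Y 1 1 - (Y 0 1 : ℂ) * Y 1 0 = 1 := by
    rw [Matrix.det_fin_two] at hY; exact_mod_cast hY
  rw [momParam, momSlope, exp_neg_two_re hq, hq, slopeRe]
  push_cast
  field_simp
  linear_combination ((Y 0 1 : ℂ) - Complex.I * Y 0 0) * hd + (Y 0 1 : ℂ) * Complex.I_mul_I

/-- Covariance of the ladder coefficients: conjugate matrices in `sl(2,ℝ)` have the same ladder
coefficients in the correspondingly transformed coordinates. -/
theorem hopCoeff_diagCoeff_of_conj {a b c a' b' c' : ℝ} {Y : Matrix (Fin 2) (Fin 2) ℝ}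
    (hY : Y.det = 1) (h : hamMatrix a' b' c' * Y = Y * hamMatrix a b c) {q : ℂ}
    (hq : Complex.exp q = Y 0 0 + Complex.I * Y 0 1) :
    hopCoeff a' b' c' q (slopeRe Y) = hopCoeff a b c 0 0 ∧
      diagCoeff a' b' c' q (slopeRe Y) = diagCoeff a b c 0 0 := by
  have hP := momParam_slopeRe hY hq
  have hd : (Y 0 0 : ℂ) * Y 1 1 - (Y 0 1 : ℂ) * Y 1 0 = 1 := by
    rw [Matrix.det_fin_two] at hY; exact_mod_cast hY
  have h' := fun i j => congrArg (fun x : ℝ => (x : ℂ)) (congrFun (congrFun h i) j)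
  have e00 := h' 0 0
  have e01 := h' 0 1
  have e10 := h' 1 0
  have e11 := h' 1 1
  simp [hamMatrix, Matrix.mul_apply, Fin.sum_univ_two] at e00 e01 e10 e11
  have hm : momParam 0 0 = Complex.I := by simp [momParam, momSlope]
  constructor
  · rw [hopCoeff, hopCoeff, hP, hq, hm, Complex.exp_zero]
    linear_combination (1 / 4 : ℂ) * (Y 1 0 + Complex.I * Y 1 1) * (e00 + Complex.I * e01) -
      (1 / 4 : ℂ) * (Y 0 0 + Complex.I * Y 0 1) * (e10 + Complex.I * e11) +
      (a + 2 * b * Complex.I + c * Complex.I ^ 2) / 4 * hd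
  · rw [diagCoeff, diagCoeff, hP, hq, hm, Complex.exp_zero]
    simp only [map_add, map_mul, Complex.conj_ofReal, Complex.conj_I, map_one]
    linear_combination (1 / 4 : ℂ) * (Y 1 0 - Complex.I * Y 1 1) * (e00 + Complex.I * e01) -
      (1 / 4 : ℂ) * (Y 0 0 - Complex.I * Y 0 1) * (e10 + Complex.I * e11) +
      (a - c * Complex.I ^ 2) / 4 * hd

theorem exists_exp_eq_topRow {Y : Matrix (Fin 2) (Fin 2) ℝ} (hY : Y.det = 1) :
    ∃ q : ℂ, Complex.exp q = Y 0 0 + Complex.I * Y 0 1 :=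
  ⟨_, Complex.exp_log (topRow_ne_zero hY)⟩

theorem unitarilyEquivalent_of_conj {a b c a' b' c' : ℝ} {Y : Matrix (Fin 2) (Fin 2) ℝ}
    (hY : Y.det = 1) (h : hamMatrix a' b' c' * Y = Y * hamMatrix a b c) :
    UnitarilyEquivalent (l2Op (weylOp a b c)) (l2Op (weylOp a' b' c')) := by
  obtain ⟨q, hq⟩ := exists_exp_eq_topRow hY
  obtain ⟨h1, h2⟩ := hopCoeff_diagCoeff_of_conj hY h hq
  exact unitarilyEquivalent_weylOp h1 h2

/-! ### Normal forms -/

theorem weylOp_diag (μ : ℝ) : weylOp μ 0 μ = ((μ / 2 : ℝ) : ℂ) • harmonicOp := by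
  ext1 f
  have h : momOp (momOp f) = -(derivCLM ℂ ℂ (derivCLM ℂ ℂ f)) := by
    simp only [momOp, _root_.smul_apply, map_smul, smul_smul]
    simp
  have h2 : harmonicOp f = -(derivCLM ℂ ℂ (derivCLM ℂ ℂ f)) + posOp (posOp f) := rfl
  rw [weylOp_apply, _root_.smul_apply, h2, h]
  push_cast
  module

theorem weylOp_offDiag (ν : ℝ) : weylOp 0 ν 0 = ((ν / 2 : ℝ) : ℂ) • dilationOp := by
  ext1 f
  have h : posOp (momOp f) + momOp (posOp f) = dilationOp f := by
    simp only [momOp, dilationOp, _root_.smul_apply, map_smul,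
      _root_.add_apply, ContinuousLinearMap.comp_apply, smul_add]
  rw [weylOp_apply, _root_.smul_apply, ← h]
  push_cast
  module

theorem weylOp_pos (κ : ℝ) : weylOp (-κ) 0 0 = ((-(κ / 2) : ℝ) : ℂ) • squareOp := by
  ext1 f
  have h : squareOp f = posOp (posOp f) := rfl
  rw [weylOp_apply, _root_.smul_apply, h]
  push_cast
  module

theorem eq_hamMatrix {B : Matrix (Fin 2) (Fin 2) ℝ} (hB : B.trace = 0) :
    B = hamMatrix (-(B 1 0)) (B 0 0) (B 0 1) := by
  rw [Matrix.trace_fin_two] at hB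
  ext i j
  fin_cases i <;> fin_cases j <;> simp [hamMatrix]
  linarith

theorem det_hamMatrix (a b c : ℝ) : (hamMatrix a b c).det = a * c - b ^ 2 := by
  rw [hamMatrix, Matrix.det_fin_two_of]; ring

/-- The elliptic normal form; `Y` is the lower triangular matrix with top left entry `√(μ/c)`. -/
theorem unitarilyEquivalent_elliptic {a b c : ℝ} (h : 0 < a * c - b ^ 2) :
    UnitarilyEquivalent (l2Op (weylOp a b c))
      (l2Op (weylOp (Real.sign c * Real.sqrt (a * c - b ^ 2)) 0
        (Real.sign c * Real.sqrt (a * c - b ^ 2)))) := by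
  have hs := Real.sqrt_pos.2 h
  have hs2 := Real.sq_sqrt h.le
  set s := Real.sqrt (a * c - b ^ 2)
  have hc : c ≠ 0 := by
    rintro rfl
    nlinarith [sq_nonneg b]
  set μ := Real.sign c * s with hμ
  have hμ2 : μ ^ 2 = a * c - b ^ 2 := by
    rcases hc.lt_or_gt with h' | h'
    · rw [hμ, Real.sign_of_neg h', ← hs2]; ring
    · rw [hμ, Real.sign_of_pos h', ← hs2]; ring
  have hμc : 0 < μ / c := by
    rcases hc.lt_or_gt with h' | h'
    · exact div_pos_of_neg_of_neg (by rw [hμ, Real.sign_of_neg h']; linarith) h'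
    · exact div_pos (by rw [hμ, Real.sign_of_pos h']; linarith) h'
  have hμ0 : μ ≠ 0 := fun h0 => by simp [h0] at hμc
  have hp := Real.sqrt_pos.2 hμc
  have hp2 := Real.sq_sqrt hμc.le
  set p := Real.sqrt (μ / c)
  have hpc : p ^ 2 * c = μ := by rw [hp2]; field_simp
  refine unitarilyEquivalent_of_conj (Y := !![p, 0; p * b / μ, p⁻¹]) ?_ ?_
  · rw [Matrix.det_fin_two_of]; field_simp; ring
  · ext i j
    fin_cases i <;> fin_cases j <;> simp [hamMatrix, Matrix.mul_apply, Fin.sum_univ_two]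
    · field_simp
    · field_simp; linarith
    · field_simp; linear_combination (-a) * hpc - p ^ 2 * hμ2
    · field_simp; linear_combination (-b) * hpc

/-- The hyperbolic normal form; the rows of `Y` are left eigenvectors `u (B + ν)` and
`u (B - ν)` of `B`, for a row `u` on which the quadratic form `det (u B, u)` does not vanish. -/
theorem unitarilyEquivalent_hyperbolic {a b c : ℝ} (h : a * c - b ^ 2 < 0) :
    UnitarilyEquivalent (l2Op (weylOp a b c))
      (l2Op (weylOp 0 (Real.sqrt (-(a * c - b ^ 2))) 0)) := by
  have hs := Real.sqrt_pos.2 (neg_pos.2 h)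
  have hs2 := Real.sq_sqrt (neg_pos.2 h).le
  set ν := Real.sqrt (-(a * c - b ^ 2))
  obtain ⟨u, w, huw⟩ : ∃ u w : ℝ, 2 * b * u * w - a * w ^ 2 - c * u ^ 2 ≠ 0 := by
    by_cases ha : a = 0
    · by_cases hc : c = 0
      · refine ⟨1, 1, ?_⟩
        subst ha hc
        have hb : b ≠ 0 := by rintro rfl; simp at h
        simpa using hb
      · exact ⟨1, 0, by simpa using hc⟩
    · exact ⟨0, 1, by simpa using ha⟩
  set D := -2 * ν * (2 * b * u * w - a * w ^ 2 - c * u ^ 2) with hD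
  have hD0 : D ≠ 0 := mul_ne_zero (mul_ne_zero (by norm_num) hs.ne') huw
  refine unitarilyEquivalent_of_conj (Y := !![(u * b - w * a + ν * u) / D,
    (u * c - w * b + ν * w) / D; u * b - w * a - ν * u, u * c - w * b - ν * w]) ?_ ?_
  · rw [Matrix.det_fin_two_of]; field_simp; rw [hD]; ring
  · ext i j
    fin_cases i <;> fin_cases j <;> simp [hamMatrix, Matrix.mul_apply, Fin.sum_univ_two]
    · field_simp; linear_combination u * hs2
    · field_simp; linear_combination w * hs2
    · linear_combination u * hs2
    · linear_combination w * hs2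

/-! ### Wavepackets along a linear system -/

/-- A solution of the linear system `Y' = N Y` in `SL(2,ℝ)`, read in the coordinates `(q, β)`. -/
theorem isHamiltonianAt_of_hasDerivAt {a b c : ℝ} {Y : ℝ → Matrix (Fin 2) (Fin 2) ℝ} {q : ℝ → ℂ}
    {t : ℝ} (hdet : ∀ τ, (Y τ).det = 1)
    (hq : ∀ τ, Complex.exp (q τ) = Y τ 0 0 + Complex.I * Y τ 0 1)
    (hqd : DifferentiableAt ℝ q t)
    (hY : ∀ i j, HasDerivAt (fun τ => Y τ i j) ((hamMatrix a b c * Y t) i j) t) :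
    IsHamiltonianAt a b c q (fun τ => slopeRe (Y τ)) t := by
  have hP : ∀ τ, Complex.exp (q τ) * momSlope (q τ) (slopeRe (Y τ)) =
      Y τ 1 0 + Complex.I * Y τ 1 1 := fun τ => momParam_slopeRe (hdet τ) (hq τ)
  have hw : ∀ τ, momSlope (q τ) (slopeRe (Y τ)) =
      (Y τ 1 0 + Complex.I * Y τ 1 1) / (Y τ 0 0 + Complex.I * Y τ 0 1) := fun τ => by
    rw [← hP, ← hq, mul_div_cancel_left₀ _ (Complex.exp_ne_zero _)]
  have hQ' := (hY 0 0).ofReal_comp.add ((hY 0 1).ofReal_comp.const_mul Complex.I)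
  have hP' := (hY 1 0).ofReal_comp.add ((hY 1 1).ofReal_comp.const_mul Complex.I)
  simp only [hamMatrix, Matrix.mul_apply, Fin.sum_univ_two] at hQ' hP'
  simp at hQ' hP'
  change HasDerivAt (fun τ => (Y τ 0 0 : ℂ) + Complex.I * Y τ 0 1) _ t at hQ'
  change HasDerivAt (fun τ => (Y τ 1 0 : ℂ) + Complex.I * Y τ 1 1) _ t at hP'
  have hne := topRow_ne_zero (hdet t)
  have hwt := hw t
  set w := momSlope (q t) (slopeRe (Y t)) with hwdef
  have hPt : (Y t 1 0 + Complex.I * Y t 1 1 : ℂ) = (Y t 0 0 + Complex.I * Y t 0 1) * w := by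
    rw [hwt, mul_div_cancel₀ _ hne]
  constructor
  · have h1 := hqd.hasDerivAt.cexp
    have h2 : HasDerivAt (fun τ => Complex.exp (q τ)) _ t :=
      hQ'.congr_of_eventuallyEq (Filter.Eventually.of_forall hq)
    have h3 := h1.unique h2
    convert! hqd.hasDerivAt using 1
    refine mul_left_cancel₀ hne ?_
    rw [← hq t, h3, hq t]
    linear_combination -c * hPt
  · have h1 : HasDerivAt (fun τ => momSlope (q τ) (slopeRe (Y τ)))
        (-(a + 2 * b * w + c * w ^ 2)) t := by
      have h2 := (hP'.div hQ' hne).congr_of_eventuallyEq (Filter.Eventually.of_forall hw)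
      convert! h2 using 1
      rw [eq_div_iff (pow_ne_zero 2 hne)]
      linear_combination (2 * b * (Y t 0 0 + Complex.I * Y t 0 1) + c * ((Y t 1 0 +
        Complex.I * Y t 1 1) + (Y t 0 0 + Complex.I * Y t 0 1) * w)) * hPt
    have h2 := Complex.reCLM.hasFDerivAt.comp_hasDerivAt t h1
    convert! h2 using 1
    · ext τ; exact (momSlope_re _ _).symm
    · have hre : w.re = slopeRe (Y t) := momSlope_re _ _
      have him : w.im = Real.exp (-2 * (q t).re) := momSlope_im _ _
      rw [Complex.reCLM_apply]
      beta_reduce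
      rw [← hre, ← him]
      simp [pow_two]
      ring

theorem weylOp_sub (a b c a' b' c' : ℝ) (f : 𝓢(ℝ, ℂ)) :
    weylOp (a - a') (b - b') (c - c') f = weylOp a b c f - weylOp a' b' c' f := by
  simp only [weylOp_apply]
  push_cast
  module

/-- Along `Y' = A Y - Y B` the wavepackets with parameters given by `Y` solve the equation
quantizing `A`, up to the transported action of the quantization of `B`. -/
theorem hasDerivAt_wavepacket_of_conj {a b c : ℝ} {B : Matrix (Fin 2) (Fin 2) ℝ}
    (hB : B.trace = 0) {Y : ℝ → Matrix (Fin 2) (Fin 2) ℝ} {q : ℝ → ℂ} {t : ℝ}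
    (hdet : ∀ τ, (Y τ).det = 1)
    (hq : ∀ τ, Complex.exp (q τ) = Y τ 0 0 + Complex.I * Y τ 0 1)
    (hqd : DifferentiableAt ℝ q t)
    (hY : ∀ i j, HasDerivAt (fun τ => Y τ i j) ((hamMatrix a b c * Y t - Y t * B) i j) t) (n : ℕ) :
    HasDerivAt (fun τ => toL2 (wavepacket (q τ) (slopeRe (Y τ)) n))
      (-Complex.I • toL2 (weylOp a b c (wavepacket (q t) (slopeRe (Y t)) n)) +
        Complex.I • metaplectic (q t) (slopeRe (Y t))
          (toL2 (weylOp (-(B 1 0)) (B 0 0) (B 0 1) (wavepacket 0 0 n)))) t := by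
  -- `Y B Y⁻¹`
  set C := Y t * B * (Y t).adjugate with hC
  have hCY : C * Y t = Y t * B := by
    rw [hC, Matrix.mul_assoc, Matrix.adjugate_mul, hdet, one_smul, Matrix.mul_one]
  have hCtr : C.trace = 0 := by
    rw [hC, Matrix.mul_assoc, Matrix.trace_mul_comm, Matrix.mul_assoc, Matrix.adjugate_mul, hdet,
      one_smul, Matrix.mul_one, hB]
  have hCham := eq_hamMatrix hCtr
  have hBham := eq_hamMatrix hB
  have hconj : hamMatrix (-(C 1 0)) (C 0 0) (C 0 1) * Y t =
      Y t * hamMatrix (-(B 1 0)) (B 0 0) (B 0 1) := by rw [← hCham, ← hBham, hCY]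
  obtain ⟨h1, h2⟩ := hopCoeff_diagCoeff_of_conj (hdet t) hconj (hq t)
  have hN : hamMatrix (a - -(C 1 0)) (b - C 0 0) (c - C 0 1) * Y t =
      hamMatrix a b c * Y t - Y t * B := by
    rw [← hCY, hCham, ← Matrix.sub_mul]
    congr 1
    ext i j
    fin_cases i <;> fin_cases j <;> simp [hamMatrix] <;> ring
  have hH := (isHamiltonianAt_of_hasDerivAt hdet hq hqd
    (fun i j => by rw [hN]; exact hY i j)).hasDerivAt_wavepacket n
  convert! hH using 1
  rw [metaplectic_weylOp h1 h2, weylOp_sub, map_sub, smul_sub, neg_smul Complex.I (toL2 (weylOp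
    (-(C 1 0)) _ _ _)), sub_neg_eq_add]

/-! ### Products of exponentials of traceless matrices -/

theorem adjugate_eq_neg_of_trace_eq_zero {A : Matrix (Fin 2) (Fin 2) ℝ} (hA : A.trace = 0) :
    A.adjugate = -A := by
  rw [Matrix.trace_fin_two] at hA
  rw [Matrix.adjugate_fin_two]
  ext i j
  fin_cases i <;> fin_cases j <;> simp <;> linarith

theorem adjugate_eq_conj_transpose (A : Matrix (Fin 2) (Fin 2) ℝ) :
    A.adjugate = !![0, 1; -1, 0] * A.transpose * (!![0, 1; -1, 0])⁻¹ := by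
  have h : (!![0, 1; -1, 0] : Matrix (Fin 2) (Fin 2) ℝ)⁻¹ = !![0, -1; 1, 0] := by
    rw [Matrix.inv_def, Matrix.det_fin_two_of, Matrix.adjugate_fin_two_of]
    simp
  rw [h, Matrix.adjugate_fin_two]
  ext i j
  fin_cases i <;> fin_cases j <;>
    simp [Matrix.mul_apply, Fin.sum_univ_two, Matrix.vecMul, dotProduct]

/-- For traceless `A` of size two, `-A = adj A = J Aᵀ J⁻¹`; so `exp (-A) = adj (exp A)`. -/
theorem det_exp_of_trace_eq_zero {A : Matrix (Fin 2) (Fin 2) ℝ} (hA : A.trace = 0) :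
    (NormedSpace.exp A).det = 1 := by
  have hJ : IsUnit (!![0, 1; -1, 0] : Matrix (Fin 2) (Fin 2) ℝ) := by
    rw [Matrix.isUnit_iff_isUnit_det, Matrix.det_fin_two_of]; simp
  have h1 : (NormedSpace.exp A).adjugate = NormedSpace.exp (-A) := by
    rw [← adjugate_eq_neg_of_trace_eq_zero hA, adjugate_eq_conj_transpose A,
      Matrix.exp_conj _ _ hJ, Matrix.exp_transpose, adjugate_eq_conj_transpose]
  have h2 := Matrix.mul_adjugate (NormedSpace.exp A)
  have hu : IsUnit (NormedSpace.exp A).det :=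
    (Matrix.isUnit_iff_isUnit_det _).1 (Matrix.isUnit_exp A)
  rw [h1, Matrix.exp_neg, Matrix.mul_nonsing_inv _ hu] at h2
  have h3 := congrFun (congrFun h2 0) 0
  simpa using h3.symm

theorem det_prodExp {d K : ℕ} {Z : Fin (K + 1) → (Fin d → ℝ) → Matrix (Fin 2) (Fin 2) ℝ}
    {θ : Fin d → ℝ} (hZ : ∀ j, (Z j θ).trace = 0) : (prodExp Z θ).det = 1 := by
  rw [prodExp, ← Matrix.coe_detMonoidHom, map_list_prod]
  refine List.prod_eq_one fun x hx => ?_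
  obtain ⟨y, hy, rfl⟩ := List.mem_map.1 hx
  obtain ⟨j, rfl⟩ := (List.mem_ofFn' _ _).1 hy
  exact det_exp_of_trace_eq_zero (hZ j)

section Analytic

open scoped Matrix.Norms.Operator

variable {E : Type*} [NormedAddCommGroup E] [NormedSpace ℝ E]

theorem analyticAt_matrix_iff {M : E → Matrix (Fin 2) (Fin 2) ℝ} {x : E} :
    AnalyticAt ℝ M x ↔ ∀ i j, AnalyticAt ℝ (fun y => M y i j) x := by
  constructor
  · intro h i j
    exact ((Matrix.entryLinearMap ℝ ℝ i j).toContinuousLinearMap.analyticAt _).comp h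
  · intro h
    have : M = fun y => ∑ i, ∑ j, M y i j • Matrix.single i j (1 : ℝ) := by
      ext1 y
      conv_lhs => rw [Matrix.matrix_eq_sum_single (M y)]
      simp
    rw [this]
    refine Finset.analyticAt_fun_sum _ fun i _ => Finset.analyticAt_fun_sum _ fun j _ => ?_
    exact (h i j).smul analyticAt_const

theorem AnalyticAt.list_prod_ofFn {𝔸 : Type*} [NormedRing 𝔸] [NormedAlgebra ℝ 𝔸] {n : ℕ}
    {f : Fin n → E → 𝔸} {x : E} (h : ∀ j, AnalyticAt ℝ (f j) x) :
    AnalyticAt ℝ (fun y => (List.ofFn fun j => f j y).prod) x := by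
  induction n with
  | zero => simpa using analyticAt_const
  | succ n ih =>
    simp only [List.ofFn_succ, List.prod_cons]
    exact (h 0).mul (ih fun j => h j.succ)

theorem analyticAt_prodExp {d K : ℕ} {Z : Fin (K + 1) → (Fin d → ℝ) → Matrix (Fin 2) (Fin 2) ℝ}
    {θ : Fin d → ℝ} (hZ : ∀ k i j, AnalyticAt ℝ (fun θ => Z k θ i j) θ) (i j : Fin 2) :
    AnalyticAt ℝ (fun θ => prodExp Z θ i j) θ := by
  refine (analyticAt_matrix_iff (M := prodExp Z)).1 ?_ i j
  refine AnalyticAt.list_prod_ofFn fun k => ?_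
  exact (NormedSpace.exp_analytic (𝕂 := ℝ) (Z k θ)).comp (analyticAt_matrix_iff.2 (hZ k))

theorem continuous_list_prod_ofFn {X 𝔸 : Type*} [TopologicalSpace X] [TopologicalSpace 𝔸]
    [Monoid 𝔸] [ContinuousMul 𝔸] {n : ℕ} {f : Fin n → X → 𝔸} (h : ∀ j, Continuous (f j)) :
    Continuous fun y => (List.ofFn fun j => f j y).prod := by
  induction n with
  | zero => simpa using continuous_const
  | succ n ih =>
    simp only [List.ofFn_succ, List.prod_cons]
    exact (h 0).mul (ih fun j => h j.succ)

theorem continuous_prodExp_smul {d K : ℕ}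
    {Z : Fin (K + 1) → (Fin d → ℝ) → Matrix (Fin 2) (Fin 2) ℝ} (hZ : ∀ k, Continuous (Z k)) :
    Continuous fun p : ℝ × (Fin d → ℝ) => prodExp (fun k θ => p.1 • Z k θ) p.2 := by
  refine continuous_list_prod_ofFn fun k => ?_
  refine NormedSpace.exp_continuous.comp ?_
  exact continuous_fst.smul ((hZ k).comp continuous_snd)

end Analytic

/-! ### A logarithm of the first row -/

/-- A homotopy of nonvanishing functions that starts at the constant `1` has a logarithm at its end.
Its value at a point depends only on the path that the homotopy describes at this point. -/
theorem exists_continuous_log {A : Type*} [TopologicalSpace A] {F : unitInterval × A → ℂ}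
    (hF : Continuous F) (hF0 : ∀ p, F p ≠ 0) (hF1 : ∀ a, F (0, a) = 1) :
    ∃ q : A → ℂ, Continuous q ∧ (∀ a, Complex.exp (q a) = F (1, a)) ∧
      ∀ a a', (∀ t, F (t, a) = F (t, a')) → q a = q a' := by
  set H : C(unitInterval × A, {z : ℂ // z ≠ 0}) := ⟨fun p => ⟨F p, hF0 p⟩, by fun_prop⟩ with hH
  have hH0 : ∀ a, H (0, a) = (⟨_, Complex.exp_ne_zero ((0 : C(A, ℂ)) a)⟩ : {z : ℂ // z ≠ 0}) :=
    fun a => Subtype.ext (by simp [hH, hF1])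
  set G := Complex.isCoveringMap_exp.liftHomotopy H 0 hH0 with hG
  have hlift : ∀ p, Complex.exp (G p) = F p := fun p =>
    congrArg Subtype.val (congrFun (Complex.isCoveringMap_exp.liftHomotopy_lifts H 0 hH0) p)
  have hzero : ∀ a, G (0, a) = 0 := fun a =>
    Complex.isCoveringMap_exp.liftHomotopy_zero H 0 hH0 a
  refine ⟨fun a => G (1, a), G.continuous.comp (by fun_prop), fun a => hlift _, fun a a' h => ?_⟩
  have h1 := Complex.isCoveringMap_exp.eq_of_comp_eq (g₁ := fun t => G (t, a))
    (g₂ := fun t => G (t, a')) (G.continuous.comp (by fun_prop)) (G.continuous.comp (by fun_prop))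
    (funext fun t => Subtype.ext (by simp only [Function.comp, hlift, h])) 0 (by simp [hzero])
  exact congrFun h1 1

/-- A continuous logarithm of an analytic function is analytic. -/
theorem analyticAt_of_exp {E : Type*} [NormedAddCommGroup E] [NormedSpace ℝ E] {q : E → ℂ} {x : E}
    (hq : ContinuousAt q x) (h : AnalyticAt ℝ (fun y => Complex.exp (q y)) x) :
    AnalyticAt ℝ q x := by
  have h1 : AnalyticAt ℝ (fun y => Complex.exp (q y) * Complex.exp (-q x)) x :=
    h.mul analyticAt_const
  have h2 : AnalyticAt ℝ Complex.log (Complex.exp (q x) * Complex.exp (-q x)) := by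
    refine (analyticAt_clog ?_).restrictScalars
    rw [← Complex.exp_add, add_neg_cancel, Complex.exp_zero]
    exact Complex.one_mem_slitPlane
  have h3 : AnalyticAt ℝ (fun y => Complex.log (Complex.exp (q y) * Complex.exp (-q x)) + q x) x :=
    (h2.comp_of_eq h1 rfl).add analyticAt_const
  refine h3.congr ?_
  have h4 : Filter.Tendsto (fun y => (q y - q x).im) (nhds x) (nhds 0) := by
    have h5 : ContinuousAt (fun y => (q y - q x).im) x :=
      Complex.continuous_im.continuousAt.comp (hq.sub continuousAt_const)
    simpa [ContinuousAt] using h5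
  filter_upwards [h4.eventually (lt_mem_nhds (neg_lt_zero.2 Real.pi_pos)),
    h4.eventually (gt_mem_nhds Real.pi_pos)] with y hy1 hy2
  rw [← Complex.exp_add, ← sub_eq_add_neg, Complex.log_exp hy1 hy2.le, sub_add_cancel]

theorem exists_norm_le_of_periodic {d : ℕ} {F : Type*} [NormedAddCommGroup F]
    {f : (Fin d → ℝ) → F} (hf : Continuous f)
    (hp : ∀ (θ : Fin d → ℝ) (k : Fin d → ℤ), f (fun i => θ i + 2 * (k i : ℝ)) = f θ) :
    ∃ R, ∀ θ, ‖f θ‖ ≤ R := by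
  obtain ⟨R, hR⟩ := (isCompact_univ_pi fun _ : Fin d => isCompact_Icc (a := (0 : ℝ)) (b := 2))
    |>.exists_bound_of_continuousOn hf.continuousOn
  refine ⟨R, fun θ => ?_⟩
  rw [← hp θ fun i => -⌊θ i / 2⌋]
  refine hR _ fun i _ => ?_
  have h1 := Int.floor_le (θ i / 2)
  have h2 := Int.lt_floor_add_one (θ i / 2)
  push_cast
  constructor <;> linarith

theorem IsAnalyticOnTorus.continuous {d p : ℕ} {f : (Fin d → ℝ) → ℝ}
    (h : IsAnalyticOnTorus p f) : Continuous f :=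
  continuous_iff_continuousAt.2 fun θ => (h.1 θ trivial).continuousAt

theorem IsAnalyticSl2OnTorus.continuous {d p : ℕ}
    {Z : (Fin d → ℝ) → Matrix (Fin 2) (Fin 2) ℝ} (h : IsAnalyticSl2OnTorus p Z) : Continuous Z :=
  continuous_matrix fun i j => (h.1 i j).continuous

/-- The matrices `e^{Z_0} ⋯ e^{Z_K}` are connected to the identity by the periodic homotopy
`e^{s Z_0} ⋯ e^{s Z_K}`, so the logarithm of `Y₀₀ + i Y₀₁` has no winding: it is as periodic as
the `Z_j`. -/
theorem exists_log_topRow {d K : ℕ} {Z : Fin (K + 1) → (Fin d → ℝ) → Matrix (Fin 2) (Fin 2) ℝ}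
    (hZ : ∀ j, IsAnalyticSl2OnTorus 2 (Z j)) :
    ∃ q : (Fin d → ℝ) → ℂ, (∀ θ, AnalyticAt ℝ q θ) ∧
      (∀ θ, Complex.exp (q θ) = prodExp Z θ 0 0 + Complex.I * prodExp Z θ 0 1) ∧
      ∀ (θ : Fin d → ℝ) (k : Fin d → ℤ), q (fun i => θ i + 2 * (k i : ℝ)) = q θ := by
  set Ys : unitInterval × (Fin d → ℝ) → Matrix (Fin 2) (Fin 2) ℝ :=
    fun p => prodExp (fun k θ => (p.1 : ℝ) • Z k θ) p.2 with hYs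
  have hdet : ∀ p, (Ys p).det = 1 := fun p => det_prodExp fun j => by
    rw [Matrix.trace_smul, (hZ j).2, smul_zero]
  have hcont : Continuous Ys :=
    (continuous_prodExp_smul fun k => (hZ k).continuous).comp
      (f := fun p : unitInterval × (Fin d → ℝ) => ((p.1 : ℝ), p.2)) (by fun_prop)
  have hent : ∀ i j, Continuous fun p => Ys p i j := fun i j => hcont.matrix_elem i j
  obtain ⟨q, hq, hexp, hper⟩ := exists_continuous_log
    (F := fun p => (Ys p 0 0 : ℂ) + Complex.I * (Ys p 0 1 : ℂ))
    ((Complex.continuous_ofReal.comp (hent 0 0)).add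
      (continuous_const.mul (Complex.continuous_ofReal.comp (hent 0 1))))
    (fun p => topRow_ne_zero (hdet p)) (fun a => by simp [hYs, prodExp])
  have hexp' : ∀ θ, Complex.exp (q θ) = prodExp Z θ 0 0 + Complex.I * prodExp Z θ 0 1 :=
    fun θ => by simpa [hYs, prodExp] using hexp θ
  refine ⟨q, fun θ => analyticAt_of_exp hq.continuousAt ?_, hexp', fun θ k => hper _ _ fun t => ?_⟩
  · simp only [hexp']
    have h := analyticAt_prodExp (θ := θ) fun k i j => ((hZ k).1 i j).1 θ trivial
    exact ((Complex.ofRealCLM.analyticAt _).comp (h 0 0)).add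
      (analyticAt_const.mul ((Complex.ofRealCLM.analyticAt _).comp (h 0 1)))
  · have : ∀ j, Z j (fun i => θ i + 2 * (k i : ℝ)) = Z j θ := fun j => by
      ext i i'
      exact_mod_cast ((hZ j).1 i i').2 θ k
    simp only [hYs, prodExp, this]

theorem analyticAt_slopeRe {E : Type*} [NormedAddCommGroup E] [NormedSpace ℝ E]
    {Y : E → Matrix (Fin 2) (Fin 2) ℝ} {x : E} (hdet : (Y x).det = 1)
    (hY : ∀ i j, AnalyticAt ℝ (fun y => Y y i j) x) : AnalyticAt ℝ (fun y => slopeRe (Y y)) x :=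
  (((hY 0 0).mul (hY 1 0)).add ((hY 0 1).mul (hY 1 1))).div
    (((hY 0 0).pow 2).add ((hY 0 1).pow 2)) (sq_add_sq_pos_of_det_eq_one hdet).ne'

/-! ### The quasi-periodic conjugation -/

/-- The conjugation is `U(θ) = metaplectic (q(θ)) (β(θ))` with the coordinates of `Y(θ)`; the
unitary depends on `q` itself and not only on `e^q`, so its periodicity requires that of `q`. -/
theorem exists_quasiperiodic_conjugation {d : ℕ} (ω : Fin d → ℝ)
    (a b c : (Fin d → ℝ) → ℝ)
    (ha : Continuous a) (hb : Continuous b) (hc : Continuous c)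
    (B : Matrix (Fin 2) (Fin 2) ℝ) (hB : B.trace = 0)
    (K : ℕ) (Z : Fin (K + 1) → (Fin d → ℝ) → Matrix (Fin 2) (Fin 2) ℝ)
    (hZ : ∀ j, IsAnalyticSl2OnTorus 2 (Z j))
    (hconj : IsConjugatedBy ω (fun θ => hamMatrix (a θ) (b θ) (c θ)) (fun _ => B) (prodExp Z)) :
    ∃ U : (Fin d → ℝ) → (L2R ≃ₗᵢ[ℂ] L2R),
      (∀ (θ : Fin d → ℝ) (k : Fin d → ℤ), U (fun i => θ i + 2 * (k i : ℝ)) = U θ) ∧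
      (∀ n : ℕ, AnalyticOnNhd ℝ (fun θ => U θ (hermiteL2 n)) Set.univ) ∧
      (∀ s : ℝ, 0 ≤ s → ∃ c' C' : ℝ, 0 < c' ∧ 0 < C' ∧ ∀ (θ : Fin d → ℝ) (ψ : L2R),
        ENNReal.ofReal c' * sobolevNorm s ψ ≤ sobolevNorm s (U θ ψ) ∧
        sobolevNorm s (U θ ψ) ≤ ENNReal.ofReal C' * sobolevNorm s ψ) ∧
      (∀ v : ℝ → L2R,
        IsSolution (fun t => weylOp (a (t • ω)) (b (t • ω)) (c (t • ω)))
          (fun t => U (t • ω) (v t)) ↔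
        IsSolution (fun _ => weylOp (-(B 1 0)) (B 0 0) (B 0 1)) v) := by
  obtain ⟨q, hq, hexp, hper⟩ := exists_log_topRow hZ
  have hdet : ∀ θ, (prodExp Z θ).det = 1 := fun θ => det_prodExp fun j => (hZ j).2 θ
  have hβ : ∀ θ, AnalyticAt ℝ (fun θ => slopeRe (prodExp Z θ)) θ := fun θ =>
    analyticAt_slopeRe (hdet θ) (analyticAt_prodExp fun k i j => ((hZ k).1 i j).1 θ trivial)
  have hqc : Continuous q := continuous_iff_continuousAt.2 fun θ => (hq θ).continuousAt
  have hβc : Continuous fun θ => slopeRe (prodExp Z θ) :=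
    continuous_iff_continuousAt.2 fun θ => (hβ θ).continuousAt
  have hYper : ∀ (θ : Fin d → ℝ) (k : Fin d → ℤ),
      prodExp Z (fun i => θ i + 2 * (k i : ℝ)) = prodExp Z θ := fun θ k => by
    have : ∀ j, Z j (fun i => θ i + 2 * (k i : ℝ)) = Z j θ := fun j => by
      ext i i'
      exact_mod_cast ((hZ j).1 i i').2 θ k
    simp only [prodExp, this]
  have hω : Continuous fun t : ℝ => t • ω := by fun_prop
  refine ⟨fun θ => metaplectic (q θ) (slopeRe (prodExp Z θ)), fun θ k => ?_, fun n θ _ => ?_,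
    fun s hs => ?_, fun v => ?_⟩
  · simp only [hper, hYper]
  · simp only [metaplectic_hermiteL2]
    exact analyticAt_wavepacket (hq θ) (hβ θ) n
  · obtain ⟨R₁, hR₁⟩ := exists_norm_le_of_periodic hqc hper
    obtain ⟨R₂, hR₂⟩ := exists_norm_le_of_periodic hβc fun θ k => by simp only [hYper]
    obtain ⟨C, hC, h⟩ := exists_sobolevNorm_metaplectic_le hs (max R₁ R₂)
    refine ⟨C⁻¹, C, inv_pos.2 hC, hC, fun θ ψ => ?_⟩
    obtain ⟨h1, h2⟩ := h (q θ) (slopeRe (prodExp Z θ)) ((hR₁ θ).trans (le_max_left _ _))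
      ((hR₂ θ).trans (le_max_right _ _)) ψ
    refine ⟨?_, h1⟩
    rw [ENNReal.ofReal_inv_of_pos hC, ENNReal.inv_mul_le_iff (ENNReal.ofReal_pos.2 hC).ne'
      ENNReal.ofReal_ne_top]
    exact h2
  · have hqt : Differentiable ℝ fun t : ℝ => q (t • ω) := fun t =>
      ((hq (t • ω)).differentiableAt).comp t (by fun_prop : DifferentiableAt ℝ (fun t => t • ω) t)
    exact isSolution_metaplectic_iff (ha.comp hω) (hb.comp hω) (hc.comp hω) (hqc.comp hω)
      (hβc.comp hω) (fun n t => hasDerivAt_wavepacket_of_conj (Y := fun t => prodExp Z (t • ω))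
        (q := fun t => q (t • ω)) hB (fun τ => hdet _) (fun τ => hexp _) (hqt t) (hconj t) n) v

theorem unitarilyEquivalent_refl (S : L2R →ₗ.[ℂ] L2R) : UnitarilyEquivalent S S :=
  ⟨LinearIsometryEquiv.refl ℂ L2R, fun _ _ => Iff.rfl⟩

end

theorem theorem3p1 {d : ℕ} (ω : Fin d → ℝ)
    (a b c : (Fin d → ℝ) → ℝ)
    (ha : IsAnalyticOnTorus 1 a) (hb : IsAnalyticOnTorus 1 b) (hc : IsAnalyticOnTorus 1 c)
    (B : Matrix (Fin 2) (Fin 2) ℝ) (hB : B.trace = 0)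
    (K : ℕ) (Z : Fin (K + 1) → (Fin d → ℝ) → Matrix (Fin 2) (Fin 2) ℝ)
    (hZ : ∀ j, IsAnalyticSl2OnTorus 2 (Z j))
    (hconj : IsConjugatedBy ω (fun θ => hamMatrix (a θ) (b θ) (c θ)) (fun _ => B) (prodExp Z)) :
    -- time quasi-periodic unitary maps `U(ωt)`, given by a function `U` on `2𝕋^d`
    (∃ U : (Fin d → ℝ) → (L2R ≃ₗᵢ[ℂ] L2R),
      (∀ (θ : Fin d → ℝ) (k : Fin d → ℤ), U (fun i => θ i + 2 * (k i : ℝ)) = U θ) ∧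
      -- analytic dependence, on the total set of Hermite functions
      (∀ n : ℕ, AnalyticOnNhd ℝ (fun θ => U θ (hermiteL2 n)) Set.univ) ∧
      -- equivalence of the norms of `𝓗^s`, uniformly on the torus
      (∀ s : ℝ, 0 ≤ s → ∃ c' C' : ℝ, 0 < c' ∧ 0 < C' ∧ ∀ (θ : Fin d → ℝ) (ψ : L2R),
        ENNReal.ofReal c' * sobolevNorm s ψ ≤ sobolevNorm s (U θ ψ) ∧
        sobolevNorm s (U θ ψ) ≤ ENNReal.ofReal C' * sobolevNorm s ψ) ∧
      -- `u = U(ωt) v` conjugates `i ∂_t u = L^W(ωt) u` to `i ∂_t v = G v`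
      (∀ v : ℝ → L2R,
        IsSolution (fun t => weylOp (a (t • ω)) (b (t • ω)) (c (t • ω)))
          (fun t => U (t • ω) (v t)) ↔
        IsSolution (fun _ => weylOp (-(B 1 0)) (B 0 0) (B 0 1)) v)) ∧
    -- the unitary type of `G`
    ((0 < B.det ∨ B = 0) →
      UnitarilyEquivalent (l2Op (weylOp (-(B 1 0)) (B 0 0) (B 0 1)))
        (l2Op (((Real.sign (B 0 1) * (Real.sqrt B.det / 2) : ℝ) : ℂ) • harmonicOp))) ∧
    (B.det < 0 →
      UnitarilyEquivalent (l2Op (weylOp (-(B 1 0)) (B 0 0) (B 0 1)))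
        (l2Op (((Real.sqrt (-B.det) / 2 : ℝ) : ℂ) • dilationOp))) ∧
    (∀ κ : ℝ, κ ≠ 0 →
      (∃ P : Matrix.SpecialLinearGroup (Fin 2) ℝ,
        B = (P : Matrix (Fin 2) (Fin 2) ℝ) * !![0, 0; κ, 0] *
          ((P⁻¹ : Matrix.SpecialLinearGroup (Fin 2) ℝ) : Matrix (Fin 2) (Fin 2) ℝ)) →
      UnitarilyEquivalent (l2Op (weylOp (-(B 1 0)) (B 0 0) (B 0 1)))
        (l2Op (((-(κ / 2) : ℝ) : ℂ) • squareOp))) := by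
  have hBham := eq_hamMatrix hB
  have hdet : -(B 1 0) * B 0 1 - B 0 0 ^ 2 = B.det := by
    conv_rhs => rw [hBham, det_hamMatrix]
  refine ⟨exists_quasiperiodic_conjugation ω a b c ha.continuous hb.continuous hc.continuous B hB
    K Z hZ hconj, fun h => ?_, fun h => ?_, fun κ _ h => ?_⟩
  · rcases h with h | rfl
    · have h1 := unitarilyEquivalent_elliptic (a := -(B 1 0)) (b := B 0 0) (c := B 0 1)
        (by rwa [hdet])
      rwa [hdet, weylOp_diag, mul_div_assoc] at h1
    · have h0 : weylOp (-((0 : Matrix (Fin 2) (Fin 2) ℝ) 1 0)) ((0 : Matrix (Fin 2) (Fin 2) ℝ) 0 0)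
          ((0 : Matrix (Fin 2) (Fin 2) ℝ) 0 1) = ((0 / 2 : ℝ) : ℂ) • harmonicOp := by
        rw [← weylOp_diag]; simp
      rw [h0]
      simpa using unitarilyEquivalent_refl _
  · have h1 := unitarilyEquivalent_hyperbolic (a := -(B 1 0)) (b := B 0 0) (c := B 0 1)
      (by rwa [hdet])
    rwa [hdet, weylOp_offDiag] at h1
  · obtain ⟨P, hP⟩ := h
    rw [← weylOp_pos]
    refine unitarilyEquivalent_of_conj (Y := ((P⁻¹ : Matrix.SpecialLinearGroup (Fin 2) ℝ) :
      Matrix (Fin 2) (Fin 2) ℝ)) (P⁻¹).2 ?_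
    have h1 : ((P⁻¹ : Matrix.SpecialLinearGroup (Fin 2) ℝ) : Matrix (Fin 2) (Fin 2) ℝ) *
        (P : Matrix (Fin 2) (Fin 2) ℝ) = 1 := by
      rw [← Matrix.SpecialLinearGroup.coe_mul, inv_mul_cancel, Matrix.SpecialLinearGroup.coe_one]
    have h2 : hamMatrix (-κ) 0 0 = !![0, 0; κ, 0] := by simp [hamMatrix]
    rw [← hBham, hP, ← Matrix.mul_assoc, ← Matrix.mul_assoc, h1, Matrix.one_mul, h2]
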